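/- **Setting.** Let $N\ge 1$, $d\ge 0$, $r\ge 0$ be integers. A *dyadic lattice* $\mathcal D=\bigcup_{k\in\mathbb Z}\mathcal D_k$ in $\mathbb R^N$ is a family of half-open cubes such that each $\mathcal D_k$ is a regular grid of cubes of side length $2^{k}$ tiling $\mathbb R^N$ and every cube of $\mathcal D_{k+1}$ is a union of $2^N$ cubes of $\mathcal D_k$ (all translates of the standard dyadic lattice are included). For $Q\in\mathcal D_k$ let $\operatorname{ch}^n Q=\{R\in\mathcal D_{k-n}:R\subset Q\}$, $\operatorname{ch}=\operatorname{ch}^1$; $\langle h\rangle_Q=|Q|^{-1}\int_Q h$; and $\Delta_Rb=\sum_{R'\in\operatorname{ch}R}\langle b\rangle_{R'}\mathbf 1_{R'}-\langle b\rangle_R\mathbf 1_R$. A *big Haar shift of complexity $r$* is a bounded operator $T=\sum_{Q\in\mathcal D}T_Q$ on $L^2(\mathbb R^N)$ (real-valued functions, the series $\sum_Q T_Qf$ converging unconditionally to $Tf$ in $L^2$ for every $f\in L^2$), $T_Qf(x)=\int K_Q(x,y)f(y)\,dy$, where the real kernel $K_Q$ vanishes off $Q\times Q$, is constant on $R\times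 S$ for all $R,S\in\operatorname{ch}^{r+1}Q$, satisfies $|K_Q|\le |Q|^{-1}$, and $T_Q\mathbf 1_Q=0$, $T_Q^*\mathbf 1_Q=0$. The *paraproduct of order $r$* with symbol $b\in L^1_{\mathrm{loc}}(\mathbb R^N)$ is $\Pi^r_b=\sum_{Q\in\mathcal D}T_Q$ (in the same sense, assumed bounded on $L^2$) with $T_Qf=\langle f\rangle_Q\sum_{R\in\operatorname{ch}^rQ}\Delta_Rb$. Such a $T=\sum_Q T_Q$ is *$r$-separated* if there is $k\in\{0,\dots,r\}$ such that $T_Q\neq0$ only for $Q\in\bigcup_{j\in\mathbb Z}\mathcal D_{k+(r+1)j}$. For $f\in L^1(\mathbb R^N;\mathbb R^d)$ put $\langle\!\langle f\rangle\!\rangle_Q=\{\langle\varphi f\rangle_Q:\varphi:Q\to\mathbb R,\ \|\varphi\|_\infty\le1\}$. A family $\mathcal S\subset\mathcal D$ is *$\varepsilon$-sparse* if $\sum_{R\in\operatorname{ch}_{\mathcal S}Q}|R|\le\varepsilon|Q|$ for every $Q\in\mathcal S$, where $\operatorname{ch}_{\mathcal S}Q$ is the set of maximal cubes $R\in\mathcal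 S$ with $R\subsetneq Q$. Let $\mathbf L_{\mathcal S}f(x)=\sum_{Q\in\mathcal S}\langle\!\langle f\rangle\!\rangle_Q\mathbf 1_Q(x)$ (Minkowski sum, i.e. the set of all sums of unconditionally convergent series $\sum_{Q\in\mathcal S} v_Q$ with $v_Q\in\langle\!\langle f\rangle\!\rangle_Q\mathbf 1_Q(x)$). **Theorem.** Let $N\ge 1$, $d\ge 0$ and $\varepsilon\in(0,1)$. There is a constant $C=C(N,d,\varepsilon)>0$ such that the following holds for every dyadic lattice $\mathcal D$ and every $r\ge0$. Let $T$ be $r$-separated and either a big Haar shift of complexity $r$, or a paraproduct $\Pi_b^r$ of order $r$ with $\|\Pi_b^r\|_{L^2\to L^2}\le2^{-Nr/2}$. Then for every compactly supported $f\in L^1(\mathbb R^N;\mathbb R^d)$ the function $Tf$ is well defined, that is, there is a function $Tf:\mathbb R^N\to\mathbb R^d$ such that for each coordinate $i$ and each sequence $u_n\in L^2(\mathbb R^N)$ with $\|u_n-f_i\|_{L^1}\to0$ one has $Tu_n\to(Tf)_i$ in measure; and there is an $\varepsilon$-sparse family $\mathcal S\subset\mathcal D$ such that $$Tf(x)\in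 C\,\mathbf L_{\mathcal S}f(x)\qquad\text{for a.e. }x\in\mathbb R^N .$$ -/

import Mathlib

open MeasureTheory Filter Topology
open scoped Pointwise ENNReal

noncomputable section

namespace ConvexBody

/-- Labels of dyadic cubes in `ℝ^N`: the cube with label `Q` has side length `2 ^ Q.scale`, and
`Q.pos` is its position in the grid of cubes of that side length. -/
structure Cube (N : ℕ) where
  scale : ℤ
  pos : Fin N → ℤ

/-- A dyadic lattice in `ℝ^N`. For every integer `k` the cubes of side length `2 ^ k` form the
regular grid that has a vertex at `origin k`; the condition `nested` says that the grid of side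
length `2 ^ k` refines the grid of side length `2 ^ (k + 1)`. If `origin` is constant, this is a
translate of the standard dyadic lattice. -/
structure DyadicLattice (N : ℕ) where
  origin : ℤ → Fin N → ℝ
  nested : ∀ k i, ∃ m : ℤ, origin (k + 1) i = origin k i + (2 : ℝ) ^ k * m

namespace DyadicLattice

variable {N : ℕ} (D : DyadicLattice N)

/-- The half-open cube with label `Q`. -/
def toSet (Q : Cube N) : Set (Fin N → ℝ) :=
  {x | ∀ i, D.origin Q.scale i + (2 : ℝ) ^ Q.scale * Q.pos i ≤ x i ∧
    x i < D.origin Q.scale i + (2 : ℝ) ^ Q.scale * (Q.pos i + 1)}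

/-- `ch^n Q`: the dyadic subcubes of `Q` of side length `2 ^ (-n)` times that of `Q`. -/
def ch (n : ℕ) (Q : Cube N) : Set (Cube N) :=
  {R | R.scale = Q.scale - n ∧ D.toSet R ⊆ D.toSet Q}

/-- `ch_S Q`: the maximal cubes of the family `S` that are strictly contained in `Q`. -/
def chIn (S : Set (Cube N)) (Q : Cube N) : Set (Cube N) :=
  {R | R ∈ S ∧ D.toSet R ⊂ D.toSet Q ∧
    ∀ P ∈ S, D.toSet P ⊂ D.toSet Q → D.toSet R ⊆ D.toSet P → P = R}

/-- `S` is `ε`-sparse: `∑_{R ∈ ch_S Q} |R| ≤ ε |Q|` for all `Q ∈ S`. -/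
def IsSparse (ε : ℝ) (S : Set (Cube N)) : Prop :=
  ∀ Q ∈ S, ∑' R : D.chIn S Q, volume (D.toSet (R : Cube N)) ≤
    ENNReal.ofReal ε * volume (D.toSet Q)

/-- The martingale difference `Δ_R b = ∑_{R' ∈ ch R} ⟨b⟩_{R'} 1_{R'} - ⟨b⟩_R 1_R`. -/
def martDiff (b : (Fin N → ℝ) → ℝ) (R : Cube N) (x : Fin N → ℝ) : ℝ :=
  (∑ᶠ R' ∈ D.ch 1 R, (D.toSet R').indicator (fun _ => ⨍ y in D.toSet R', b y) x) -
    (D.toSet R).indicator (fun _ => ⨍ y in D.toSet R, b y) x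

/-- The conditions on the kernels `K_Q` of a big Haar shift `∑_Q T_Q` of complexity `r`, where
`T_Q f(x) = ∫ K_Q(x,y) f(y) dy`. The last two fields are `T_Q 1_Q = 0` and `T_Q^* 1_Q = 0`. -/
structure IsBigHaarKernel (r : ℕ) (K : Cube N → (Fin N → ℝ) → (Fin N → ℝ) → ℝ) : Prop where
  support : ∀ Q x y, ¬ (x ∈ D.toSet Q ∧ y ∈ D.toSet Q) → K Q x y = 0
  const : ∀ Q, ∀ R ∈ D.ch (r + 1) Q, ∀ S ∈ D.ch (r + 1) Q,
    ∀ x ∈ D.toSet R, ∀ x' ∈ D.toSet R, ∀ y ∈ D.toSet S, ∀ y' ∈ D.toSet S,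
      K Q x y = K Q x' y'
  bound : ∀ Q x y, |K Q x y| ≤ (volume.real (D.toSet Q))⁻¹
  cancel_right : ∀ Q x, ∫ y in D.toSet Q, K Q x y = 0
  cancel_left : ∀ Q y, ∫ x in D.toSet Q, K Q x y = 0

/-- The operators `f ↦ ⟨f⟩_Q ∑_{R ∈ ch^r Q} Δ_R b`, whose sum over `Q` is the paraproduct
`Π_b^r`. -/
def paraPiece (r : ℕ) (b : (Fin N → ℝ) → ℝ) (Q : Cube N) (f : (Fin N → ℝ) → ℝ)
    (x : Fin N → ℝ) : ℝ :=
  (⨍ y in D.toSet Q, f y) * ∑ᶠ R ∈ D.ch r Q, D.martDiff b R x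

end DyadicLattice

/-- The operators `T_Q f(x) = ∫ K_Q(x,y) f(y) dy`. -/
def kernelPiece {N : ℕ} (K : Cube N → (Fin N → ℝ) → (Fin N → ℝ) → ℝ) (Q : Cube N)
    (f : (Fin N → ℝ) → ℝ) (x : Fin N → ℝ) : ℝ :=
  ∫ y, K Q x y * f y

/-- `T = ∑_Q t_Q` as a bounded operator on `L²(ℝ^N)`: for every `f ∈ L²` the (unordered) series
`∑_Q t_Q f` converges to `T f` in `L²`. -/
def IsL2Sum {N : ℕ}
    (T : Lp ℝ 2 (volume : Measure (Fin N → ℝ)) →L[ℝ] Lp ℝ 2 (volume : Measure (Fin N → ℝ)))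
    (t : Cube N → ((Fin N → ℝ) → ℝ) → (Fin N → ℝ) → ℝ) : Prop :=
  ∀ f : Lp ℝ 2 (volume : Measure (Fin N → ℝ)),
    Tendsto (fun s : Finset (Cube N) =>
      eLpNorm (fun x => T f x - ∑ Q ∈ s, t Q f x) 2 volume) atTop (𝓝 0)

/-- `r`-separation: there is `k ∈ {0, …, r}` such that `t_Q ≠ 0` only for cubes `Q` whose scale
is of the form `k + (r + 1) j`, `j ∈ ℤ`. -/
def IsSeparated {N : ℕ} (r : ℕ) (t : Cube N → ((Fin N → ℝ) → ℝ) → (Fin N → ℝ) → ℝ) : Prop :=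
  ∃ k : ℕ, k ≤ r ∧ ∀ Q : Cube N, t Q ≠ 0 → ∃ j : ℤ, Q.scale = k + (r + 1) * j

/-- `g = T f` for `f ∈ L¹(ℝ^N)`, where `T` is extended from `L¹ ∩ L²` to `L¹` by continuity:
whenever `u n ∈ L²` and `u n → f` in `L¹`, the functions `T (u n)` converge to `g` in measure. -/
def IsL1Value {N : ℕ}
    (T : Lp ℝ 2 (volume : Measure (Fin N → ℝ)) →L[ℝ] Lp ℝ 2 (volume : Measure (Fin N → ℝ)))
    (f g : (Fin N → ℝ) → ℝ) : Prop :=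
  ∀ u : ℕ → Lp ℝ 2 (volume : Measure (Fin N → ℝ)),
    Tendsto (fun n => eLpNorm (fun x => u n x - f x) 1 volume) atTop (𝓝 0) →
      TendstoInMeasure volume (fun n x => T (u n) x) atTop g

/-- `g = (T ⊗ I_d) f` for `f ∈ L¹(ℝ^N; ℝ^d)`: the operator acts on each coordinate. -/
def IsVectorL1Value {N d : ℕ}
    (T : Lp ℝ 2 (volume : Measure (Fin N → ℝ)) →L[ℝ] Lp ℝ 2 (volume : Measure (Fin N → ℝ)))
    (f g : (Fin N → ℝ) → EuclideanSpace ℝ (Fin d)) : Prop :=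
  ∀ i : Fin d, IsL1Value T (fun x => f x i) (fun x => g x i)

/-- The convex body valued average `⟪f⟫_Q = {⟨φ f⟩_Q : φ : Q → ℝ, ‖φ‖_∞ ≤ 1}`. -/
def bodyAverage {N d : ℕ} (f : (Fin N → ℝ) → EuclideanSpace ℝ (Fin d))
    (Q : Set (Fin N → ℝ)) : Set (EuclideanSpace ℝ (Fin d)) :=
  {v | ∃ φ : (Fin N → ℝ) → ℝ, AEStronglyMeasurable φ (volume.restrict Q) ∧
    (∀ᵐ x ∂volume.restrict Q, |φ x| ≤ 1) ∧ v = ⨍ x in Q, φ x • f x}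

/-- The Minkowski sum of a family of sets: all sums of convergent series `∑ v i` with
`v i ∈ A i`. -/
def minkowskiSum {ι E : Type*} [AddCommMonoid E] [TopologicalSpace E] (A : ι → Set E) : Set E :=
  {s | ∃ v : ι → E, (∀ i, v i ∈ A i) ∧ HasSum v s}

/-- The convex body valued sparse operator `L_S f(x) = ∑_{Q ∈ S} 1_Q(x) ⟪f⟫_Q`. -/
def sparseOp {N d : ℕ} (D : DyadicLattice N) (S : Set (Cube N))
    (f : (Fin N → ℝ) → EuclideanSpace ℝ (Fin d)) (x : Fin N → ℝ) :
    Set (EuclideanSpace ℝ (Fin d)) :=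
  minkowskiSum fun Q : S =>
    (D.toSet (Q : Cube N)).indicator (fun _ => (1 : ℝ)) x • bodyAverage f (D.toSet (Q : Cube N))

end ConvexBody

end

/-! ### Dyadic cubes as labels, and partitions of space into cubes. -/

namespace ConvexBody

/-! Both kinds of operator are sums of pieces `T_Q` whose outputs have mean zero on `Q` and are
constant on the cubes `r + 1` generations below `Q`. Separation makes any two different scales in
use differ by at least `r + 1`, so a smaller piece sees the output of a larger one as a constant.
Hence the outputs are orthogonal and no constant depends on `r`. The common framework is `IsShift`,
reached through `exists_isShift`; for paraproducts the norm assumption, tested on `1_Q`, bounds the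
kernel by `2 ^ N / |Q|`.

The analytic input is the weak type (1,1) bound `weak_type` for finite partial sums. In the
Calderón–Zygmund decomposition, off the exceptional set, a stopping cube contributes to `T_Q` only
if it lies at least one and at most `r` generations below `Q`; by separation there is at most one
such `Q`. This bound extends `T` to `L¹` (`IsShift.exists_isL1Value`). It also controls truncated
sums on disjoint cubes, because there the truncations agree with one single partial sum
(`IsShift.tsum_volume_chainSum_le`).

For a cube `P`, an approximate Auerbach basis of `⟪f⟫_P` reduces the vector problem to at most `d`
scalar functions whose absolute values have average at most 2 on `P`. Membership in a multiple of
`⟪f⟫_P` then only requires bounds on the coordinates. One stops at the maximal cubes where some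
coordinate has average above `t`, or where the sum from `P` down to the cube exceeds `t`. For large
`t` these cubes cover at most `ε |P|`, and above them the sum of the pieces lies in a multiple of
`⟪f⟫_P` (`IsShift.exists_stopCubes`). Iteration gives the lower half of the sparse family.

A lattice need not have a cube containing the support of `f`. Above a scale beyond which the cubes
meeting the support no longer merge, every `m`-th scale is taken, with `2 ^ (-m) ≤ ε`; the crude
kernel bound puts each block of `m` scales into a multiple of one average, and the blocks sum
geometrically (`IsShift.exists_hasSum_large`). Since `T f` is the a.e. limit of a subsequence of the
truncated sums, the two halves add up to the claim in `IsShift.exists_sparse`. -/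

theorem Cube.ext' {N : ℕ} {P Q : Cube N} (h : P.scale = Q.scale) (h' : P.pos = Q.pos) : P = Q := by
  cases P; cases Q; simp_all

instance {N : ℕ} : Countable (Cube N) :=
  Function.Injective.countable (f := fun Q : Cube N => (Q.scale, Q.pos)) fun P Q h => by
    simp only [Prod.mk.injEq] at h
    exact Cube.ext' h.1 h.2

namespace DyadicLattice

variable {N : ℕ} (D : DyadicLattice N)

/-- The cube of scale `k` that contains the point `x`. -/
noncomputable def cubeAt (k : ℤ) (x : Fin N → ℝ) : Cube N :=
  ⟨k, fun i => ⌊(x i - D.origin k i) / (2 : ℝ) ^ k⌋⟩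

@[simp] theorem cubeAt_scale (k : ℤ) (x : Fin N → ℝ) : (D.cubeAt k x).scale = k := rfl

/-- Membership becomes an equation between labels; containment and disjointness of cubes are then
handled by rewriting with `cubeAt`. -/
theorem mem_toSet_iff {Q : Cube N} {x : Fin N → ℝ} : x ∈ D.toSet Q ↔ D.cubeAt Q.scale x = Q := by
  have h2 : (0 : ℝ) < 2 ^ Q.scale := by positivity
  have key : x ∈ D.toSet Q ↔ ∀ i, ⌊(x i - D.origin Q.scale i) / (2 : ℝ) ^ Q.scale⌋ = Q.pos i := by
    simp only [toSet, Set.mem_ofPred_eq]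
    refine forall_congr' fun i => ?_
    rw [Int.floor_eq_iff, le_div_iff₀ h2, div_lt_iff₀ h2]
    constructor <;> rintro ⟨h, h'⟩ <;> constructor <;> linarith
  rw [key]
  constructor
  · intro h
    exact Cube.ext' rfl (funext h)
  · intro h i
    exact congrFun (congrArg Cube.pos h) i

theorem mem_cubeAt (k : ℤ) (x : Fin N → ℝ) : x ∈ D.toSet (D.cubeAt k x) := by
  rw [mem_toSet_iff]; rfl

theorem mem_cubeAt_iff {k : ℤ} {x y : Fin N → ℝ} :
    y ∈ D.toSet (D.cubeAt k x) ↔ D.cubeAt k y = D.cubeAt k x := by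
  rw [mem_toSet_iff]; rfl

theorem cubeAt_mono {k l : ℤ} (hkl : k ≤ l) {x y : Fin N → ℝ} (h : D.cubeAt k x = D.cubeAt k y) :
    D.cubeAt l x = D.cubeAt l y := by
  induction l, hkl using Int.leInduction with
  | base => exact h
  | succ l _ ih =>
    refine Cube.ext' rfl (funext fun i => ?_)
    have hi := congrFun (congrArg Cube.pos ih) i
    simp only [cubeAt] at hi ⊢
    obtain ⟨m, hm⟩ := D.nested l i
    have h2 : (0 : ℝ) < 2 ^ l := by positivity
    -- The coarse label is a function of the fine one: shift by the integer `m` from `nested`, then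
    -- halve and round down.
    have key : ∀ z : ℝ, ⌊(z - D.origin (l + 1) i) / (2 : ℝ) ^ (l + 1)⌋ =
        (⌊(z - D.origin l i) / (2 : ℝ) ^ l⌋ - m) / 2 := by
      intro z
      have : (z - D.origin (l + 1) i) / (2 : ℝ) ^ (l + 1) =
          ((z - D.origin l i) / (2 : ℝ) ^ l - m) / (2 : ℕ) := by
        rw [hm, zpow_add₀ two_ne_zero, zpow_one]
        field_simp
        push_cast
        ring
      rw [this, Int.floor_div_natCast, Int.floor_sub_intCast]
      rfl
    rw [key, key, hi]

theorem toSet_nonempty (Q : Cube N) : (D.toSet Q).Nonempty := by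
  have h2 : (0 : ℝ) < 2 ^ Q.scale := by positivity
  refine ⟨fun i => D.origin Q.scale i + (2 : ℝ) ^ Q.scale * Q.pos i, fun i => ⟨le_rfl, ?_⟩⟩
  nlinarith

theorem exists_cubeAt_eq (Q : Cube N) : ∃ x, x ∈ D.toSet Q ∧ D.cubeAt Q.scale x = Q := by
  obtain ⟨x, hx⟩ := D.toSet_nonempty Q
  exact ⟨x, hx, D.mem_toSet_iff.1 hx⟩

theorem toSet_subset_of_mem {P Q : Cube N} (h : P.scale ≤ Q.scale) {x : Fin N → ℝ}
    (hP : x ∈ D.toSet P) (hQ : x ∈ D.toSet Q) : D.toSet P ⊆ D.toSet Q := by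
  intro y hy
  rw [mem_toSet_iff] at *
  rw [← hQ]
  exact D.cubeAt_mono h (hy.trans hP.symm)

theorem cubeAt_subset {k l : ℤ} (h : k ≤ l) (x : Fin N → ℝ) :
    D.toSet (D.cubeAt k x) ⊆ D.toSet (D.cubeAt l x) :=
  D.toSet_subset_of_mem (by simpa using h) (D.mem_cubeAt k x) (D.mem_cubeAt l x)

theorem toSet_eq_pi (Q : Cube N) : D.toSet Q = Set.univ.pi fun i =>
    Set.Ico (D.origin Q.scale i + (2 : ℝ) ^ Q.scale * Q.pos i)
      (D.origin Q.scale i + (2 : ℝ) ^ Q.scale * (Q.pos i + 1)) := by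
  ext x; simp [toSet]

theorem measurableSet_toSet (Q : Cube N) : MeasurableSet (D.toSet Q) := by
  rw [toSet_eq_pi]
  exact MeasurableSet.univ_pi fun i => measurableSet_Ico

theorem volume_toSet (Q : Cube N) :
    volume (D.toSet Q) = ENNReal.ofReal (((2 : ℝ) ^ Q.scale) ^ N) := by
  rw [toSet_eq_pi, Real.volume_pi_Ico, ENNReal.ofReal_pow (by positivity)]
  have : ∀ i : Fin N, D.origin Q.scale i + (2 : ℝ) ^ Q.scale * (Q.pos i + 1) -
    (D.origin Q.scale i + (2 : ℝ) ^ Q.scale * Q.pos i) = 2 ^ Q.scale := fun i => by ring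
  simp [this]

theorem volume_toSet_ne_top (Q : Cube N) : volume (D.toSet Q) ≠ ∞ := by
  rw [volume_toSet]; exact ENNReal.ofReal_ne_top

theorem volume_toSet_ne_zero (Q : Cube N) : volume (D.toSet Q) ≠ 0 := by
  rw [volume_toSet]
  have : (0 : ℝ) < (2 ^ Q.scale) ^ N := by positivity
  simpa using this

theorem volume_real_toSet (Q : Cube N) :
    volume.real (D.toSet Q) = ((2 : ℝ) ^ Q.scale) ^ N := by
  rw [Measure.real, volume_toSet, ENNReal.toReal_ofReal (by positivity)]

theorem volume_real_toSet_pos (Q : Cube N) : 0 < volume.real (D.toSet Q) := by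
  rw [volume_real_toSet]; positivity

/-- Compare volumes. In dimension 0 every cube is the whole one-point space, so the scale can be
read off the set only when `1 ≤ N`. -/
theorem scale_le_of_subset (hN : 1 ≤ N) {P Q : Cube N} (h : D.toSet P ⊆ D.toSet Q) :
    P.scale ≤ Q.scale := by
  have h1 := measureReal_mono h (D.volume_toSet_ne_top Q)
  rw [volume_real_toSet, volume_real_toSet] at h1
  have h2 := le_of_pow_le_pow_left₀ (by omega) (by positivity) h1
  exact (zpow_le_zpow_iff_right₀ one_lt_two).1 h2

theorem eq_of_mem {P Q : Cube N} (h : P.scale = Q.scale) {x : Fin N → ℝ}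
    (hP : x ∈ D.toSet P) (hQ : x ∈ D.toSet Q) : P = Q := by
  rw [mem_toSet_iff] at hP hQ
  rw [← hP, ← hQ, h]

theorem toSet_injective (hN : 1 ≤ N) : Function.Injective D.toSet := by
  intro P Q h
  obtain ⟨x, hx⟩ := D.toSet_nonempty P
  exact D.eq_of_mem (le_antisymm (D.scale_le_of_subset hN h.le) (D.scale_le_of_subset hN h.ge)) hx
    (h ▸ hx)

theorem scale_lt_of_ssubset (hN : 1 ≤ N) {P Q : Cube N} (h : D.toSet P ⊂ D.toSet Q) :
    P.scale < Q.scale := by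
  refine lt_of_le_of_ne (D.scale_le_of_subset hN h.subset) fun he => h.ne ?_
  obtain ⟨x, hx⟩ := D.toSet_nonempty P
  rw [D.eq_of_mem he hx (h.subset hx)]

theorem ssubset_of_scale_lt (hN : 1 ≤ N) {P Q : Cube N} (h : D.toSet P ⊆ D.toSet Q)
    (h' : P.scale < Q.scale) : D.toSet P ⊂ D.toSet Q := by
  refine h.ssubset_of_ne fun he => h'.ne ?_
  rw [D.toSet_injective hN he]

theorem subset_or_disjoint {P Q : Cube N} (h : P.scale ≤ Q.scale) :
    D.toSet P ⊆ D.toSet Q ∨ Disjoint (D.toSet P) (D.toSet Q) := by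
  by_cases hd : Disjoint (D.toSet P) (D.toSet Q)
  · exact .inr hd
  · obtain ⟨x, hP, hQ⟩ := Set.not_disjoint_iff.1 hd
    exact .inl (D.toSet_subset_of_mem h hP hQ)

/-- Such a set is a union of cubes, and there are only countably many cubes. All measurability of
stopping scales and kernels comes from here. -/
theorem measurableSet_of_cubeAt {U : Set (Fin N → ℝ)} {j : ℤ}
    (h : ∀ x y, D.cubeAt j x = D.cubeAt j y → x ∈ U → y ∈ U) : MeasurableSet U := by
  have : U = ⋃ Q ∈ {Q : Cube N | D.toSet Q ⊆ U}, D.toSet Q := by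
    ext x
    simp only [Set.mem_ofPred_eq, Set.mem_iUnion, exists_prop]
    refine ⟨fun hx => ⟨D.cubeAt j x, fun y hy => ?_, D.mem_cubeAt j x⟩, fun ⟨Q, hQ, hx⟩ => hQ hx⟩
    exact h x y (D.mem_cubeAt_iff.1 hy).symm hx
  rw [this]
  exact MeasurableSet.biUnion (Set.to_countable _) fun Q _ => D.measurableSet_toSet Q

theorem measurable_of_cubeAt {β : Type*} [MeasurableSpace β] {φ : (Fin N → ℝ) → β} {j : ℤ}
    (h : ∀ x y, D.cubeAt j x = D.cubeAt j y → φ x = φ y) : Measurable φ := fun s _ =>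
  D.measurableSet_of_cubeAt (j := j) fun x y hxy hx => by
    simpa [Set.mem_preimage, ← h x y hxy] using hx

/-- A partition of `ℝ^N` into dyadic cubes: `J x` is the cube of the partition that contains
the point `x`. -/
structure IsPartition (J : (Fin N → ℝ) → Cube N) : Prop where
  mem : ∀ x, x ∈ D.toSet (J x)
  eq : ∀ x, ∀ y ∈ D.toSet (J x), J y = J x

theorem isPartition_cubeAt (k : ℤ) : D.IsPartition (D.cubeAt k) :=
  ⟨D.mem_cubeAt k, fun _ _ hy => D.mem_cubeAt_iff.1 hy⟩

variable {D}

theorem IsPartition.eq_iUnion {J : (Fin N → ℝ) → Cube N} (hJ : D.IsPartition J)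
    {U : Set (Fin N → ℝ)} (hU : ∀ x ∈ U, D.toSet (J x) ⊆ U) :
    U = ⋃ Q : (J '' U), D.toSet (Q : Cube N) := by
  ext x
  simp only [Set.mem_iUnion, Subtype.exists, Set.mem_image, exists_prop]
  constructor
  · exact fun hx => ⟨J x, ⟨x, hx, rfl⟩, hJ.mem x⟩
  · rintro ⟨_, ⟨y, hy, rfl⟩, hx⟩
    exact hU y hy hx

theorem IsPartition.pairwise_disjoint {J : (Fin N → ℝ) → Cube N} (hJ : D.IsPartition J)
    (U : Set (Fin N → ℝ)) :
    Pairwise (Function.onFun Disjoint fun Q : (J '' U) => D.toSet (Q : Cube N)) := by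
  rintro ⟨_, x, hx, rfl⟩ ⟨_, y, hy, rfl⟩ hne
  refine Set.disjoint_left.2 fun z hz hz' => hne (Subtype.ext ?_)
  exact (hJ.eq x z hz).symm.trans (hJ.eq y z hz')

theorem IsPartition.setIntegral_congr {E : Type*} [NormedAddCommGroup E] [NormedSpace ℝ E]
    {J : (Fin N → ℝ) → Cube N} (hJ : D.IsPartition J)
    {U : Set (Fin N → ℝ)} (hU : ∀ x ∈ U, D.toSet (J x) ⊆ U) {f g : (Fin N → ℝ) → E}
    (hf : IntegrableOn f U) (hg : IntegrableOn g U)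
    (h : ∀ x ∈ U, ∫ y in D.toSet (J x), f y = ∫ y in D.toSet (J x), g y) :
    ∫ y in U, f y = ∫ y in U, g y := by
  have hUe := hJ.eq_iUnion hU
  rw [hUe] at hf hg
  rw [hUe, integral_iUnion (fun Q => D.measurableSet_toSet _) (hJ.pairwise_disjoint U) hf,
    integral_iUnion (fun Q => D.measurableSet_toSet _) (hJ.pairwise_disjoint U) hg]
  refine tsum_congr ?_
  rintro ⟨_, x, hx, rfl⟩
  exact h x hx

theorem IsPartition.setLIntegral_mono {J : (Fin N → ℝ) → Cube N} (hJ : D.IsPartition J)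
    {U : Set (Fin N → ℝ)} (hU : ∀ x ∈ U, D.toSet (J x) ⊆ U) {f g : (Fin N → ℝ) → ℝ≥0∞}
    (h : ∀ x ∈ U, ∫⁻ y in D.toSet (J x), f y ≤ ∫⁻ y in D.toSet (J x), g y) :
    ∫⁻ y in U, f y ≤ ∫⁻ y in U, g y := by
  have hUe := hJ.eq_iUnion hU
  rw [hUe, lintegral_iUnion (fun Q => D.measurableSet_toSet _) (hJ.pairwise_disjoint U),
    lintegral_iUnion (fun Q => D.measurableSet_toSet _) (hJ.pairwise_disjoint U)]
  refine ENNReal.tsum_le_tsum ?_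
  rintro ⟨_, x, hx, rfl⟩
  exact h x hx

end DyadicLattice

end ConvexBody

/-! ### Separated shifts and their pieces. -/

namespace ConvexBody

open scoped NNReal

/-- Kernels of an `r`-separated dyadic shift that is cancellative in the output variable: this
covers both big Haar shifts of complexity `r` and paraproducts of order `r`. -/
structure IsShift {N : ℕ} (D : DyadicLattice N) (A : Cube N → ℝ≥0) (r : ℕ) (c : ℤ)
    (K : Cube N → (Fin N → ℝ) → (Fin N → ℝ) → ℝ) : Prop where
  support : ∀ Q x y, K Q x y ≠ 0 → x ∈ D.toSet Q ∧ y ∈ D.toSet Q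
  const : ∀ Q x x' y y', D.cubeAt (Q.scale - (r + 1)) x = D.cubeAt (Q.scale - (r + 1)) x' →
    D.cubeAt (Q.scale - (r + 1)) y = D.cubeAt (Q.scale - (r + 1)) y' → K Q x y = K Q x' y'
  -- The bound may vary with `Q`: paraproducts must be known to be shifts, hence orthogonal sums,
  -- before a uniform bound on their kernels can be derived.
  bound : ∀ Q x y, |K Q x y| ≤ A Q * (volume.real (D.toSet Q))⁻¹
  cancel : ∀ Q y, ∫ x in D.toSet Q, K Q x y = 0
  separated : ∀ Q, K Q ≠ 0 → ∃ j : ℤ, Q.scale = c + (r + 1) * j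

/-- The partial sums `∑_{Q ∈ s} T_Q` of an operator with kernels `K_Q`. -/
noncomputable def partialSum {N : ℕ} (K : Cube N → (Fin N → ℝ) → (Fin N → ℝ) → ℝ)
    (s : Finset (Cube N)) (h : (Fin N → ℝ) → ℝ) (x : Fin N → ℝ) : ℝ :=
  ∑ Q ∈ s, kernelPiece K Q h x

/-- Uniform `L²` bound for the partial sums. -/
def IsL2Contractive {N : ℕ} (K : Cube N → (Fin N → ℝ) → (Fin N → ℝ) → ℝ) : Prop :=
  ∀ (s : Finset (Cube N)) (h : (Fin N → ℝ) → ℝ), MemLp h 2 volume →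
    ∫⁻ x, ‖partialSum K s h x‖ₑ ^ 2 ≤ ∫⁻ x, ‖h x‖ₑ ^ 2

/-- Two scales in the same arithmetic progression of step `r + 1`, one strictly below the other. -/
theorem separated_scale_le {r : ℕ} {c k l : ℤ} (hk : ∃ j : ℤ, k = c + (r + 1) * j)
    (hl : ∃ j : ℤ, l = c + (r + 1) * j) (hkl : k < l) : k ≤ l - (r + 1) := by
  obtain ⟨i, rfl⟩ := hk
  obtain ⟨j, rfl⟩ := hl
  have : i < j := by
    by_contra! h
    have : ((r : ℤ) + 1) * j ≤ (r + 1) * i := by gcongr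
    omega
  have : ((r : ℤ) + 1) * (i + 1) ≤ (r + 1) * j := by gcongr; omega
  linarith

variable {N : ℕ} {D : DyadicLattice N} {A : Cube N → ℝ≥0} {r : ℕ} {c : ℤ}
  {K : Cube N → (Fin N → ℝ) → (Fin N → ℝ) → ℝ}

namespace IsShift

theorem eq_zero_left (hK : IsShift D A r c K) {Q : Cube N} {x : Fin N → ℝ}
    (hx : x ∉ D.toSet Q) (y : Fin N → ℝ) : K Q x y = 0 := by
  by_contra h
  exact hx (hK.support Q x y h).1

theorem eq_zero_right (hK : IsShift D A r c K) {Q : Cube N} (x : Fin N → ℝ) {y : Fin N → ℝ}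
    (hy : y ∉ D.toSet Q) : K Q x y = 0 := by
  by_contra h
  exact hy (hK.support Q x y h).2

theorem measurable_right (hK : IsShift D A r c K) (Q : Cube N) (x : Fin N → ℝ) :
    Measurable (K Q x) :=
  D.measurable_of_cubeAt fun y y' h => hK.const Q x x y y' rfl h

theorem enorm_le (hK : IsShift D A r c K) (Q : Cube N) (x y : Fin N → ℝ) :
    ‖K Q x y‖ₑ ≤ A Q * (volume (D.toSet Q))⁻¹ := by
  have h := hK.bound Q x y
  rw [← Real.norm_eq_abs] at h
  rw [← ofReal_norm]
  refine (ENNReal.ofReal_le_ofReal h).trans ?_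
  rw [ENNReal.ofReal_mul (by positivity), ENNReal.ofReal_inv_of_pos (D.volume_real_toSet_pos Q),
    Measure.real, ENNReal.ofReal_toReal (D.volume_toSet_ne_top Q), ENNReal.ofReal_coe_nnreal]

theorem smul_eq_indicator {E : Type*} [NormedAddCommGroup E] [NormedSpace ℝ E]
    (hK : IsShift D A r c K) (Q : Cube N) (x : Fin N → ℝ) (h : (Fin N → ℝ) → E) :
    (fun y => K Q x y • h y) = (D.toSet Q).indicator fun y => K Q x y • h y := by
  ext y
  by_cases hy : y ∈ D.toSet Q
  · rw [Set.indicator_of_mem hy]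
  · rw [Set.indicator_of_notMem hy, hK.eq_zero_right x hy, zero_smul]

theorem integrable_smul {E : Type*} [NormedAddCommGroup E] [NormedSpace ℝ E]
    (hK : IsShift D A r c K) (Q : Cube N) (x : Fin N → ℝ) {h : (Fin N → ℝ) → E}
    (hh : IntegrableOn h (D.toSet Q)) : Integrable fun y => K Q x y • h y := by
  rw [hK.smul_eq_indicator, integrable_indicator_iff (D.measurableSet_toSet Q)]
  exact hh.bdd_smul (A Q * (volume.real (D.toSet Q))⁻¹)
    (hK.measurable_right Q x).aestronglyMeasurable (.of_forall fun y => hK.bound Q x y)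

theorem integrable_mul (hK : IsShift D A r c K) (Q : Cube N) (x : Fin N → ℝ)
    {h : (Fin N → ℝ) → ℝ} (hh : IntegrableOn h (D.toSet Q)) :
    Integrable fun y => K Q x y * h y := by
  simpa only [smul_eq_mul] using hK.integrable_smul Q x hh

theorem integral_smul_eq {E : Type*} [NormedAddCommGroup E] [NormedSpace ℝ E]
    (hK : IsShift D A r c K) (Q : Cube N) (x : Fin N → ℝ) (h : (Fin N → ℝ) → E) :
    ∫ y, K Q x y • h y = ∫ y in D.toSet Q, K Q x y • h y := by
  conv_lhs => rw [hK.smul_eq_indicator]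
  rw [integral_indicator (D.measurableSet_toSet Q)]

theorem kernelPiece_eq (hK : IsShift D A r c K) (Q : Cube N) (h : (Fin N → ℝ) → ℝ)
    (x : Fin N → ℝ) : kernelPiece K Q h x = ∫ y in D.toSet Q, K Q x y * h y :=
  hK.integral_smul_eq Q x h

theorem kernelPiece_congr (hK : IsShift D A r c K) (Q : Cube N) (h : (Fin N → ℝ) → ℝ)
    {x x' : Fin N → ℝ}
    (hx : D.cubeAt (Q.scale - (r + 1)) x = D.cubeAt (Q.scale - (r + 1)) x') :
    kernelPiece K Q h x = kernelPiece K Q h x' := by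
  unfold kernelPiece
  congr 1 with y
  rw [hK.const Q x x' y y hx rfl]

theorem measurable_kernelPiece (hK : IsShift D A r c K) (Q : Cube N) (h : (Fin N → ℝ) → ℝ) :
    Measurable (kernelPiece K Q h) :=
  D.measurable_of_cubeAt fun _ _ hx => hK.kernelPiece_congr Q h hx

theorem measurable_partialSum (hK : IsShift D A r c K) (s : Finset (Cube N))
    (h : (Fin N → ℝ) → ℝ) : Measurable (partialSum K s h) :=
  Finset.measurable_fun_sum _ fun Q _ => hK.measurable_kernelPiece Q h

theorem kernelPiece_eq_zero (hK : IsShift D A r c K) {Q : Cube N} (h : (Fin N → ℝ) → ℝ)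
    {x : Fin N → ℝ} (hx : x ∉ D.toSet Q) : kernelPiece K Q h x = 0 := by
  simp [kernelPiece, hK.eq_zero_left hx]

theorem kernelPiece_sub (hK : IsShift D A r c K) (Q : Cube N) {h h' : (Fin N → ℝ) → ℝ}
    (hh : IntegrableOn h (D.toSet Q)) (hh' : IntegrableOn h' (D.toSet Q)) (x : Fin N → ℝ) :
    kernelPiece K Q (fun y => h y - h' y) x = kernelPiece K Q h x - kernelPiece K Q h' x := by
  unfold kernelPiece
  rw [← integral_sub (hK.integrable_mul Q x hh) (hK.integrable_mul Q x hh')]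
  congr 1 with y
  ring

theorem partialSum_sub (hK : IsShift D A r c K) (s : Finset (Cube N)) {h h' : (Fin N → ℝ) → ℝ}
    (x : Fin N → ℝ)
    (hi : ∀ Q, IntegrableOn h (D.toSet Q)) (hi' : ∀ Q, IntegrableOn h' (D.toSet Q)) :
    partialSum K s (fun y => h y - h' y) x = partialSum K s h x - partialSum K s h' x := by
  unfold partialSum
  rw [← Finset.sum_sub_distrib]
  exact Finset.sum_congr rfl fun Q _ => hK.kernelPiece_sub Q (hi Q) (hi' Q) x

theorem enorm_kernelPiece_le (hK : IsShift D A r c K) (Q : Cube N) (h : (Fin N → ℝ) → ℝ)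
    (x : Fin N → ℝ) :
    ‖kernelPiece K Q h x‖ₑ ≤ A Q * (volume (D.toSet Q))⁻¹ * ∫⁻ y in D.toSet Q, ‖h y‖ₑ := by
  rw [hK.kernelPiece_eq]
  refine (enorm_integral_le_lintegral_enorm _).trans ?_
  rw [← lintegral_const_mul' _ _ (by
    exact ENNReal.mul_ne_top ENNReal.coe_ne_top
      (ENNReal.inv_ne_top.2 (D.volume_toSet_ne_zero Q)))]
  refine lintegral_mono fun y => ?_
  rw [enorm_mul]
  gcongr
  exact hK.enorm_le Q x y

end IsShift

end ConvexBody

/-! ### Calderón–Zygmund decomposition truncated at a lowest scale. -/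

namespace ConvexBody

open scoped NNReal

variable {N : ℕ} {D : DyadicLattice N} {c : ℤ} {h : (Fin N → ℝ) → ℝ}

theorem eLpNorm_two_sq_eq_lintegral {α E : Type*} [MeasurableSpace α] [NormedAddCommGroup E]
    (μ : Measure α) (f : α → E) : eLpNorm f 2 μ ^ 2 = ∫⁻ x, ‖f x‖ₑ ^ 2 ∂μ := by
  rw [eLpNorm_eq_lintegral_rpow_enorm_toReal two_ne_zero ENNReal.ofNat_ne_top,
    ← ENNReal.rpow_natCast, ← ENNReal.rpow_mul]
  simp

/-- The average of `|h|` over the cube `Q` is larger than `l`. -/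
def DyadicLattice.IsHigh (D : DyadicLattice N) (h : (Fin N → ℝ) → ℝ) (l : ℝ≥0) (Q : Cube N) :
    Prop :=
  l * volume (D.toSet Q) < ∫⁻ y in D.toSet Q, ‖h y‖ₑ

/-- The volume of a cube eventually exceeds `‖h‖₁ / l`, so high cubes have bounded scale and a
largest one exists above each point. -/
theorem exists_scale_not_isHigh (D : DyadicLattice N) (hN : 1 ≤ N) (hh : Integrable h) {l : ℝ≥0}
    (hl : l ≠ 0) : ∃ t : ℤ, ∀ Q : Cube N, t ≤ Q.scale → ¬ D.IsHigh h l Q := by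
  have hM : ∫⁻ y, ‖h y‖ₑ ≠ ∞ := hh.hasFiniteIntegral.ne
  set M := ∫⁻ y, ‖h y‖ₑ with hMdef
  obtain ⟨n, hn⟩ := pow_unbounded_of_one_lt (M.toReal / l) one_lt_two
  have hl' : (0 : ℝ) < l := by positivity
  refine ⟨n, fun Q hQ => ?_⟩
  rw [DyadicLattice.IsHigh, not_lt]
  refine (setLIntegral_le_lintegral _ _).trans ?_
  rw [← hMdef, D.volume_toSet, ← ENNReal.ofReal_toReal hM, ← ENNReal.ofReal_coe_nnreal,
    ← ENNReal.ofReal_mul hl'.le]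
  refine ENNReal.ofReal_le_ofReal ?_
  rw [div_lt_iff₀ hl'] at hn
  have h1 : (2 : ℝ) ^ n ≤ 2 ^ Q.scale := by
    rw [← zpow_natCast]
    exact zpow_le_zpow_right₀ one_le_two hQ
  have h0 : (1 : ℝ) ≤ 2 ^ n := one_le_pow₀ one_le_two
  have h2 : (2 : ℝ) ^ Q.scale ≤ (2 ^ Q.scale) ^ N := le_self_pow₀ (h0.trans h1) (by omega)
  calc M.toReal ≤ 2 ^ n * l := hn.le
    _ ≤ (2 ^ Q.scale) ^ N * l := by gcongr; exact h1.trans h2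
    _ = _ := mul_comm _ _

/-- `τ x` is the scale of the largest cube of scale at least `c` that contains `x` and on which
the average of `|h|` exceeds `l`, and `c` if there is no such cube. -/
structure IsStoppingScale (D : DyadicLattice N) (h : (Fin N → ℝ) → ℝ) (l : ℝ≥0) (c : ℤ)
    (τ : (Fin N → ℝ) → ℤ) : Prop where
  le : ∀ x, c ≤ τ x
  not_isHigh : ∀ x k, τ x < k → ¬ D.IsHigh h l (D.cubeAt k x)
  eq_or : ∀ x, τ x = c ∨ D.IsHigh h l (D.cubeAt (τ x) x)

theorem exists_isStoppingScale (D : DyadicLattice N) (hN : 1 ≤ N) (hh : Integrable h) {l : ℝ≥0}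
    (hl : l ≠ 0) (c : ℤ) : ∃ τ, IsStoppingScale D h l c τ := by
  obtain ⟨t, ht⟩ := exists_scale_not_isHigh D hN hh hl
  have key : ∀ x, ∃ k : ℤ, c ≤ k ∧ (∀ m, k < m → ¬ D.IsHigh h l (D.cubeAt m x)) ∧
      (k = c ∨ D.IsHigh h l (D.cubeAt k x)) := by
    intro x
    by_cases hex : ∃ k : ℤ, c ≤ k ∧ D.IsHigh h l (D.cubeAt k x)
    · obtain ⟨k, ⟨hk, hk'⟩, hmax⟩ := Int.exists_greatest_of_bdd
        (P := fun k : ℤ => c ≤ k ∧ D.IsHigh h l (D.cubeAt k x))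
        ⟨t, fun z hz => by
          by_contra! hlt
          exact ht (D.cubeAt z x) (by simpa using hlt.le) hz.2⟩ hex
      refine ⟨k, hk, fun m hm hm' => ?_, .inr hk'⟩
      have := hmax m ⟨by omega, hm'⟩
      omega
    · push Not at hex
      exact ⟨c, le_rfl, fun m hm => hex m hm.le, .inl rfl⟩
  choose τ h1 h2 h3 using key
  exact ⟨τ, h1, h2, h3⟩

namespace IsStoppingScale

variable {l : ℝ≥0} {τ : (Fin N → ℝ) → ℤ}

/-- If `y` stopped above scale `k`, its high stopping cube would also contain `x`, contradicting
that no cube above the stopping cube of `x` is high. This makes the stopping cubes a partition. -/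
theorem le_of_cubeAt_eq (hτ : IsStoppingScale D h l c τ) {x y : Fin N → ℝ} {k : ℤ} (hk : τ x ≤ k)
    (hxy : D.cubeAt k y = D.cubeAt k x) : τ y ≤ k := by
  by_contra! hlt
  have h1 := hτ.le x
  have h2 := (hτ.eq_or y).resolve_left (by omega)
  rw [D.cubeAt_mono hlt.le hxy] at h2
  exact hτ.not_isHigh x (τ y) (by omega) h2

theorem eq_of_mem (hτ : IsStoppingScale D h l c τ) {x y : Fin N → ℝ}
    (hy : y ∈ D.toSet (D.cubeAt (τ x) x)) : τ y = τ x := by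
  rw [D.mem_cubeAt_iff] at hy
  have h1 := hτ.le_of_cubeAt_eq le_rfl hy
  refine le_antisymm h1 ?_
  by_contra! hlt
  have h2 := hτ.le y
  have h3 := (hτ.eq_or x).resolve_left (by omega)
  rw [← hy] at h3
  exact hτ.not_isHigh y _ hlt h3

theorem eq_of_cubeAt_eq (hτ : IsStoppingScale D h l c τ) {x y : Fin N → ℝ}
    (hy : D.cubeAt c x = D.cubeAt c y) : τ x = τ y :=
  hτ.eq_of_mem (D.mem_cubeAt_iff.2 (D.cubeAt_mono (hτ.le y) hy))

theorem isPartition (hτ : IsStoppingScale D h l c τ) :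
    D.IsPartition fun x => D.cubeAt (τ x) x where
  mem _ := D.mem_cubeAt _ _
  eq _ _ hy := by
    simp only [hτ.eq_of_mem hy]
    exact D.mem_cubeAt_iff.1 hy

end IsStoppingScale

/-- The good part of the Calderón–Zygmund decomposition: averages over the stopping cubes. -/
noncomputable def goodPart (D : DyadicLattice N) (h : (Fin N → ℝ) → ℝ) (τ : (Fin N → ℝ) → ℤ)
    (x : Fin N → ℝ) : ℝ :=
  ⨍ y in D.toSet (D.cubeAt (τ x) x), h y

theorem enorm_setAverage_mul_le (D : DyadicLattice N) (Q : Cube N) (h : (Fin N → ℝ) → ℝ) :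
    ‖⨍ y in D.toSet Q, h y‖ₑ * volume (D.toSet Q) ≤ ∫⁻ y in D.toSet Q, ‖h y‖ₑ := by
  rw [setAverage_eq, enorm_smul, Real.enorm_eq_ofReal (by positivity),
    ENNReal.ofReal_inv_of_pos (D.volume_real_toSet_pos Q), Measure.real,
    ENNReal.ofReal_toReal (D.volume_toSet_ne_top Q), mul_right_comm,
    ENNReal.inv_mul_cancel (D.volume_toSet_ne_zero Q) (D.volume_toSet_ne_top Q), one_mul]
  exact enorm_integral_le_lintegral_enorm _

namespace IsStoppingScale

variable {l : ℝ≥0} {τ : (Fin N → ℝ) → ℤ}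

theorem goodPart_congr (hτ : IsStoppingScale D h l c τ) {x y : Fin N → ℝ}
    (hy : y ∈ D.toSet (D.cubeAt (τ x) x)) : goodPart D h τ y = goodPart D h τ x := by
  have : D.cubeAt (τ y) y = D.cubeAt (τ x) x := hτ.isPartition.eq x y hy
  simp only [goodPart, this]

theorem measurable_goodPart (hτ : IsStoppingScale D h l c τ) : Measurable (goodPart D h τ) :=
  D.measurable_of_cubeAt (j := c) fun _ y hxy =>
    hτ.goodPart_congr (D.mem_cubeAt_iff.2 (D.cubeAt_mono (hτ.le y) hxy))

theorem setLIntegral_goodPart_le (hτ : IsStoppingScale D h l c τ) (x : Fin N → ℝ) :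
    ∫⁻ y in D.toSet (D.cubeAt (τ x) x), ‖goodPart D h τ y‖ₑ ≤
      ∫⁻ y in D.toSet (D.cubeAt (τ x) x), ‖h y‖ₑ := by
  rw [setLIntegral_congr_fun (g := fun _ => ‖goodPart D h τ x‖ₑ) (D.measurableSet_toSet _)
    (fun y hy => by simp only [hτ.goodPart_congr hy]), setLIntegral_const]
  exact enorm_setAverage_mul_le D _ h

theorem lintegral_goodPart_le (hτ : IsStoppingScale D h l c τ) :
    ∫⁻ y, ‖goodPart D h τ y‖ₑ ≤ ∫⁻ y, ‖h y‖ₑ := by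
  have := hτ.isPartition.setLIntegral_mono (U := Set.univ) (fun _ _ => Set.subset_univ _)
    fun x _ => hτ.setLIntegral_goodPart_le x
  simpa using this

theorem integrable_goodPart (hτ : IsStoppingScale D h l c τ) (hh : Integrable h) :
    Integrable (goodPart D h τ) :=
  ⟨hτ.measurable_goodPart.aestronglyMeasurable,
    hτ.lintegral_goodPart_le.trans_lt hh.hasFiniteIntegral⟩

theorem setIntegral_goodPart (hτ : IsStoppingScale D h l c τ) (x : Fin N → ℝ) :
    ∫ y in D.toSet (D.cubeAt (τ x) x), goodPart D h τ y =
      ∫ y in D.toSet (D.cubeAt (τ x) x), h y := by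
  rw [setIntegral_congr_fun (g := fun _ => goodPart D h τ x) (D.measurableSet_toSet _)
    (fun y hy => by simp only [hτ.goodPart_congr hy]), setIntegral_const, goodPart, setAverage_eq,
    smul_smul, mul_inv_cancel₀ (D.volume_real_toSet_pos _).ne', one_smul]

/-- The parent of a stopping cube is not high, and its volume is `2 ^ N` times larger. The bound
holds at every point because low cells at the bottom scale are averaged too, so no differentiation
theorem is involved. -/
theorem enorm_goodPart_le (hτ : IsStoppingScale D h l c τ) (x : Fin N → ℝ) :
    ‖goodPart D h τ x‖ₑ ≤ 2 ^ N * l := by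
  have h1 := enorm_setAverage_mul_le D (D.cubeAt (τ x) x) h
  have h2 := hτ.not_isHigh x (τ x + 1) (by omega)
  rw [DyadicLattice.IsHigh, not_lt] at h2
  have h3 := lintegral_mono_set (μ := volume) (f := fun y => ‖h y‖ₑ)
    (D.cubeAt_subset (show τ x ≤ τ x + 1 by omega) x)
  have h4 : volume (D.toSet (D.cubeAt (τ x + 1) x)) =
      2 ^ N * volume (D.toSet (D.cubeAt (τ x) x)) := by
    simp only [D.volume_toSet, DyadicLattice.cubeAt_scale]
    rw [zpow_add₀ two_ne_zero, zpow_one, mul_pow, mul_comm, ENNReal.ofReal_mul (by positivity),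
      ENNReal.ofReal_pow zero_le_two]
    simp
  rw [h4] at h2
  refine (ENNReal.mul_le_mul_iff_left (D.volume_toSet_ne_zero (D.cubeAt (τ x) x))
    (D.volume_toSet_ne_top _)).1 ?_
  calc _ ≤ _ := h1
    _ ≤ _ := h3
    _ ≤ _ := h2
    _ = _ := by ring

theorem lintegral_goodPart_sq_le (hτ : IsStoppingScale D h l c τ) :
    ∫⁻ y, ‖goodPart D h τ y‖ₑ ^ 2 ≤ 2 ^ N * l * ∫⁻ y, ‖h y‖ₑ := by
  calc _ ≤ ∫⁻ y, 2 ^ N * l * ‖goodPart D h τ y‖ₑ := by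
        refine lintegral_mono fun y => ?_
        rw [sq]
        gcongr
        exact hτ.enorm_goodPart_le y
    _ = 2 ^ N * l * ∫⁻ y, ‖goodPart D h τ y‖ₑ := lintegral_const_mul' _ _ (by finiteness)
    _ ≤ _ := mul_le_mul_right hτ.lintegral_goodPart_le _

theorem memLp_goodPart (hτ : IsStoppingScale D h l c τ) (hh : Integrable h) :
    MemLp (goodPart D h τ) 2 := by
  refine ⟨hτ.measurable_goodPart.aestronglyMeasurable, ?_⟩
  have h1 := hτ.lintegral_goodPart_sq_le
  have h2 : ∫⁻ y, ‖h y‖ₑ < ∞ := hh.hasFiniteIntegral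
  rw [← eLpNorm_two_sq_eq_lintegral] at h1
  exact (ENNReal.pow_lt_top_iff.1 (h1.trans_lt (by finiteness))).resolve_right two_ne_zero

/-- The part of the space covered by stopping cubes on which `h` is large. -/
theorem volume_high_le (hτ : IsStoppingScale D h l c τ) :
    l * volume {x | D.IsHigh h l (D.cubeAt (τ x) x)} ≤ ∫⁻ y, ‖h y‖ₑ := by
  have := hτ.isPartition.setLIntegral_mono (U := {x | D.IsHigh h l (D.cubeAt (τ x) x)})
    (f := fun _ => l) (g := fun y => ‖h y‖ₑ) (fun x hx y hy => by
      have : D.cubeAt (τ y) y = D.cubeAt (τ x) x := hτ.isPartition.eq x y hy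
      simpa [this] using hx) fun x hx => by
        rw [setLIntegral_const]
        exact (show D.IsHigh h l (D.cubeAt (τ x) x) from hx).le
  rw [setLIntegral_const] at this
  exact this.trans (setLIntegral_le_lintegral _ _)

end IsStoppingScale

end ConvexBody

/-! ### Weak type (1,1) with a constant independent of the complexity. -/

namespace ConvexBody

open scoped NNReal

variable {N : ℕ} {D : DyadicLattice N} {A : ℝ≥0} {r : ℕ} {c : ℤ}
  {K : Cube N → (Fin N → ℝ) → (Fin N → ℝ) → ℝ} {h : (Fin N → ℝ) → ℝ}

/-- The part of `Q` covered by stopping cubes that are strictly smaller than `Q`, but too large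
for the kernel `K_Q` to be constant on them. -/
def midPart (D : DyadicLattice N) (r : ℕ) (τ : (Fin N → ℝ) → ℤ) (Q : Cube N) : Set (Fin N → ℝ) :=
  {y | y ∈ D.toSet Q ∧ Q.scale - (r + 1) < τ y ∧ τ y < Q.scale}

namespace IsStoppingScale

variable {l : ℝ≥0} {τ : (Fin N → ℝ) → ℤ} {m : ℤ}

theorem measurableSet_midPart (hτ : IsStoppingScale D h l m τ) (r : ℕ) (Q : Cube N) :
    MeasurableSet (midPart D r τ Q) := by
  have : midPart D r τ Q = D.toSet Q ∩ {y | Q.scale - (r + 1) < τ y ∧ τ y < Q.scale} := rfl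
  rw [this]
  refine (D.measurableSet_toSet Q).inter (D.measurableSet_of_cubeAt (j := m) fun x y hxy => ?_)
  simp only [Set.mem_ofPred_eq, hτ.eq_of_cubeAt_eq hxy, imp_self]

/-- A stopping cube of scale at least that of `Q` meeting `Q` would be high and contain `x`, so `x`
could not have run down to the bottom scale. -/
theorem scale_lt_of_not_isHigh (hτ : IsStoppingScale D h l m τ) {Q : Cube N} (hQ : m < Q.scale)
    {x y : Fin N → ℝ} (hx : ¬ D.IsHigh h l (D.cubeAt (τ x) x)) (hxQ : x ∈ D.toSet Q)
    (hyQ : y ∈ D.toSet Q) : τ y < Q.scale := by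
  rw [D.mem_toSet_iff] at hxQ hyQ
  have h1 : τ x = m := (hτ.eq_or x).resolve_right hx
  exact lt_of_le_of_ne (hτ.le_of_cubeAt_eq (by omega) (hyQ.trans hxQ.symm)) fun h2 => by
    have h3 := (hτ.eq_or y).resolve_left (by omega)
    rw [h2, hyQ, ← hxQ] at h3
    exact hτ.not_isHigh x _ (by omega) h3

/-- The difference `h - goodPart` has mean zero on every stopping cube. It contributes nothing on
those of scale at most `Q.scale - (r + 1)`, where the kernel is constant in `y`, and as `x` is in a
low cell no stopping cube in `Q` has the scale of `Q` or more. Only `midPart` survives. -/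
theorem enorm_kernelPiece_sub_le (hτ : IsStoppingScale D h l m τ) (hK : IsShift D (fun _ => A) r c K)
    (hh : Integrable h) {Q : Cube N} (hQ : m ≤ Q.scale - (r + 1)) {x : Fin N → ℝ}
    (hx : ¬ D.IsHigh h l (D.cubeAt (τ x) x)) :
    ‖kernelPiece K Q h x - kernelPiece K Q (goodPart D h τ) x‖ₑ ≤
      (D.toSet Q).indicator (fun _ => A * (volume (D.toSet Q))⁻¹ *
        ∫⁻ y in midPart D r τ Q, ‖h y - goodPart D h τ y‖ₑ) x := by
  by_cases hxQ : x ∈ D.toSet Q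
  swap
  · simp [hK.kernelPiece_eq_zero _ hxQ]
  rw [Set.indicator_of_mem hxQ]
  have hg := hτ.integrable_goodPart hh
  have hlt : ∀ y ∈ D.toSet Q, τ y < Q.scale := fun y hy =>
    hτ.scale_lt_of_not_isHigh (by omega) hx hxQ hy
  have i1 := hK.integrable_mul Q x hh.integrableOn
  have i2 := hK.integrable_mul Q x hg.integrableOn
  set U : Set (Fin N → ℝ) := {y | y ∈ D.toSet Q ∧ τ y ≤ Q.scale - (r + 1)} with hU
  have hzero : ∫ y in U, K Q x y * h y = ∫ y in U, K Q x y * goodPart D h τ y := by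
    refine hτ.isPartition.setIntegral_congr (fun y hy z hz => ?_) i1.integrableOn i2.integrableOn
      fun y hy => ?_
    · refine ⟨D.toSet_subset_of_mem ?_ (D.mem_cubeAt _ y) hy.1 hz, ?_⟩
      · have := hy.2
        simp only [DyadicLattice.cubeAt_scale]
        omega
      · rw [hτ.eq_of_mem hz]
        exact hy.2
    · have hc : ∀ z ∈ D.toSet (D.cubeAt (τ y) y), K Q x z = K Q x y := fun z hz =>
        hK.const Q x x z y rfl (D.cubeAt_mono hy.2 (D.mem_cubeAt_iff.1 hz))
      rw [setIntegral_congr_fun (g := fun z => K Q x y * h z) (D.measurableSet_toSet _)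
          (fun z hz => by simp only [hc z hz]),
        setIntegral_congr_fun (f := fun z => K Q x z * goodPart D h τ z)
          (g := fun z => K Q x y * goodPart D h τ z) (D.measurableSet_toSet _)
          (fun z hz => by simp only [hc z hz]),
        integral_const_mul, integral_const_mul, hτ.setIntegral_goodPart]
  have hUm : MeasurableSet U :=
    (D.measurableSet_toSet Q).inter (D.measurableSet_of_cubeAt (j := m)
      (U := {y | τ y ≤ Q.scale - (r + 1)}) fun x y hxy => by
        simp only [Set.mem_ofPred_eq, hτ.eq_of_cubeAt_eq hxy, imp_self])
  have hsplit : D.toSet Q = U ∪ midPart D r τ Q := by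
    ext y
    simp only [hU, midPart, Set.mem_union, Set.mem_ofPred_eq]
    constructor
    · intro hy
      have := hlt y hy
      rcases le_or_gt (τ y) (Q.scale - (r + 1)) with h' | h'
      · exact .inl ⟨hy, h'⟩
      · exact .inr ⟨hy, h', this⟩
    · rintro (h | h) <;> exact h.1
  have hdisj : Disjoint U (midPart D r τ Q) := by
    refine Set.disjoint_left.2 fun y hy hy' => ?_
    have h1 := hy.2
    have h2 := hy'.2.1
    omega
  have hmid := hτ.measurableSet_midPart r Q
  have i3 : Integrable fun y => K Q x y * h y - K Q x y * goodPart D h τ y := i1.sub i2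
  rw [hK.kernelPiece_eq, hK.kernelPiece_eq, ← integral_sub i1.integrableOn i2.integrableOn, hsplit,
    setIntegral_union hdisj hmid i3.integrableOn i3.integrableOn,
    integral_sub (i1.integrableOn (s := U)) i2.integrableOn, hzero, sub_self, zero_add, ← hsplit,
    ← lintegral_const_mul' _ _ (ENNReal.mul_ne_top ENNReal.coe_ne_top
      (ENNReal.inv_ne_top.2 (D.volume_toSet_ne_zero Q)))]
  refine (enorm_integral_le_lintegral_enorm _).trans (lintegral_mono fun y => ?_)
  rw [← mul_sub, enorm_mul]
  exact mul_le_mul_left (hK.enorm_le Q x y) _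

/-- The sets `midPart` are disjoint: `τ y` lies strictly between two consecutive scales of the
progression, which fixes the scale of `Q`, and then `y` fixes `Q`. This is where the dependence on
`r` disappears. -/
theorem sum_lintegral_midPart_le (hτ : IsStoppingScale D h l m τ) {s : Finset (Cube N)}
    (hs : ∀ Q ∈ s, ∃ j : ℤ, Q.scale = c + (r + 1) * j) (b : (Fin N → ℝ) → ℝ≥0∞) :
    ∑ Q ∈ s, ∫⁻ y in midPart D r τ Q, b y ≤ ∫⁻ y, b y := by
  rw [← lintegral_biUnion_finset (fun P hP Q hQ hPQ => ?_) fun Q _ => hτ.measurableSet_midPart r Q]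
  · exact setLIntegral_le_lintegral _ _
  · refine Set.disjoint_left.2 fun y hyP hyQ => hPQ ?_
    refine D.eq_of_mem ?_ hyP.1 hyQ.1
    obtain ⟨h1, h2⟩ := hyP.2
    obtain ⟨h3, h4⟩ := hyQ.2
    rcases lt_trichotomy P.scale Q.scale with h' | h' | h'
    · have := separated_scale_le (hs P hP) (hs Q hQ) h'
      omega
    · exact h'
    · have := separated_scale_le (hs Q hQ) (hs P hP) h'
      omega

theorem lintegral_enorm_sub_le (hτ : IsStoppingScale D h l m τ) (hh : Integrable h) :
    ∫⁻ y, ‖h y - goodPart D h τ y‖ₑ ≤ 2 * ∫⁻ y, ‖h y‖ₑ := by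
  calc _ ≤ ∫⁻ y, (‖h y‖ₑ + ‖goodPart D h τ y‖ₑ) := lintegral_mono fun y => enorm_sub_le
    _ = (∫⁻ y, ‖h y‖ₑ) + ∫⁻ y, ‖goodPart D h τ y‖ₑ := lintegral_add_left' hh.1.enorm _
    _ ≤ _ := by
      rw [two_mul]
      exact add_le_add_right hτ.lintegral_goodPart_le _

end IsStoppingScale

theorem partialSum_filter (K : Cube N → (Fin N → ℝ) → (Fin N → ℝ) → ℝ)
    (s : Finset (Cube N)) (h : (Fin N → ℝ) → ℝ) (x : Fin N → ℝ) [DecidablePred fun Q => K Q ≠ 0] :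
    partialSum K (s.filter fun Q => K Q ≠ 0) h x = partialSum K s h x := by
  rw [partialSum, partialSum, Finset.sum_filter]
  refine Finset.sum_congr rfl fun Q _ => ?_
  split_ifs with hQ
  · rfl
  · push Not at hQ
    simp [kernelPiece, hQ]

/-- The constant in the weak type `(1,1)` inequality. -/
noncomputable def weakConst (N : ℕ) (A : ℝ≥0) : ℝ≥0 := 1 + 4 * 2 ^ N + 4 * A

theorem exists_le_scale (s : Finset (Cube N)) (a : ℤ) : ∃ m : ℤ, ∀ Q ∈ s, m ≤ Q.scale - a := by
  obtain ⟨m, hm⟩ := ((s.finite_toSet.image fun Q => Q.scale - a).bddBelow)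
  exact ⟨m, fun Q hQ => hm ⟨Q, hQ, rfl⟩⟩

/-- Weak type `(1,1)` for the partial sums of a separated shift, with a constant that does not
depend on the complexity. -/
theorem weak_type (hN : 1 ≤ N) (hK : IsShift D (fun _ => A) r c K) (hL : IsL2Contractive K)
    (s : Finset (Cube N)) (hh : Integrable h) (l : ℝ≥0) :
    l * volume {x | l < ‖partialSum K s h x‖ₑ} ≤ weakConst N A * ∫⁻ y, ‖h y‖ₑ := by
  classical
  -- Only cubes with a nonzero kernel are known to have scales in the progression.
  wlog hs : ∀ Q ∈ s, K Q ≠ 0 generalizing s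
  · have := this (s.filter fun Q => K Q ≠ 0) (by simp)
    simpa only [partialSum_filter] using this
  rcases eq_or_ne l 0 with rfl | hl
  · simp
  -- At the lowest scale `m` all the finitely many kernels are constant, so replacing `h` by its
  -- averages on low cells does not change the operators.
  obtain ⟨m, hm⟩ := exists_le_scale s (r + 1)
  obtain ⟨τ, hτ⟩ := exists_isStoppingScale D hN hh hl m
  set g := goodPart D h τ with hg
  set I := ∫⁻ y, ‖h y‖ₑ with hI
  set Ω := {x | D.IsHigh h l (D.cubeAt (τ x) x)} with hΩ
  have hΩm : MeasurableSet Ω := D.measurableSet_of_cubeAt (j := m) fun x y hxy hx => by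
    have h1 := hτ.eq_of_cubeAt_eq hxy
    have h2 := D.cubeAt_mono (hτ.le x) hxy
    simp only [hΩ, Set.mem_ofPred_eq] at hx ⊢
    rwa [← h1, ← h2]
  have hgi := hτ.integrable_goodPart hh
  have hTg := hK.measurable_partialSum s g
  have hTh := hK.measurable_partialSum s h
  have hl2 : ((l / 2 : ℝ≥0) : ℝ≥0∞) ≠ 0 := by simpa using hl
  have hl22 : ((l / 2 : ℝ≥0) : ℝ≥0∞) + (l / 2 : ℝ≥0) = l := by
    rw [← ENNReal.coe_add, add_halves]
  -- The terms `1`, `4 * 2 ^ N` and `4 * A` of `weakConst` come from the three sets: the high cubes,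
  -- the good part above `l / 2`, and the bad part above `l / 2` off the high cubes.
  have hcover : {x | (l : ℝ≥0∞) < ‖partialSum K s h x‖ₑ} ⊆
      Ω ∪ ({x | ((l / 2 : ℝ≥0) : ℝ≥0∞) ^ 2 ≤ ‖partialSum K s g x‖ₑ ^ 2} ∪
        {x | ((l / 2 : ℝ≥0) : ℝ≥0∞) ≤
          Ωᶜ.indicator (fun x => ‖partialSum K s h x - partialSum K s g x‖ₑ) x}) := by
    intro x hx
    by_cases hxΩ : x ∈ Ω
    · exact .inl hxΩ
    refine .inr ?_
    simp only [Set.mem_union, Set.mem_ofPred_eq] at hx ⊢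
    rw [Set.indicator_of_mem (show x ∈ Ωᶜ from hxΩ)]
    by_contra! hcon
    obtain ⟨h1, h2⟩ := hcon
    have h1' := (ENNReal.pow_lt_pow_left_iff two_ne_zero).1 h1
    have h3 : ‖partialSum K s h x‖ₑ ≤
        ‖partialSum K s g x‖ₑ + ‖partialSum K s h x - partialSum K s g x‖ₑ := by
      have := enorm_add_le (partialSum K s g x) (partialSum K s h x - partialSum K s g x)
      rwa [add_sub_cancel] at this
    have h4 := ENNReal.add_lt_add h1' h2
    rw [hl22] at h4
    exact absurd (hx.trans_le h3) (not_lt.2 h4.le)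
  have e1 : l * volume Ω ≤ I := hτ.volume_high_le
  have e2 : l * volume {x | ((l / 2 : ℝ≥0) : ℝ≥0∞) ^ 2 ≤ ‖partialSum K s g x‖ₑ ^ 2} ≤
      4 * 2 ^ N * I := by
    have h1 := mul_meas_ge_le_lintegral (μ := volume) (hTg.enorm.pow_const 2)
      (((l / 2 : ℝ≥0) : ℝ≥0∞) ^ 2)
    have h2 := (h1.trans (hL s g (hτ.memLp_goodPart hh))).trans hτ.lintegral_goodPart_sq_le
    -- Chebyshev is quadratic in the level while the good part costs one factor `l`; multiplying by
    -- `l` and using `l² = 4 (l / 2)²` makes the two sides comparable.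
    refine (ENNReal.mul_le_mul_iff_right (a := (l : ℝ≥0∞)) (by simpa using hl) (by simp)).1 ?_
    have h4 : (l : ℝ≥0∞) * l = 4 * ((l / 2 : ℝ≥0) : ℝ≥0∞) ^ 2 := by
      rw [← hl22]; ring
    rw [← mul_assoc, h4, mul_assoc]
    calc _ ≤ _ := mul_le_mul_right h2 4
      _ = _ := by ring
  have e3 : l * volume {x | ((l / 2 : ℝ≥0) : ℝ≥0∞) ≤
      Ωᶜ.indicator (fun x => ‖partialSum K s h x - partialSum K s g x‖ₑ) x} ≤ 4 * A * I := by
    have hmeas : Measurable (Ωᶜ.indicator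
        fun x => ‖partialSum K s h x - partialSum K s g x‖ₑ) :=
      (hTh.sub hTg).enorm.indicator hΩm.compl
    have h1 := mul_meas_ge_le_lintegral (μ := volume) hmeas ((l / 2 : ℝ≥0) : ℝ≥0∞)
    have h2 : ∫⁻ x, Ωᶜ.indicator (fun x => ‖partialSum K s h x - partialSum K s g x‖ₑ) x ≤
        A * (2 * I) := by
      calc _ ≤ ∫⁻ x, ∑ Q ∈ s, (D.toSet Q).indicator (fun _ => A * (volume (D.toSet Q))⁻¹ *
            ∫⁻ y in midPart D r τ Q, ‖h y - g y‖ₑ) x := by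
            refine lintegral_mono fun x => ?_
            refine Set.indicator_apply_le' (fun hx => ?_) fun _ => zero_le
            rw [partialSum, partialSum, ← Finset.sum_sub_distrib]
            refine (enorm_sum_le _ _).trans (Finset.sum_le_sum fun Q hQ => ?_)
            exact hτ.enorm_kernelPiece_sub_le hK hh (hm Q hQ) hx
        _ = ∑ Q ∈ s, A * ∫⁻ y in midPart D r τ Q, ‖h y - g y‖ₑ := by
            rw [lintegral_finsetSum _ fun Q _ =>
              measurable_const.indicator (D.measurableSet_toSet Q)]
            refine Finset.sum_congr rfl fun Q _ => ?_
            rw [lintegral_indicator_const (D.measurableSet_toSet Q), mul_right_comm,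
              mul_assoc (A : ℝ≥0∞), ENNReal.inv_mul_cancel (D.volume_toSet_ne_zero Q)
              (D.volume_toSet_ne_top Q), mul_one]
        _ = A * ∑ Q ∈ s, ∫⁻ y in midPart D r τ Q, ‖h y - g y‖ₑ := by rw [Finset.mul_sum]
        _ ≤ A * ∫⁻ y, ‖h y - g y‖ₑ := mul_le_mul_right
            (hτ.sum_lintegral_midPart_le (c := c) (r := r) (fun Q hQ => hK.separated Q (hs Q hQ)) _) _
        _ ≤ A * (2 * I) := mul_le_mul_right (hτ.lintegral_enorm_sub_le hh) _
    have h5 : (l : ℝ≥0∞) = 2 * (l / 2 : ℝ≥0) := by rw [← hl22]; ring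
    rw [h5, mul_assoc]
    calc _ ≤ _ := mul_le_mul_right (h1.trans h2) 2
      _ = _ := by ring
  calc _ ≤ l * (volume Ω + (_ + _)) := by
        refine mul_le_mul_right ((measure_mono hcover).trans ((measure_union_le _ _).trans ?_)) _
        exact add_le_add_right (measure_union_le _ _) _
    _ ≤ I + (4 * 2 ^ N * I + 4 * A * I) := by
        rw [mul_add, mul_add]
        exact add_le_add e1 (add_le_add e2 e3)
    _ = _ := by
        simp only [weakConst, ENNReal.coe_add, ENNReal.coe_mul, ENNReal.coe_one, ENNReal.coe_pow,
          ENNReal.coe_ofNat]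
        ring

end ConvexBody

/-! ### Orthogonality and `L²` bounds. -/

namespace ConvexBody

open scoped NNReal

theorem integral_sum_sq {α ι : Type*} [MeasurableSpace α] {μ : Measure α} (s : Finset ι)
    {φ : ι → α → ℝ} (hφ : ∀ i ∈ s, MemLp (φ i) 2 μ)
    (horth : ∀ i ∈ s, ∀ j ∈ s, i ≠ j → ∫ x, φ i x * φ j x ∂μ = 0) :
    ∫ x, (∑ i ∈ s, φ i x) ^ 2 ∂μ = ∑ i ∈ s, ∫ x, φ i x ^ 2 ∂μ := by
  have hint : ∀ i ∈ s, ∀ j ∈ s, Integrable (fun x => φ i x * φ j x) μ := fun i hi j hj =>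
    (hφ i hi).integrable_mul (hφ j hj)
  calc _ = ∫ x, ∑ i ∈ s, ∑ j ∈ s, φ i x * φ j x ∂μ := by
        simp only [sq, Finset.sum_mul_sum]
    _ = ∑ i ∈ s, ∑ j ∈ s, ∫ x, φ i x * φ j x ∂μ := by
        rw [integral_finsetSum _ fun i hi => integrable_finsetSum _ (hint i hi)]
        exact Finset.sum_congr rfl fun i hi => integral_finsetSum _ (hint i hi)
    _ = _ := by
        refine Finset.sum_congr rfl fun i hi => ?_
        rw [Finset.sum_eq_single_of_mem i hi fun j hj hji => horth i hi j hj hji.symm]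
        simp only [sq]

theorem lintegral_enorm_sq_eq {α : Type*} [MeasurableSpace α] {μ : Measure α} {f : α → ℝ}
    (hf : MemLp f 2 μ) : ∫⁻ x, ‖f x‖ₑ ^ 2 ∂μ = ENNReal.ofReal (∫ x, f x ^ 2 ∂μ) := by
  rw [ofReal_integral_eq_lintegral_ofReal hf.integrable_sq (.of_forall fun x => sq_nonneg _)]
  refine lintegral_congr fun x => ?_
  rw [← sq_abs, ENNReal.ofReal_pow (abs_nonneg _), Real.enorm_eq_ofReal_abs]

variable {N : ℕ} {D : DyadicLattice N} {A : Cube N → ℝ≥0} {r : ℕ} {c : ℤ}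
  {K : Cube N → (Fin N → ℝ) → (Fin N → ℝ) → ℝ} {h : (Fin N → ℝ) → ℝ}

theorem memLp_two_of_bound {Q : Cube N} {φ : (Fin N → ℝ) → ℝ} (hm : Measurable φ)
    (hs : ∀ x ∉ D.toSet Q, φ x = 0) (B : ℝ) (hB : ∀ x ∈ D.toSet Q, |φ x| ≤ B) : MemLp φ 2 := by
  refine MemLp.mono (g := (D.toSet Q).indicator fun _ => B)
    (memLp_indicator_const 2 (D.measurableSet_toSet Q) B (.inr (D.volume_toSet_ne_top Q)))
    hm.aestronglyMeasurable (.of_forall fun x => ?_)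
  by_cases hx : x ∈ D.toSet Q
  · rw [Set.indicator_of_mem hx]
    exact (hB x hx).trans (le_abs_self B)
  · simp [hs x hx]

theorem setIntegral_eq_of_support {E : Type*} [NormedAddCommGroup E] [NormedSpace ℝ E] {Q : Cube N}
    {φ : (Fin N → ℝ) → E} (hs : ∀ x ∉ D.toSet Q, φ x = 0) :
    ∫ x in D.toSet Q, φ x = ∫ x, φ x :=
  setIntegral_eq_integral_of_forall_compl_eq_zero hs

theorem integral_mul_eq_zero {P : Cube N} {φ ψ : (Fin N → ℝ) → ℝ}
    (hφ : ∀ x ∉ D.toSet P, φ x = 0) (hφ0 : ∫ x in D.toSet P, φ x = 0)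
    (hψ : ∀ x ∈ D.toSet P, ∀ y ∈ D.toSet P, ψ x = ψ y) : ∫ x, φ x * ψ x = 0 := by
  obtain ⟨z, hz⟩ := D.toSet_nonempty P
  rw [← setIntegral_eq_of_support (D := D) (Q := P) fun x hx => by rw [hφ x hx, zero_mul],
    setIntegral_congr_fun (g := fun x => φ x * ψ z) (D.measurableSet_toSet P)
      (fun x hx => by simp only [hψ x hx z hz]), integral_mul_const, hφ0, zero_mul]

/-- Functions attached to the cubes of a separated family, each of which is constant on small
cells and has mean zero, are pairwise orthogonal. -/
theorem integral_mul_eq_zero_of_separated {P Q : Cube N} {φ ψ : (Fin N → ℝ) → ℝ}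
    (hP : ∃ j : ℤ, P.scale = c + (r + 1) * j) (hQ : ∃ j : ℤ, Q.scale = c + (r + 1) * j)
    (hPQ : P ≠ Q)
    (hφ : ∀ x ∉ D.toSet P, φ x = 0) (hφ0 : ∫ x in D.toSet P, φ x = 0)
    (hφc : ∀ x y, D.cubeAt (P.scale - (r + 1)) x = D.cubeAt (P.scale - (r + 1)) y → φ x = φ y)
    (hψ : ∀ x ∉ D.toSet Q, ψ x = 0) (hψ0 : ∫ x in D.toSet Q, ψ x = 0)
    (hψc : ∀ x y, D.cubeAt (Q.scale - (r + 1)) x = D.cubeAt (Q.scale - (r + 1)) y → ψ x = ψ y) :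
    ∫ x, φ x * ψ x = 0 := by
  rcases lt_trichotomy P.scale Q.scale with h | h | h
  · refine integral_mul_eq_zero hφ hφ0 fun x hx y hy => hψc x y ?_
    rw [D.mem_toSet_iff] at hx hy
    exact D.cubeAt_mono (separated_scale_le hP hQ h) (hx.trans hy.symm)
  · refine integral_mul_eq_zero hφ hφ0 fun x hx y hy => ?_
    rw [hψ x fun hx' => hPQ (D.eq_of_mem h hx hx'), hψ y fun hy' => hPQ (D.eq_of_mem h hy hy')]
  · rw [integral_congr_ae (.of_forall fun x => mul_comm (φ x) (ψ x))]
    refine integral_mul_eq_zero hψ hψ0 fun x hx y hy => hφc x y ?_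
    rw [D.mem_toSet_iff] at hx hy
    exact D.cubeAt_mono (separated_scale_le hQ hP h) (hx.trans hy.symm)

namespace IsShift

theorem measurable_uncurry (hK : IsShift D A r c K) (Q : Cube N) :
    Measurable (Function.uncurry (K Q)) := by
  intro s _
  have : Function.uncurry (K Q) ⁻¹' s = ⋃ R ∈ {R : Cube N × Cube N |
      D.toSet R.1 ×ˢ D.toSet R.2 ⊆ Function.uncurry (K Q) ⁻¹' s},
      D.toSet R.1 ×ˢ D.toSet R.2 := by
    ext ⟨x, y⟩
    simp only [Set.mem_ofPred_eq, Set.mem_iUnion, exists_prop]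
    constructor
    · refine fun hx => ⟨(D.cubeAt (Q.scale - (r + 1)) x, D.cubeAt (Q.scale - (r + 1)) y), ?_,
        D.mem_cubeAt _ x, D.mem_cubeAt _ y⟩
      rintro ⟨x', y'⟩ ⟨hx', hy'⟩
      have := hK.const Q x' x y' y (D.mem_cubeAt_iff.1 hx') (D.mem_cubeAt_iff.1 hy')
      simpa [Set.mem_preimage, this] using hx
    · exact fun ⟨R, hR, hx⟩ => hR hx
  rw [this]
  exact MeasurableSet.biUnion (Set.to_countable _) fun R _ =>
    (D.measurableSet_toSet _).prod (D.measurableSet_toSet _)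

/-- Fubini and the cancellation of the kernel in the output variable. -/
theorem setIntegral_kernelPiece (hK : IsShift D A r c K) (Q : Cube N)
    (hh : IntegrableOn h (D.toSet Q)) : ∫ x in D.toSet Q, kernelPiece K Q h x = 0 := by
  have : IsFiniteMeasure (volume.restrict (D.toSet Q)) :=
    ⟨by simpa using (D.volume_toSet_ne_top Q).lt_top⟩
  simp_rw [hK.kernelPiece_eq]
  rw [integral_integral_swap]
  · simp_rw [integral_mul_const, hK.cancel, zero_mul]
    simp
  · have h1 : Integrable (fun p : (Fin N → ℝ) × (Fin N → ℝ) => h p.2)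
        ((volume.restrict (D.toSet Q)).prod (volume.restrict (D.toSet Q))) := hh.comp_snd _
    exact h1.bdd_mul (c := (A Q : ℝ) * (volume.real (D.toSet Q))⁻¹)
      (hK.measurable_uncurry Q).aestronglyMeasurable (.of_forall fun p => hK.bound Q p.1 p.2)

theorem memLp_kernelPiece (hK : IsShift D A r c K) (Q : Cube N)
    (hh : IntegrableOn h (D.toSet Q)) : MemLp (kernelPiece K Q h) 2 := by
  refine memLp_two_of_bound (D := D) (Q := Q) (hK.measurable_kernelPiece Q h)
    (fun x hx => hK.kernelPiece_eq_zero h hx)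
    (A Q * (volume.real (D.toSet Q))⁻¹ * ∫ y in D.toSet Q, |h y|) fun x _ => ?_
  rw [hK.kernelPiece_eq, ← integral_const_mul]
  refine (abs_integral_le_integral_abs).trans ?_
  refine integral_mono (hK.integrable_mul Q x hh).abs.integrableOn (hh.abs.const_mul _) fun y => ?_
  simp only [abs_mul]
  exact mul_le_mul_of_nonneg_right (hK.bound Q x y) (abs_nonneg _)

/-- Pythagoras. Only cancellation in the output variable enters, so this also serves paraproducts,
which do not annihilate `1_Q`. -/
theorem integral_partialSum_sq (hK : IsShift D A r c K) (s : Finset (Cube N))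
    (hh : ∀ Q, IntegrableOn h (D.toSet Q)) :
    ∫ x, partialSum K s h x ^ 2 = ∑ Q ∈ s, ∫ x, kernelPiece K Q h x ^ 2 := by
  refine integral_sum_sq s (fun Q _ => hK.memLp_kernelPiece Q (hh Q)) fun P _ Q _ hPQ => ?_
  by_cases hP : K P = 0
  · simp [kernelPiece, hP]
  by_cases hQ : K Q = 0
  · simp [kernelPiece, hQ]
  exact integral_mul_eq_zero_of_separated (D := D) (hK.separated P hP) (hK.separated Q hQ) hPQ
    (fun x hx => hK.kernelPiece_eq_zero h hx) (hK.setIntegral_kernelPiece P (hh P))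
    (fun x y hxy => hK.kernelPiece_congr P h hxy)
    (fun x hx => hK.kernelPiece_eq_zero h hx) (hK.setIntegral_kernelPiece Q (hh Q))
    (fun x y hxy => hK.kernelPiece_congr Q h hxy)

theorem memLp_partialSum (hK : IsShift D A r c K) (s : Finset (Cube N))
    (hh : ∀ Q, IntegrableOn h (D.toSet Q)) : MemLp (partialSum K s h) 2 :=
  memLp_finsetSum _ fun Q _ => hK.memLp_kernelPiece Q (hh Q)

end IsShift

/-- Conditional expectation onto the cubes of scale `j`. -/
noncomputable def cubeAvg (D : DyadicLattice N) (j : ℤ) (h : (Fin N → ℝ) → ℝ)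
    (x : Fin N → ℝ) : ℝ :=
  ⨍ y in D.toSet (D.cubeAt j x), h y

theorem cubeAvg_congr (D : DyadicLattice N) {j : ℤ} (h : (Fin N → ℝ) → ℝ) {x y : Fin N → ℝ}
    (hxy : D.cubeAt j x = D.cubeAt j y) : cubeAvg D j h x = cubeAvg D j h y := by
  rw [cubeAvg, cubeAvg, hxy]

theorem measurable_cubeAvg (D : DyadicLattice N) (j : ℤ) (h : (Fin N → ℝ) → ℝ) :
    Measurable (cubeAvg D j h) :=
  D.measurable_of_cubeAt fun _ _ => cubeAvg_congr D h

theorem abs_cubeAvg_le {Q : Cube N} {j : ℤ} (hj : j ≤ Q.scale) (hh : IntegrableOn h (D.toSet Q))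
    {x : Fin N → ℝ} (hx : x ∈ D.toSet Q) :
    |cubeAvg D j h x| ≤ (((2 : ℝ) ^ j) ^ N)⁻¹ * ∫ y in D.toSet Q, |h y| := by
  rw [cubeAvg, setAverage_eq, D.volume_real_toSet, smul_eq_mul, abs_mul,
    abs_of_nonneg (by positivity)]
  refine mul_le_mul_of_nonneg_left ?_ (by positivity)
  refine abs_integral_le_integral_abs.trans ?_
  exact setIntegral_mono_set hh.abs (.of_forall fun y => abs_nonneg _)
    (Filter.Eventually.of_forall (D.toSet_subset_of_mem hj (D.mem_cubeAt j x) hx))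

theorem integrableOn_of_bound {Q : Cube N} {φ : (Fin N → ℝ) → ℝ} (hm : Measurable φ) {B : ℝ}
    (hB : ∀ x ∈ D.toSet Q, |φ x| ≤ B) : IntegrableOn φ (D.toSet Q) :=
  Measure.integrableOn_of_bounded (D.volume_toSet_ne_top Q) hm.aestronglyMeasurable
    ((ae_restrict_iff' (D.measurableSet_toSet Q)).2 (.of_forall hB))

/-- `E_j` is self-adjoint: it may be dropped when tested against a function that is constant on
the cubes of scale `j`. -/
theorem setIntegral_mul_cubeAvg {Q : Cube N} {j : ℤ} (hj : j ≤ Q.scale)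
    (hh : IntegrableOn h (D.toSet Q)) {φ : (Fin N → ℝ) → ℝ}
    (hφ : ∀ x y, D.cubeAt j x = D.cubeAt j y → φ x = φ y) {B : ℝ}
    (hB : ∀ x ∈ D.toSet Q, |φ x| ≤ B) :
    ∫ y in D.toSet Q, φ y * cubeAvg D j h y = ∫ y in D.toSet Q, φ y * h y := by
  have hφm : Measurable φ := D.measurable_of_cubeAt hφ
  have hB' : ∀ᵐ x ∂volume.restrict (D.toSet Q), ‖φ x‖ ≤ B :=
    (ae_restrict_iff' (D.measurableSet_toSet Q)).2 (.of_forall hB)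
  have hav : IntegrableOn (cubeAvg D j h) (D.toSet Q) :=
    integrableOn_of_bound (measurable_cubeAvg D j h) fun x hx => abs_cubeAvg_le hj hh hx
  refine (D.isPartition_cubeAt j).setIntegral_congr
    (fun x hx => D.toSet_subset_of_mem hj (D.mem_cubeAt j x) hx)
    (hav.bdd_mul hφm.aestronglyMeasurable hB')
    (hh.bdd_mul hφm.aestronglyMeasurable hB') fun x _ => ?_
  rw [setIntegral_congr_fun (g := fun _ => φ x * cubeAvg D j h x) (D.measurableSet_toSet _)
      (fun z hz => by
        have := D.mem_cubeAt_iff.1 hz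
        simp only [hφ z x this, cubeAvg_congr D h this]),
    setIntegral_congr_fun (f := fun z => φ z * h z) (g := fun z => φ x * h z)
      (D.measurableSet_toSet _)
      (fun z hz => by simp only [hφ z x (D.mem_cubeAt_iff.1 hz)]),
    setIntegral_const, cubeAvg, setAverage_eq, smul_eq_mul, smul_eq_mul,
    integral_const_mul (φ x) h]
  have := (D.volume_real_toSet_pos (D.cubeAt j x)).ne'
  field_simp

theorem setIntegral_cubeAvg {Q : Cube N} {j : ℤ} (hj : j ≤ Q.scale)
    (hh : IntegrableOn h (D.toSet Q)) :
    ∫ y in D.toSet Q, cubeAvg D j h y = ∫ y in D.toSet Q, h y := by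
  simpa using setIntegral_mul_cubeAvg (φ := fun _ => 1) (B := 1) hj hh (fun _ _ _ => rfl)
    (fun _ _ => by simp)

/-- The projection `1_Q (E_j - E_k)`, where `2 ^ k` is the side length of `Q`. -/
noncomputable def cubeProj (D : DyadicLattice N) (j : ℤ) (Q : Cube N) (h : (Fin N → ℝ) → ℝ)
    (x : Fin N → ℝ) : ℝ :=
  (D.toSet Q).indicator (fun x => cubeAvg D j h x - ⨍ y in D.toSet Q, h y) x

section cubeProj

variable {Q : Cube N} {j : ℤ}

theorem cubeProj_of_notMem {x : Fin N → ℝ} (hx : x ∉ D.toSet Q) : cubeProj D j Q h x = 0 :=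
  Set.indicator_of_notMem hx _

theorem cubeProj_of_mem {x : Fin N → ℝ} (hx : x ∈ D.toSet Q) :
    cubeProj D j Q h x = cubeAvg D j h x - ⨍ y in D.toSet Q, h y :=
  Set.indicator_of_mem hx _

theorem cubeProj_congr (hj : j ≤ Q.scale) (x y : Fin N → ℝ)
    (hxy : D.cubeAt j x = D.cubeAt j y) : cubeProj D j Q h x = cubeProj D j Q h y := by
  have hk := D.cubeAt_mono hj hxy
  by_cases hx : x ∈ D.toSet Q
  · have hy : y ∈ D.toSet Q := by rw [D.mem_toSet_iff] at hx ⊢; rw [← hk, hx]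
    rw [cubeProj_of_mem hx, cubeProj_of_mem hy, cubeAvg_congr D h hxy]
  · have hy : y ∉ D.toSet Q := by rw [D.mem_toSet_iff] at hx ⊢; rwa [← hk]
    rw [cubeProj_of_notMem hx, cubeProj_of_notMem hy]

theorem measurable_cubeProj (hj : j ≤ Q.scale) : Measurable (cubeProj D j Q h) :=
  D.measurable_of_cubeAt (cubeProj_congr hj)

theorem exists_cubeProj_le (hj : j ≤ Q.scale) (hh : IntegrableOn h (D.toSet Q)) :
    ∃ B, ∀ x ∈ D.toSet Q, |cubeProj D j Q h x| ≤ B :=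
  ⟨_, fun x hx => by
    rw [cubeProj_of_mem hx]
    exact (abs_sub _ _).trans (add_le_add_left (abs_cubeAvg_le hj hh hx) _)⟩

theorem memLp_cubeProj (hj : j ≤ Q.scale) (hh : IntegrableOn h (D.toSet Q)) :
    MemLp (cubeProj D j Q h) 2 := by
  obtain ⟨B, hB⟩ := exists_cubeProj_le hj hh
  exact memLp_two_of_bound (measurable_cubeProj hj) (fun x hx => cubeProj_of_notMem hx) B hB

theorem setIntegral_cubeProj (hj : j ≤ Q.scale) (hh : IntegrableOn h (D.toSet Q)) :
    ∫ x in D.toSet Q, cubeProj D j Q h x = 0 := by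
  have hav : IntegrableOn (cubeAvg D j h) (D.toSet Q) :=
    integrableOn_of_bound (measurable_cubeAvg D j h) fun x hx => abs_cubeAvg_le hj hh hx
  rw [setIntegral_congr_fun (g := fun x => cubeAvg D j h x - ⨍ y in D.toSet Q, h y)
      (D.measurableSet_toSet Q) (fun x hx => cubeProj_of_mem hx),
    integral_sub hav (integrableOn_const (D.volume_toSet_ne_top Q)), setIntegral_cubeAvg hj hh,
    setIntegral_const, setAverage_eq, smul_smul, mul_inv_cancel₀ (D.volume_real_toSet_pos Q).ne',
    one_smul, sub_self]

theorem integral_mul_cubeProj (hj : j ≤ Q.scale) (hh : IntegrableOn h (D.toSet Q)) :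
    ∫ x, h x * cubeProj D j Q h x = ∫ x, cubeProj D j Q h x ^ 2 := by
  obtain ⟨B, hB⟩ := exists_cubeProj_le hj hh
  have hm := measurable_cubeProj (D := D) (h := h) hj
  have hav : IntegrableOn (cubeAvg D j h) (D.toSet Q) :=
    integrableOn_of_bound (measurable_cubeAvg D j h) fun x hx => abs_cubeAvg_le hj hh hx
  have hB' : ∀ᵐ x ∂volume.restrict (D.toSet Q), ‖cubeProj D j Q h x‖ ≤ B :=
    (ae_restrict_iff' (D.measurableSet_toSet Q)).2 (.of_forall hB)
  rw [← setIntegral_eq_of_support (D := D) (Q := Q) fun x hx => by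
      rw [cubeProj_of_notMem hx, mul_zero],
    ← setIntegral_eq_of_support (D := D) (Q := Q) (φ := fun x => cubeProj D j Q h x ^ 2)
      fun x hx => by rw [cubeProj_of_notMem hx, zero_pow two_ne_zero]]
  simp_rw [mul_comm (h _)]
  rw [← setIntegral_mul_cubeAvg hj hh (cubeProj_congr hj) hB,
    setIntegral_congr_fun (f := fun x => cubeProj D j Q h x ^ 2)
      (g := fun x => cubeProj D j Q h x * cubeAvg D j h x -
        cubeProj D j Q h x * ⨍ y in D.toSet Q, h y) (D.measurableSet_toSet Q)
      (fun x hx => by simp only [← mul_sub, ← cubeProj_of_mem hx, sq]),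
    integral_sub (hav.bdd_mul hm.aestronglyMeasurable hB')
      ((integrableOn_of_bound hm hB).mul_const _), integral_mul_const,
    setIntegral_cubeProj hj hh, zero_mul, sub_zero]

end cubeProj

/-- Bessel's inequality for the projections on a separated family of cubes. -/
theorem sum_integral_cubeProj_sq_le {s : Finset (Cube N)}
    (hs : ∀ Q ∈ s, ∃ j : ℤ, Q.scale = c + (r + 1) * j) (hh : MemLp h 2)
    (hi : ∀ Q, IntegrableOn h (D.toSet Q)) :
    ∑ Q ∈ s, ∫ x, cubeProj D (Q.scale - (r + 1)) Q h x ^ 2 ≤ ∫ x, h x ^ 2 := by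
  have hle : ∀ Q : Cube N, Q.scale - (r + 1) ≤ Q.scale := fun Q => by omega
  have hm : ∀ Q ∈ s, MemLp (cubeProj D (Q.scale - (r + 1)) Q h) 2 := fun Q _ =>
    memLp_cubeProj (hle Q) (hi Q)
  have horth := integral_sum_sq s hm fun P hP Q hQ hPQ =>
    integral_mul_eq_zero_of_separated (D := D) (hs P hP) (hs Q hQ) hPQ
      (fun x hx => cubeProj_of_notMem hx) (setIntegral_cubeProj (hle P) (hi P))
      (fun x y hxy => cubeProj_congr (hle P) x y hxy)
      (fun x hx => cubeProj_of_notMem hx) (setIntegral_cubeProj (hle Q) (hi Q))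
      (fun x y hxy => cubeProj_congr (hle Q) x y hxy)
  set F : (Fin N → ℝ) → ℝ := fun x => ∑ Q ∈ s, cubeProj D (Q.scale - (r + 1)) Q h x with hF
  have hFm : MemLp F 2 := memLp_finsetSum _ hm
  have hhF : ∫ x, h x * F x = ∫ x, F x ^ 2 := by
    rw [horth]
    simp only [hF, Finset.mul_sum]
    rw [integral_finsetSum _ fun Q hQ => by exact hh.integrable_mul (hm Q hQ)]
    exact Finset.sum_congr rfl fun Q _ => integral_mul_cubeProj (hle Q) (hi Q)
  rw [← horth]
  -- Bessel from `0 ≤ ‖h - F‖²`, since `⟨h, F⟩ = ‖F‖²`.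
  have h0 : 0 ≤ ∫ x, (h x - F x) ^ 2 := integral_nonneg fun x => sq_nonneg _
  have h1 : ∫ x, (h x - F x) ^ 2 = (∫ x, h x ^ 2) - 2 * (∫ x, h x * F x) + ∫ x, F x ^ 2 := by
    have i1 := hh.integrable_sq
    have i2 : Integrable fun x => h x * F x := hh.integrable_mul hFm
    have i3 := hFm.integrable_sq
    rw [← integral_const_mul, ← integral_sub i1 (i2.const_mul 2),
      ← integral_add (by exact i1.sub (i2.const_mul 2)) i3]
    congr 1 with x
    ring
  linarith

theorem integrableOn_of_memLp (hh : MemLp h 2) (Q : Cube N) : IntegrableOn h (D.toSet Q) := by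
  have : IsFiniteMeasure (volume.restrict (D.toSet Q)) :=
    ⟨by simpa using (D.volume_toSet_ne_top Q).lt_top⟩
  exact (hh.restrict _).integrable one_le_two

/-- With kernel bound `1 / |Q|` the output is at most the average of `|h|` on `Q`; Cauchy–Schwarz
then gives norm at most 1 for a single piece. -/
theorem IsShift.integral_kernelPiece_sq_le (hK : IsShift D 1 r c K) (Q : Cube N)
    (hh : MemLp h 2) : ∫ x, kernelPiece K Q h x ^ 2 ≤ ∫ x, h x ^ 2 := by
  have hi := integrableOn_of_memLp (D := D) hh Q
  have hV := D.volume_real_toSet_pos Q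
  set V := volume.real (D.toSet Q) with hVdef
  have hCS : (∫ y in D.toSet Q, |h y|) ^ 2 ≤ V * ∫ y, h y ^ 2 := by
    set a := ∫ y in D.toSet Q, |h y| with ha
    have i1 : IntegrableOn (fun y => h y ^ 2) (D.toSet Q) := hh.integrable_sq.integrableOn
    -- Cauchy–Schwarz as nonnegativity of the variance of `|h|` on `Q`.
    have h0 : 0 ≤ ∫ y in D.toSet Q, (V * |h y| - a) ^ 2 := integral_nonneg fun _ => sq_nonneg _
    have h1 : ∫ y in D.toSet Q, (V * |h y| - a) ^ 2 =
        V ^ 2 * (∫ y in D.toSet Q, h y ^ 2) - 2 * V * a * a + V * a ^ 2 := by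
      have : ∀ y, (V * |h y| - a) ^ 2 = V ^ 2 * h y ^ 2 - 2 * V * a * |h y| + a ^ 2 := fun y => by
        rw [← sq_abs (h y)]; ring
      have i2 : IntegrableOn (fun y => V ^ 2 * h y ^ 2 - 2 * V * a * |h y|) (D.toSet Q) :=
        (i1.const_mul _).sub (hi.abs.const_mul _)
      have i3 : IntegrableOn (fun _ => a ^ 2) (D.toSet Q) :=
        integrableOn_const (D.volume_toSet_ne_top Q)
      simp_rw [this]
      rw [integral_add i2 i3, integral_sub (i1.const_mul _) (hi.abs.const_mul _), integral_const_mul,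
        integral_const_mul, setIntegral_const, smul_eq_mul, ← ha, ← hVdef]
    have h2 : ∫ y in D.toSet Q, h y ^ 2 ≤ ∫ y, h y ^ 2 :=
      setIntegral_le_integral hh.integrable_sq (.of_forall fun _ => sq_nonneg _)
    have h3 : 0 ≤ V * (V * (∫ y in D.toSet Q, h y ^ 2) - a ^ 2) := by linarith
    have h4 := nonneg_of_mul_nonneg_right h3 hV
    nlinarith
  have hpt : ∀ x, kernelPiece K Q h x ^ 2 ≤
      (D.toSet Q).indicator (fun _ => V⁻¹ * ∫ y, h y ^ 2) x := by
    intro x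
    by_cases hx : x ∈ D.toSet Q
    swap
    · simp [hK.kernelPiece_eq_zero h hx, hx]
    rw [Set.indicator_of_mem hx]
    have h1 : |kernelPiece K Q h x| ≤ V⁻¹ * ∫ y in D.toSet Q, |h y| := by
      rw [hK.kernelPiece_eq, ← integral_const_mul]
      refine (abs_integral_le_integral_abs).trans ?_
      refine integral_mono (hK.integrable_mul Q x hi).abs.integrableOn (hi.abs.const_mul _)
        fun y => ?_
      simp only [abs_mul]
      refine mul_le_mul_of_nonneg_right ?_ (abs_nonneg _)
      simpa using hK.bound Q x y
    calc _ = |kernelPiece K Q h x| ^ 2 := (sq_abs _).symm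
      _ ≤ (V⁻¹ * ∫ y in D.toSet Q, |h y|) ^ 2 := by gcongr
      _ = V⁻¹ ^ 2 * (∫ y in D.toSet Q, |h y|) ^ 2 := mul_pow _ _ _
      _ ≤ V⁻¹ ^ 2 * (V * ∫ y, h y ^ 2) := by gcongr
      _ = _ := by field_simp
  calc _ ≤ ∫ x, (D.toSet Q).indicator (fun _ => V⁻¹ * ∫ y, h y ^ 2) x :=
        integral_mono (hK.memLp_kernelPiece Q hi).integrable_sq
          ((integrable_indicator_iff (D.measurableSet_toSet Q)).2
            (integrableOn_const (D.volume_toSet_ne_top Q))) hpt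
    _ = _ := by
        rw [integral_indicator (D.measurableSet_toSet Q), setIntegral_const, smul_eq_mul,
          ← mul_assoc, ← hVdef, mul_inv_cancel₀ hV.ne', one_mul]

/-- Kernels that are cancellative in both variables give contractions on `L²`. -/
theorem IsShift.isL2Contractive (hK : IsShift D 1 r c K)
    (hK' : ∀ Q x, ∫ y in D.toSet Q, K Q x y = 0) : IsL2Contractive K := by
  classical
  intro s h hh
  have hi := integrableOn_of_memLp (D := D) hh
  rw [lintegral_enorm_sq_eq (hK.memLp_partialSum s hi), lintegral_enorm_sq_eq hh]
  refine ENNReal.ofReal_le_ofReal ?_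
  -- Constancy of the kernel in `y` replaces `h` by its averages on small cells, and cancellation in
  -- `y` removes the mean on `Q`. The inputs are thereby orthogonal projections of `h`, to which
  -- Bessel applies.
  have hpiece : ∀ Q, kernelPiece K Q h =
      kernelPiece K Q (cubeProj D (Q.scale - (r + 1)) Q h) := by
    intro Q
    have hj : Q.scale - (r + 1) ≤ Q.scale := by omega
    have hav : IntegrableOn (cubeAvg D (Q.scale - (r + 1)) h) (D.toSet Q) :=
      integrableOn_of_bound (measurable_cubeAvg D _ h) fun x hx => abs_cubeAvg_le hj (hi Q) hx
    ext x
    rw [hK.kernelPiece_eq, hK.kernelPiece_eq,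
      ← setIntegral_mul_cubeAvg hj (hi Q) (fun y y' hy => hK.const Q x x y y' rfl hy)
        (fun y _ => hK.bound Q x y),
      setIntegral_congr_fun (f := fun y => K Q x y * cubeProj D (Q.scale - (r + 1)) Q h y)
        (g := fun y => K Q x y * cubeAvg D (Q.scale - (r + 1)) h y -
          K Q x y * ⨍ y in D.toSet Q, h y) (D.measurableSet_toSet Q)
        (fun y hy => by simp only [cubeProj_of_mem hy, mul_sub]),
      integral_sub (hK.integrable_mul Q x hav).integrableOn
        (hK.integrable_mul Q x (h := fun _ => ⨍ y in D.toSet Q, h y)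
          (integrableOn_const (D.volume_toSet_ne_top Q))).integrableOn, integral_mul_const,
      hK', zero_mul, sub_zero]
  rw [← integral_congr_ae (.of_forall fun x => congrArg (· ^ 2) (partialSum_filter K s h x)),
    hK.integral_partialSum_sq _ hi]
  refine le_trans (Finset.sum_le_sum fun Q _ => ?_) (sum_integral_cubeProj_sq_le
    (s := s.filter fun Q => K Q ≠ 0) (c := c) (r := r)
    (fun Q hQ => hK.separated Q (Finset.mem_filter.1 hQ).2) hh hi)
  rw [hpiece]
  exact hK.integral_kernelPiece_sq_le Q (memLp_cubeProj (by omega) (hi Q))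

end ConvexBody

/-! ### Reduction of Haar shifts and paraproducts to separated shifts. -/

namespace ConvexBody

open scoped NNReal

theorem finsum_mem_eq_of_unique {α M : Type*} [AddCommMonoid M] {s : Set α} {g : α → M} {a : α}
    (ha : a ∈ s) (h : ∀ x ∈ s, x ≠ a → g x = 0) : ∑ᶠ x ∈ s, g x = g a := by
  classical
  rw [finsum_eq_single _ a fun x hx => by
    by_cases hxs : x ∈ s
    · rw [finsum_eq_if, if_pos hxs, h x hxs hx]
    · rw [finsum_eq_if, if_neg hxs], finsum_eq_if, if_pos ha]

variable {N : ℕ} {D : DyadicLattice N} {A : Cube N → ℝ≥0} {r : ℕ} {c : ℤ}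
  {K : Cube N → (Fin N → ℝ) → (Fin N → ℝ) → ℝ} {h : (Fin N → ℝ) → ℝ}

theorem cubeAt_mem_ch {Q : Cube N} {x : Fin N → ℝ} (hx : x ∈ D.toSet Q) (n : ℕ) :
    D.cubeAt (Q.scale - n) x ∈ D.ch n Q :=
  ⟨rfl, D.toSet_subset_of_mem (by simp) (D.mem_cubeAt _ x) hx⟩

theorem eq_cubeAt_of_mem_ch {Q R : Cube N} {x : Fin N → ℝ} {n : ℕ} (hR : R ∈ D.ch n Q)
    (hx : x ∈ D.toSet R) : R = D.cubeAt (Q.scale - n) x := by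
  rw [← hR.1, (D.mem_toSet_iff.1 hx)]

/-- At a given point only the child containing it contributes to the finite sum. -/
theorem martDiff_eq (b : (Fin N → ℝ) → ℝ) (R : Cube N) (x : Fin N → ℝ) :
    D.martDiff b R x = cubeProj D (R.scale - 1) R b x := by
  unfold DyadicLattice.martDiff
  by_cases hx : x ∈ D.toSet R
  · have hmem := cubeAt_mem_ch hx 1
    rw [finsum_mem_eq_of_unique hmem, cubeProj_of_mem hx, Set.indicator_of_mem hx,
      Set.indicator_of_mem (D.mem_cubeAt _ x)]
    · rfl
    · intro R' hR' hne
      exact Set.indicator_of_notMem (fun hx' => hne (eq_cubeAt_of_mem_ch hR' hx')) _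
  · rw [cubeProj_of_notMem hx, Set.indicator_of_notMem hx, sub_zero]
    exact finsum_mem_eq_zero_of_forall_eq_zero fun R' hR' =>
      Set.indicator_of_notMem (fun hx' => hx (hR'.2 hx')) _

/-- The output function `∑_{R ∈ ch^r Q} Δ_R b` of a paraproduct. -/
noncomputable def paraFun (D : DyadicLattice N) (r : ℕ) (b : (Fin N → ℝ) → ℝ) (Q : Cube N)
    (x : Fin N → ℝ) : ℝ :=
  cubeProj D (Q.scale - (r + 1)) Q b x - cubeProj D (Q.scale - r) Q b x

/-- On `Q` both sides are the difference of the averages of `b` over the cubes `r + 1` and `r`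
generations below `Q` containing `x`; the average over `Q` cancels. -/
theorem finsum_martDiff_eq (b : (Fin N → ℝ) → ℝ) (Q : Cube N) (x : Fin N → ℝ) :
    ∑ᶠ R ∈ D.ch r Q, D.martDiff b R x = paraFun D r b Q x := by
  simp only [martDiff_eq, paraFun]
  by_cases hx : x ∈ D.toSet Q
  · rw [finsum_mem_eq_of_unique (cubeAt_mem_ch hx r), cubeProj_of_mem hx, cubeProj_of_mem hx,
      cubeProj_of_mem (D.mem_cubeAt _ x)]
    · rw [sub_sub_sub_cancel_right, DyadicLattice.cubeAt_scale, sub_sub]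
      rfl
    · intro R hR hne
      exact cubeProj_of_notMem fun hx' => hne (eq_cubeAt_of_mem_ch hR hx')
  · rw [cubeProj_of_notMem hx, cubeProj_of_notMem hx, sub_zero]
    exact finsum_mem_eq_zero_of_forall_eq_zero fun R hR =>
      cubeProj_of_notMem fun hx' => hx (hR.2 hx')

open Classical in
/-- The kernels of a paraproduct, put to zero off the scales `c + (r + 1) ℤ`. -/
noncomputable def paraKernel (D : DyadicLattice N) (r : ℕ) (c : ℤ) (b : (Fin N → ℝ) → ℝ)
    (Q : Cube N) (x y : Fin N → ℝ) : ℝ :=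
  if ∃ j : ℤ, Q.scale = c + (r + 1) * j then
    (volume.real (D.toSet Q))⁻¹ * paraFun D r b Q x * (D.toSet Q).indicator (fun _ => 1) y
  else 0

theorem paraFun_congr (b : (Fin N → ℝ) → ℝ) (Q : Cube N) {x y : Fin N → ℝ}
    (hxy : D.cubeAt (Q.scale - (r + 1)) x = D.cubeAt (Q.scale - (r + 1)) y) :
    paraFun D r b Q x = paraFun D r b Q y := by
  rw [paraFun, paraFun, cubeProj_congr (by omega) x y hxy,
    cubeProj_congr (j := Q.scale - r) (by omega) x y (D.cubeAt_mono (by omega) hxy)]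

theorem paraFun_of_notMem {b : (Fin N → ℝ) → ℝ} {Q : Cube N} {x : Fin N → ℝ}
    (hx : x ∉ D.toSet Q) : paraFun D r b Q x = 0 := by
  rw [paraFun, cubeProj_of_notMem hx, cubeProj_of_notMem hx, sub_zero]

/-- Cancellation in `x` holds because both projections of `b` have mean zero on `Q`. -/
theorem isShift_paraKernel (c : ℤ) {b : (Fin N → ℝ) → ℝ} (hb : ∀ Q, IntegrableOn b (D.toSet Q))
    (hA : ∀ Q : Cube N, (∃ j : ℤ, Q.scale = c + (r + 1) * j) →
      ∀ x ∈ D.toSet Q, |paraFun D r b Q x| ≤ A Q) :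
    IsShift D A r c (paraKernel D r c b) := by
  have hm : ∀ Q, IntegrableOn (cubeProj D (Q.scale - (r + 1)) Q b) (D.toSet Q) ∧
      IntegrableOn (cubeProj D (Q.scale - r) Q b) (D.toSet Q) := fun Q =>
    ⟨integrableOn_of_memLp (memLp_cubeProj (by omega) (hb Q)) Q,
      integrableOn_of_memLp (memLp_cubeProj (by omega) (hb Q)) Q⟩
  refine ⟨fun Q x y hne => ?_, fun Q x x' y y' hx hy => ?_, fun Q x y => ?_, fun Q y => ?_,
    fun Q hQ => ?_⟩
  · by_contra hxy
    refine hne ?_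
    unfold paraKernel
    split_ifs with hs
    · by_cases hx : x ∈ D.toSet Q
      · rw [Set.indicator_of_notMem fun hy => hxy ⟨hx, hy⟩, mul_zero]
      · rw [paraFun_of_notMem hx]; simp
    · rfl
  · have h1 : (D.toSet Q).indicator (fun _ => (1 : ℝ)) y =
        (D.toSet Q).indicator (fun _ => (1 : ℝ)) y' := by
      have hiff : y ∈ D.toSet Q ↔ y' ∈ D.toSet Q := by
        rw [D.mem_toSet_iff, D.mem_toSet_iff, D.cubeAt_mono (by omega) hy]
      by_cases hyQ : y ∈ D.toSet Q
      · rw [Set.indicator_of_mem hyQ, Set.indicator_of_mem (hiff.1 hyQ)]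
      · rw [Set.indicator_of_notMem hyQ, Set.indicator_of_notMem fun h' => hyQ (hiff.2 h')]
    unfold paraKernel
    rw [paraFun_congr b Q hx, h1]
  · have hV := D.volume_real_toSet_pos Q
    unfold paraKernel
    split_ifs with hs
    · rw [abs_mul, abs_mul, abs_of_pos (inv_pos.2 hV), mul_comm _ |paraFun D r b Q x|]
      have h1 : |paraFun D r b Q x| ≤ A Q := by
        by_cases hx : x ∈ D.toSet Q
        · exact hA Q hs x hx
        · rw [paraFun_of_notMem hx]; simp
      have h2 : |(D.toSet Q).indicator (fun _ => (1 : ℝ)) y| ≤ 1 := by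
        by_cases hy : y ∈ D.toSet Q <;> simp [hy]
      calc _ ≤ (A Q : ℝ) * (volume.real (D.toSet Q))⁻¹ * 1 := by gcongr
        _ = _ := mul_one _
    · rw [abs_zero]; positivity
  · unfold paraKernel
    split_ifs with hs
    · rw [integral_mul_const, integral_const_mul]
      have : ∫ x in D.toSet Q, paraFun D r b Q x = 0 := by
        simp only [paraFun]
        rw [integral_sub (hm Q).1 (hm Q).2, setIntegral_cubeProj (by omega) (hb Q),
          setIntegral_cubeProj (by omega) (hb Q), sub_zero]
      rw [this]
      simp
    · simp
  · by_contra hs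
    refine hQ ?_
    ext x y
    simp [paraKernel, hs]

theorem kernelPiece_paraKernel {b : (Fin N → ℝ) → ℝ} {Q : Cube N}
    (hQ : ∃ j : ℤ, Q.scale = c + (r + 1) * j) :
    kernelPiece (paraKernel D r c b) Q = D.paraPiece r b Q := by
  ext f x
  simp only [kernelPiece, paraKernel, if_pos hQ, DyadicLattice.paraPiece, finsum_martDiff_eq]
  have : ∀ y, (volume.real (D.toSet Q))⁻¹ * paraFun D r b Q x *
      (D.toSet Q).indicator (fun _ => (1 : ℝ)) y * f y =
      (volume.real (D.toSet Q))⁻¹ * paraFun D r b Q x * (D.toSet Q).indicator f y := fun y => by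
    by_cases hy : y ∈ D.toSet Q <;> simp [hy]
  simp_rw [this]
  rw [integral_const_mul, integral_indicator (D.measurableSet_toSet Q), setAverage_eq, smul_eq_mul]
  ring

theorem kernelPiece_congr_ae {f g : (Fin N → ℝ) → ℝ} (hfg : f =ᵐ[volume] g) (Q : Cube N) :
    kernelPiece K Q f = kernelPiece K Q g := by
  ext x
  exact integral_congr_ae (hfg.mono fun y hy => by simp only [hy])

theorem partialSum_congr_ae {f g : (Fin N → ℝ) → ℝ} (hfg : f =ᵐ[volume] g)
    (s : Finset (Cube N)) : partialSum K s f = partialSum K s g := by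
  ext x
  simp only [partialSum, kernelPiece_congr_ae hfg]

/-- By orthogonality, the partial sums of `T u` have `L²` norm at most that of `T u`. -/
theorem IsShift.eLpNorm_partialSum_le (hK : IsShift D A r c K)
    {T : Lp ℝ 2 (volume : Measure (Fin N → ℝ)) →L[ℝ] Lp ℝ 2 (volume : Measure (Fin N → ℝ))}
    (hT : IsL2Sum T (kernelPiece K)) (s : Finset (Cube N))
    (u : Lp ℝ 2 (volume : Measure (Fin N → ℝ))) :
    eLpNorm (partialSum K s u) 2 volume ≤ eLpNorm (T u) 2 volume := by
  have hi := integrableOn_of_memLp (D := D) (Lp.memLp u)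
  -- By orthogonality enlarging the set of cubes only adds nonnegative terms to the squared norm;
  -- the limit over all finite sets then compares with `T u`.
  have hmono : ∀ s', s ⊆ s' →
      eLpNorm (partialSum K s u) 2 volume ≤ eLpNorm (partialSum K s' u) 2 volume := by
    intro s' hs
    refine (ENNReal.pow_le_pow_left_iff two_ne_zero).1 ?_
    rw [eLpNorm_two_sq_eq_lintegral, eLpNorm_two_sq_eq_lintegral,
      lintegral_enorm_sq_eq (hK.memLp_partialSum s hi),
      lintegral_enorm_sq_eq (hK.memLp_partialSum s' hi), hK.integral_partialSum_sq s hi,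
      hK.integral_partialSum_sq s' hi]
    exact ENNReal.ofReal_le_ofReal (Finset.sum_le_sum_of_subset_of_nonneg hs fun Q _ _ =>
      integral_nonneg fun x => sq_nonneg _)
  have hlim : Tendsto (fun s' : Finset (Cube N) => eLpNorm (T u) 2 volume +
      eLpNorm (fun x => T u x - ∑ Q ∈ s', kernelPiece K Q u x) 2 volume) atTop
      (𝓝 (eLpNorm (T u) 2 volume + 0)) := (hT u).const_add _
  rw [add_zero] at hlim
  refine ge_of_tendsto hlim ?_
  filter_upwards [eventually_ge_atTop s] with s' hs'
  refine (hmono s' hs').trans ?_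
  have : partialSum K s' u = T u - fun x => T u x - ∑ Q ∈ s', kernelPiece K Q u x := by
    ext x
    simp [partialSum]
  rw [this]
  refine eLpNorm_sub_le (Lp.aestronglyMeasurable _) ?_ one_le_two
  exact (Lp.aestronglyMeasurable (T u)).sub
    (hK.measurable_partialSum s' u).aestronglyMeasurable

theorem eLpNorm_apply_le
    (T : Lp ℝ 2 (volume : Measure (Fin N → ℝ)) →L[ℝ] Lp ℝ 2 (volume : Measure (Fin N → ℝ)))
    (u : Lp ℝ 2 (volume : Measure (Fin N → ℝ))) :
    eLpNorm (T u) 2 volume ≤ ENNReal.ofReal ‖T‖ * eLpNorm u 2 volume := by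
  rw [← Lp.enorm_def, ← Lp.enorm_def, ← ofReal_norm, ← ofReal_norm,
    ← ENNReal.ofReal_mul (norm_nonneg _)]
  exact ENNReal.ofReal_le_ofReal (T.le_opNorm u)

theorem isL2Sum_congr
    {T : Lp ℝ 2 (volume : Measure (Fin N → ℝ)) →L[ℝ] Lp ℝ 2 (volume : Measure (Fin N → ℝ))}
    {t : Cube N → ((Fin N → ℝ) → ℝ) → (Fin N → ℝ) → ℝ} (hT : IsL2Sum T t)
    (ht : t = kernelPiece K) : IsL2Sum T (kernelPiece K) := ht ▸ hT

theorem locallyIntegrable_integrableOn {b : (Fin N → ℝ) → ℝ} (hb : LocallyIntegrable b)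
    (Q : Cube N) : IntegrableOn b (D.toSet Q) := by
  refine (hb.integrableOn_isCompact (isCompact_univ_pi (s := fun i =>
    Set.Icc (D.origin Q.scale i + (2 : ℝ) ^ Q.scale * Q.pos i)
      (D.origin Q.scale i + (2 : ℝ) ^ Q.scale * (Q.pos i + 1))) fun i => isCompact_Icc)).mono_set ?_
  rw [D.toSet_eq_pi]
  exact Set.pi_mono fun i _ => Set.Ico_subset_Icc_self

/-- The bound on `∑_{R ∈ ch^r Q} Δ_R b` that follows from the bound on the norm of the
paraproduct. -/
theorem abs_paraFun_le {b : (Fin N → ℝ) → ℝ} (hb : ∀ Q, IntegrableOn b (D.toSet Q))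
    {T : Lp ℝ 2 (volume : Measure (Fin N → ℝ)) →L[ℝ] Lp ℝ 2 (volume : Measure (Fin N → ℝ))}
    (hT : IsL2Sum T (kernelPiece (paraKernel D r c b)))
    (hTn : ‖T‖ ≤ (2 : ℝ) ^ (-((N : ℝ) * r / 2)))
    {Q : Cube N} (hQ : ∃ j : ℤ, Q.scale = c + (r + 1) * j) (x : Fin N → ℝ) :
    |paraFun D r b Q x| ≤ 2 ^ N := by
  -- Crude bounds, different for each cube, are enough to apply the orthogonality of the pieces.
  have hbd : ∀ Q : Cube N, ∃ B : ℝ≥0, ∀ x ∈ D.toSet Q, |paraFun D r b Q x| ≤ B := by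
    intro Q
    obtain ⟨B, hB⟩ := exists_cubeProj_le (D := D) (j := Q.scale - (r + 1)) (by omega) (hb Q)
    obtain ⟨B', hB'⟩ := exists_cubeProj_le (D := D) (j := Q.scale - r) (by omega) (hb Q)
    refine ⟨(B + B').toNNReal, fun x hx => (le_trans ?_ (Real.le_coe_toNNReal _))⟩
    exact (abs_sub _ _).trans (add_le_add (hB x hx) (hB' x hx))
  choose A hA using hbd
  have hK : IsShift D A r c (paraKernel D r c b) :=
    isShift_paraKernel c hb fun Q _ => hA Q
  set V := volume.real (D.toSet Q) with hV
  have hVpos : 0 < V := D.volume_real_toSet_pos Q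
  have hind : MemLp ((D.toSet Q).indicator fun _ => (1 : ℝ)) 2 :=
    memLp_indicator_const 2 (D.measurableSet_toSet Q) 1 (.inr (D.volume_toSet_ne_top Q))
  -- Testing on `1_Q` isolates the output function of the piece at `Q`, whose norm is at most `‖T‖
  -- |Q|^(1/2)`.
  set u := hind.toLp with hu
  have hpiece : partialSum (paraKernel D r c b) {Q} u = paraFun D r b Q := by
    rw [partialSum_congr_ae hind.coeFn_toLp]
    ext z
    rw [partialSum, Finset.sum_singleton, kernelPiece_paraKernel hQ, DyadicLattice.paraPiece,
      finsum_martDiff_eq, setAverage_eq, setIntegral_indicator (D.measurableSet_toSet Q),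
      Set.inter_self, setIntegral_const, smul_eq_mul, smul_eq_mul, mul_one,
      inv_mul_cancel₀ hVpos.ne', one_mul]
  have hi := integrableOn_of_memLp (D := D) (Lp.memLp u)
  have hpm : MemLp (paraFun D r b Q) 2 := hpiece ▸ hK.memLp_partialSum {Q} hi
  have h1 := (hK.eLpNorm_partialSum_le hT {Q} u).trans (eLpNorm_apply_le T u)
  rw [hpiece, eLpNorm_congr_ae hind.coeFn_toLp] at h1
  have h2 := ENNReal.pow_le_pow_left h1 (n := 2)
  rw [mul_pow, eLpNorm_two_sq_eq_lintegral, eLpNorm_two_sq_eq_lintegral,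
    lintegral_enorm_sq_eq hpm, lintegral_enorm_sq_eq hind, ← ENNReal.ofReal_pow (norm_nonneg _),
    ← ENNReal.ofReal_mul (by positivity), ENNReal.ofReal_le_ofReal_iff (by positivity)] at h2
  have h3 : ∫ z, (D.toSet Q).indicator (fun _ => (1 : ℝ)) z ^ 2 = V := by
    have : ∀ z, (D.toSet Q).indicator (fun _ => (1 : ℝ)) z ^ 2 =
        (D.toSet Q).indicator (fun _ => (1 : ℝ)) z := fun z => by
      by_cases hz : z ∈ D.toSet Q <;> simp [hz]
    simp_rw [this]
    rw [integral_indicator (D.measurableSet_toSet Q), setIntegral_const, smul_eq_mul, mul_one]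
  rw [h3] at h2
  set P := D.cubeAt (Q.scale - (r + 1)) x with hP
  have h4 : volume.real (D.toSet P) * paraFun D r b Q x ^ 2 ≤ ∫ z, paraFun D r b Q z ^ 2 := by
    rw [← smul_eq_mul, ← setIntegral_const,
      setIntegral_congr_fun (g := fun z => paraFun D r b Q z ^ 2) (D.measurableSet_toSet P)
        (fun z hz => by simp only [paraFun_congr b Q (D.mem_cubeAt_iff.1 hz)])]
    exact setIntegral_le_integral hpm.integrable_sq (.of_forall fun _ => sq_nonneg _)
  -- The output function is constant on `P`. The ratio `|Q| / |P| = 2 ^ (N * (r + 1))` is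
  -- compensated by `‖T‖² ≤ 2 ^ (-N * r)` up to `2 ^ N`, which explains the normalization of the
  -- paraproduct.
  have h5 : V = 2 ^ N * 2 ^ (N * r) * volume.real (D.toSet P) := by
    rw [hV, hP, D.volume_real_toSet, D.volume_real_toSet, DyadicLattice.cubeAt_scale,
      zpow_sub₀ two_ne_zero, div_pow, pow_mul', ← mul_pow]
    have : (2 : ℝ) ^ ((r : ℤ) + 1) = 2 * 2 ^ r := by
      rw [zpow_add₀ two_ne_zero, zpow_one, zpow_natCast, mul_comm]
    rw [this]
    field_simp
  have h6 : ‖T‖ ^ 2 ≤ (2 ^ (N * r))⁻¹ := by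
    calc ‖T‖ ^ 2 ≤ ((2 : ℝ) ^ (-((N : ℝ) * r / 2))) ^ 2 := by gcongr
      _ = _ := by
        rw [← Real.rpow_natCast, ← Real.rpow_mul zero_le_two, ← Real.rpow_natCast 2 (N * r),
          ← Real.rpow_neg zero_le_two]
        congr 1
        push_cast
        ring
  have hPpos : 0 < volume.real (D.toSet P) := D.volume_real_toSet_pos P
  have h7 : volume.real (D.toSet P) * paraFun D r b Q x ^ 2 ≤ volume.real (D.toSet P) * 2 ^ N := by
    calc _ ≤ ‖T‖ ^ 2 * V := h4.trans h2
      _ ≤ (2 ^ (N * r))⁻¹ * V := by gcongr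
      _ = _ := by rw [h5]; field_simp
  have h8 := le_of_mul_le_mul_left h7 hPpos
  refine abs_le_of_sq_le_sq (h8.trans ?_) (by positivity)
  exact le_self_pow₀ (one_le_pow₀ one_le_two) two_ne_zero

theorem IsShift.isL2Contractive_of_isL2Sum (hK : IsShift D A r c K)
    {T : Lp ℝ 2 (volume : Measure (Fin N → ℝ)) →L[ℝ] Lp ℝ 2 (volume : Measure (Fin N → ℝ))}
    (hT : IsL2Sum T (kernelPiece K)) (hTn : ‖T‖ ≤ 1) : IsL2Contractive K := by
  intro s h hh
  rw [← eLpNorm_two_sq_eq_lintegral, ← eLpNorm_two_sq_eq_lintegral,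
    ← partialSum_congr_ae hh.coeFn_toLp, ← eLpNorm_congr_ae hh.coeFn_toLp]
  refine ENNReal.pow_le_pow_left
    ((hK.eLpNorm_partialSum_le hT s _).trans ((eLpNorm_apply_le T _).trans ?_))
  exact mul_le_of_le_one_left' (ENNReal.ofReal_le_one.2 hTn)

open Classical in
/-- The kernels of a big Haar shift, put to zero off the scales `c + (r + 1) ℤ`. -/
noncomputable def haarKernel (r : ℕ) (c : ℤ) (K : Cube N → (Fin N → ℝ) → (Fin N → ℝ) → ℝ)
    (Q : Cube N) (x y : Fin N → ℝ) : ℝ :=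
  if ∃ j : ℤ, Q.scale = c + (r + 1) * j then K Q x y else 0

theorem isShift_haarKernel (c : ℤ) (hK : D.IsBigHaarKernel r K) :
    IsShift D 1 r c (haarKernel r c K) := by
  refine ⟨fun Q x y hne => ?_, fun Q x x' y y' hx hy => ?_, fun Q x y => ?_, fun Q y => ?_,
    fun Q hQ => ?_⟩
  · by_contra hxy
    exact hne (by simp [haarKernel, hK.support Q x y hxy])
  · unfold haarKernel
    split_ifs with hs
    · have ex : x ∈ D.toSet Q ↔ x' ∈ D.toSet Q := by
        rw [D.mem_toSet_iff, D.mem_toSet_iff, D.cubeAt_mono (by omega) hx]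
      have ey : y ∈ D.toSet Q ↔ y' ∈ D.toSet Q := by
        rw [D.mem_toSet_iff, D.mem_toSet_iff, D.cubeAt_mono (by omega) hy]
      by_cases hxy : x ∈ D.toSet Q ∧ y ∈ D.toSet Q
      · have mx := cubeAt_mem_ch hxy.1 (r + 1)
        have my := cubeAt_mem_ch hxy.2 (r + 1)
        push_cast at mx my
        exact hK.const Q _ mx _ my x (D.mem_cubeAt _ x) x' (D.mem_cubeAt_iff.2 hx.symm) y
          (D.mem_cubeAt _ y) y' (D.mem_cubeAt_iff.2 hy.symm)
      · rw [hK.support Q x y hxy, hK.support Q x' y' (by rwa [← ex, ← ey])]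
    · rfl
  · unfold haarKernel
    split_ifs with hs
    · simpa using hK.bound Q x y
    · rw [abs_zero]; positivity
  · unfold haarKernel
    split_ifs with hs
    · exact hK.cancel_left Q y
    · simp
  · by_contra hs
    refine hQ ?_
    ext x y
    simp [haarKernel, hs]

theorem IsShift.mono (hK : IsShift D A r c K) {B : Cube N → ℝ≥0} (hAB : ∀ Q, A Q ≤ B Q) :
    IsShift D B r c K where
  support := hK.support
  const := hK.const
  bound Q x y := (hK.bound Q x y).trans <| by
    have : (A Q : ℝ) ≤ B Q := hAB Q
    gcongr
  cancel := hK.cancel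
  separated := hK.separated

/-- Both separated big Haar shifts and separated paraproducts are separated shifts. -/
theorem exists_isShift
    {T : Lp ℝ 2 (volume : Measure (Fin N → ℝ)) →L[ℝ] Lp ℝ 2 (volume : Measure (Fin N → ℝ))}
    {t : Cube N → ((Fin N → ℝ) → ℝ) → (Fin N → ℝ) → ℝ} (hT : IsL2Sum T t) (ht : IsSeparated r t)
    (h : (∃ K : Cube N → (Fin N → ℝ) → (Fin N → ℝ) → ℝ,
            D.IsBigHaarKernel r K ∧ t = kernelPiece K) ∨
          (∃ b : (Fin N → ℝ) → ℝ, LocallyIntegrable b volume ∧ t = D.paraPiece r b ∧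
            ‖T‖ ≤ (2 : ℝ) ^ (-((N : ℝ) * r / 2)))) :
    ∃ (c : ℤ) (K : Cube N → (Fin N → ℝ) → (Fin N → ℝ) → ℝ),
      IsShift D (fun _ => 2 ^ N) r c K ∧ IsL2Contractive K ∧ IsL2Sum T (kernelPiece K) := by
  obtain ⟨k, -, hk⟩ := ht
  refine ⟨k, ?_⟩
  -- Separation is given for the operators `t Q` and not for the kernels. Off the progression the
  -- kernels are replaced by zero, which leaves the operators unchanged.
  have hzero : ∀ Q : Cube N, (¬ ∃ j : ℤ, Q.scale = k + (r + 1) * j) → t Q = 0 := fun Q hQ => by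
    by_contra hne
    exact hQ (hk Q hne)
  rcases h with ⟨K, hK, rfl⟩ | ⟨b, hb, rfl, hTn⟩
  · have hS := isShift_haarKernel (c := k) hK
    refine ⟨haarKernel r k K, hS.mono fun Q => ?_, hS.isL2Contractive fun Q x => ?_, ?_⟩
    · exact one_le_pow₀ one_le_two
    · unfold haarKernel
      split_ifs
      · exact hK.cancel_right Q x
      · simp
    · refine isL2Sum_congr hT (funext fun Q => ?_)
      by_cases hQ : ∃ j : ℤ, Q.scale = k + (r + 1) * j
      · ext f x
        simp [kernelPiece, haarKernel, hQ]
      · rw [hzero Q hQ]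
        ext f x
        simp [kernelPiece, haarKernel, hQ]
  · have hbi := locallyIntegrable_integrableOn (D := D) hb
    have hT' : IsL2Sum T (kernelPiece (paraKernel D r k b)) := by
      refine isL2Sum_congr hT (funext fun Q => ?_)
      by_cases hQ : ∃ j : ℤ, Q.scale = k + (r + 1) * j
      · exact (kernelPiece_paraKernel hQ).symm
      · rw [hzero Q hQ]
        ext f x
        simp [kernelPiece, paraKernel, hQ]
    have hS : IsShift D (fun _ => 2 ^ N) r k (paraKernel D r k b) :=
      isShift_paraKernel k hbi fun Q hQ x _ => by
        simpa using abs_paraFun_le hbi hT' hTn hQ x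
    refine ⟨_, hS, hS.isL2Contractive_of_isL2Sum hT' (hTn.trans ?_), hT'⟩
    exact Real.rpow_le_one_of_one_le_of_nonpos one_le_two (by
      have : (0 : ℝ) ≤ N * r / 2 := by positivity
      linarith)

end ConvexBody

/-! ### Extension to `L¹` by convergence in measure. -/

namespace ConvexBody

open scoped NNReal

/-- A sequence that is rapidly Cauchy in measure converges in measure. -/
theorem exists_tendstoInMeasure {α : Type*} [MeasurableSpace α] {μ : Measure α} {f : ℕ → α → ℝ}
    {B : ℝ≥0∞} (hB : B ≠ ∞)
    (hf : ∀ n : ℕ, μ {x | (1 / 2 : ℝ) ^ n ≤ ‖f (n + 1) x - f n x‖} ≤ B * (2⁻¹) ^ n) :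
    ∃ g : α → ℝ, TendstoInMeasure μ f atTop g := by
  set E : ℕ → Set α := fun n => {x | (1 / 2 : ℝ) ^ n ≤ ‖f (n + 1) x - f n x‖} with hE
  refine ⟨fun x => limUnder atTop fun n => f n x, tendstoInMeasure_iff_norm.2 fun ε hε => ?_⟩
  -- Off the union of the tail sets the increments are dominated by a geometric series, which gives
  -- the pointwise limit together with a rate.
  have hdist : ∀ n x, x ∉ ⋃ m, E (m + n) →
      ‖f n x - limUnder atTop fun n => f n x‖ ≤ 2 * (1 / 2 : ℝ) ^ n := by
    intro n x hx
    have hstep : ∀ m, dist (f (m + n) x) (f (m + 1 + n) x) ≤ (1 / 2 : ℝ) ^ n * (1 / 2) ^ m := by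
      intro m
      have hm : x ∉ E (m + n) := fun h => hx (Set.mem_iUnion.2 ⟨m, h⟩)
      simp only [hE, Set.mem_ofPred_eq, not_le] at hm
      rw [dist_comm, dist_eq_norm, show m + 1 + n = m + n + 1 by ring, ← pow_add, add_comm n m]
      exact hm.le
    have hc : CauchySeq fun m => f (m + n) x := cauchySeq_of_le_geometric _ _ one_half_lt_one hstep
    have hlim : Tendsto (fun m => f (m + n) x) atTop (𝓝 (limUnder atTop fun n => f n x)) := by
      obtain ⟨a, ha⟩ := cauchySeq_tendsto_of_complete hc
      have ha' := (tendsto_add_atTop_iff_nat (f := fun m => f m x) n).1 ha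
      rwa [ha'.limUnder_eq]
    have := dist_le_of_le_geometric_of_tendsto₀ _ _ one_half_lt_one hstep hlim
    rw [dist_eq_norm, zero_add] at this
    refine this.trans (le_of_eq ?_)
    ring
  have hsum : ∑' m : ℕ, B * (2⁻¹ : ℝ≥0∞) ^ m ≠ ∞ := by
    rw [ENNReal.tsum_mul_left, ENNReal.tsum_geometric]
    refine ENNReal.mul_ne_top hB ?_
    simp
  have htail := ENNReal.tendsto_sum_nat_add _ hsum
  have hev : ∀ᶠ n : ℕ in atTop, 2 * (1 / 2 : ℝ) ^ n < ε := by
    have : Tendsto (fun n : ℕ => 2 * (1 / 2 : ℝ) ^ n) atTop (𝓝 (2 * 0)) :=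
      (tendsto_pow_atTop_nhds_zero_of_lt_one (by norm_num) one_half_lt_one).const_mul _
    rw [mul_zero] at this
    exact this.eventually_lt_const hε
  refine tendsto_of_tendsto_of_tendsto_of_le_of_le' tendsto_const_nhds htail
    (.of_forall fun _ => zero_le) ?_
  filter_upwards [hev] with n hn
  calc _ ≤ μ (⋃ m, E (m + n)) := measure_mono fun x hx => by
        by_contra hx'
        exact absurd (hdist n x hx') (not_le.2 (hn.trans_le hx))
    _ ≤ ∑' m, μ (E (m + n)) := measure_iUnion_le _
    _ ≤ _ := ENNReal.tsum_le_tsum fun m => hf (m + n)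

theorem measure_norm_add_le {α : Type*} [MeasurableSpace α] (μ : Measure α) (f g : α → ℝ) (ε : ℝ) :
    μ {x | ε ≤ ‖f x + g x‖} ≤ μ {x | ε / 2 ≤ ‖f x‖} + μ {x | ε / 2 ≤ ‖g x‖} := by
  refine (measure_mono fun x hx => ?_).trans (measure_union_le _ _)
  by_contra h
  simp only [Set.mem_union, Set.mem_ofPred_eq, not_or, not_le] at h hx
  have := norm_add_le (f x) (g x)
  linarith [h.1, h.2]

variable {N : ℕ} {D : DyadicLattice N} {A : Cube N → ℝ≥0} {r : ℕ} {c : ℤ}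
  {K : Cube N → (Fin N → ℝ) → (Fin N → ℝ) → ℝ} {h : (Fin N → ℝ) → ℝ}

/-- Uniform weak type `(1,1)` for the partial sums. -/
def HasWeakType (K : Cube N → (Fin N → ℝ) → (Fin N → ℝ) → ℝ) (W : ℝ≥0) : Prop :=
  ∀ (s : Finset (Cube N)) (h : (Fin N → ℝ) → ℝ), Integrable h → ∀ ε : ℝ, 0 < ε →
    volume {x | ε ≤ ‖partialSum K s h x‖} ≤ ENNReal.ofReal (2 / ε) * W * ∫⁻ y, ‖h y‖ₑ

/-- `weak_type` is applied at level `ε / 2`; the factor 2 pays for passing from a strict inequality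
to a weak one. -/
theorem hasWeakType (hN : 1 ≤ N) {A : ℝ≥0} (hK : IsShift D (fun _ => A) r c K)
    (hL : IsL2Contractive K) : HasWeakType K (weakConst N A) := by
  intro s h hh ε hε
  have h1 := weak_type hN hK hL s hh (ε / 2).toNNReal
  have h0 : ENNReal.ofReal (ε / 2) ≠ 0 := by simpa using hε
  have h2 : ((ε / 2).toNNReal : ℝ≥0∞) = ENNReal.ofReal (ε / 2) := rfl
  rw [h2] at h1
  rw [mul_assoc, show 2 / ε = (ε / 2)⁻¹ by rw [inv_div], ENNReal.ofReal_inv_of_pos (by positivity)]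
  refine le_trans (measure_mono fun x hx => ?_)
    ((ENNReal.mul_le_iff_le_inv h0 ENNReal.ofReal_ne_top).1 h1)
  simp only [Set.mem_ofPred_eq] at hx ⊢
  rw [← ofReal_norm]
  exact (ENNReal.ofReal_lt_ofReal_iff (by linarith)).2 (by linarith)

section L1Value

variable {T : Lp ℝ 2 (volume : Measure (Fin N → ℝ)) →L[ℝ] Lp ℝ 2 (volume : Measure (Fin N → ℝ))}
  {W : ℝ≥0}

theorem IsShift.tendstoInMeasure_partialSum (hK : IsShift D A r c K)
    (hT : IsL2Sum T (kernelPiece K)) (u : Lp ℝ 2 (volume : Measure (Fin N → ℝ))) :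
    TendstoInMeasure volume (fun s => partialSum K s u) atTop (T u) := by
  refine tendstoInMeasure_of_tendsto_eLpNorm two_ne_zero
    (fun s => (hK.measurable_partialSum s u).aestronglyMeasurable) (Lp.aestronglyMeasurable _) ?_
  refine (hT u).congr fun s => ?_
  rw [eLpNorm_sub_comm]
  rfl

/-- The bound for partial sums passes to `T u` through convergence in measure. If `u` is not
integrable the right side is infinite, because `W ≠ 0`. -/
theorem IsShift.weakType_apply (hK : IsShift D A r c K) (hW : HasWeakType K W) (hW0 : W ≠ 0)
    (hT : IsL2Sum T (kernelPiece K)) (u : Lp ℝ 2 (volume : Measure (Fin N → ℝ))) {ε : ℝ}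
    (hε : 0 < ε) :
    volume {x | ε ≤ ‖T u x‖} ≤ ENNReal.ofReal (4 / ε) * W * ∫⁻ y, ‖u y‖ₑ := by
  by_cases hu : Integrable u
  swap
  · have : ∫⁻ y, ‖u y‖ₑ = ∞ := by
      by_contra h
      exact hu ⟨Lp.aestronglyMeasurable u, Ne.lt_top h⟩
    rw [this, ENNReal.mul_top]
    · exact le_top
    · have : 0 < 4 / ε := by positivity
      simp [hW0, hε]
  have hlim := (tendstoInMeasure_iff_norm.1 (hK.tendstoInMeasure_partialSum hT u) (ε / 2)
    (by positivity)).const_add (ENNReal.ofReal (4 / ε) * W * ∫⁻ y, ‖u y‖ₑ)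
  rw [add_zero] at hlim
  refine ge_of_tendsto' hlim fun s => ?_
  have h1 := measure_norm_add_le volume (partialSum K s u) (fun x => T u x - partialSum K s u x) ε
  simp only [add_sub_cancel] at h1
  refine h1.trans (add_le_add ?_ (le_of_eq ?_))
  · have := hW s u hu (ε / 2) (by positivity)
    rwa [show 2 / (ε / 2) = 4 / ε by field_simp; norm_num] at this
  · simp only [norm_sub_rev]

/-- The value `T f` for `f ∈ L¹` exists, and the partial sums converge to it in measure. -/
theorem IsShift.exists_isL1Value (hK : IsShift D A r c K) (hW : HasWeakType K W) (hW0 : W ≠ 0)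
    (hT : IsL2Sum T (kernelPiece K)) {f : (Fin N → ℝ) → ℝ} (hf : Integrable f) :
    ∃ g, IsL1Value T f g ∧ TendstoInMeasure volume (fun s => partialSum K s f) atTop g := by
  have hdense : ∀ n : ℕ, ∃ w : Lp ℝ 2 (volume : Measure (Fin N → ℝ)),
      ∫⁻ x, ‖f x - w x‖ₑ ≤ (4⁻¹) ^ n ∧ Integrable w := by
    intro n
    obtain ⟨w, hw1, hw2, hw3, hw4⟩ := hf.exists_hasCompactSupport_lintegral_sub_le
      (ε := (4⁻¹) ^ n) (by simp)
    have hm : MemLp w 2 volume := hw3.memLp_of_hasCompactSupport hw1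
    refine ⟨hm.toLp, le_of_eq_of_le (lintegral_congr_ae ?_) hw2, hw4.congr hm.coeFn_toLp.symm⟩
    filter_upwards [hm.coeFn_toLp] with x hx
    rw [hx]
  choose w hw hwi using hdense
  have hsub : ∀ u v : Lp ℝ 2 (volume : Measure (Fin N → ℝ)), ∀ {ε : ℝ}, 0 < ε →
      volume {x | ε ≤ ‖T u x - T v x‖} ≤
        ENNReal.ofReal (4 / ε) * W * ((∫⁻ x, ‖u x - f x‖ₑ) + ∫⁻ x, ‖f x - v x‖ₑ) := by
    intro u v ε hε
    have h1 : ∀ᵐ x, T (u - v) x = T u x - T v x := by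
      rw [map_sub]
      exact Lp.coeFn_sub _ _
    have h2 : volume {x | ε ≤ ‖T u x - T v x‖} ≤ volume {x | ε ≤ ‖T (u - v) x‖} := by
      refine measure_mono_ae ?_
      filter_upwards [h1] with x hx hxε
      change ε ≤ ‖T (u - v) x‖
      rw [hx]
      exact hxε
    refine h2.trans ((hK.weakType_apply hW hW0 hT (u - v) hε).trans (mul_le_mul_right ?_ _))
    rw [← lintegral_add_right' _ (by exact (hf.1.sub (Lp.aestronglyMeasurable v)).enorm)]
    refine lintegral_mono_ae ?_
    filter_upwards [Lp.coeFn_sub u v] with x hx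
    rw [hx, Pi.sub_apply, ← sub_add_sub_cancel (u x) (f x) (v x)]
    exact enorm_add_le _ _
  have hwn : ∀ n, ∫⁻ x, ‖w n x - f x‖ₑ ≤ (4⁻¹) ^ n := fun n => by
    simpa only [enorm_sub_rev] using hw n
  -- An `L¹` error of order `4 ^ (-n)` against the threshold `2 ^ (-n)` leaves the summable measure
  -- bound `8 * W * 2 ^ (-n)`.
  obtain ⟨g, hg⟩ := exists_tendstoInMeasure (μ := volume) (f := fun n => T (w n))
    (B := 8 * W) (by finiteness) fun n => by
      refine (hsub (w (n + 1)) (w n) (by positivity)).trans ?_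
      have e1 : ENNReal.ofReal (4 / (1 / 2) ^ n) = 4 * 2 ^ n := by
        rw [one_div, inv_pow, div_inv_eq_mul, ENNReal.ofReal_mul (by norm_num),
          ENNReal.ofReal_pow zero_le_two]
        simp
      rw [e1]
      have e2 : (∫⁻ x, ‖w (n + 1) x - f x‖ₑ) + ∫⁻ x, ‖f x - w n x‖ₑ ≤ 2 * (4⁻¹) ^ n := by
        rw [two_mul]
        refine add_le_add ((hwn (n + 1)).trans ?_) (hw n)
        exact pow_le_pow_right_of_le_one' (by simp [ENNReal.inv_le_one]) (Nat.le_succ n)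
      have e3 : (2 : ℝ≥0∞) ^ n * (4⁻¹) ^ n = (2⁻¹) ^ n := by
        rw [← mul_pow]
        congr 1
        rw [show (4 : ℝ≥0∞) = 2 * 2 by norm_num,
          ENNReal.mul_inv (.inl two_ne_zero) (.inl ENNReal.ofNat_ne_top), ← mul_assoc,
          ENNReal.mul_inv_cancel two_ne_zero ENNReal.ofNat_ne_top, one_mul]
      calc _ ≤ 4 * 2 ^ n * (W : ℝ≥0∞) * (2 * (4⁻¹) ^ n) := mul_le_mul_right e2 _
        _ = 8 * (W : ℝ≥0∞) * (2 ^ n * (4⁻¹) ^ n) := by ring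
        _ = _ := by rw [e3]
  have h4 : Tendsto (fun n : ℕ => (4⁻¹ : ℝ≥0∞) ^ n) atTop (𝓝 0) :=
    ENNReal.tendsto_pow_atTop_nhds_zero_of_lt_one (by simp)
  refine ⟨g, fun u hu => tendstoInMeasure_iff_norm.2 fun ε hε => ?_,
    tendstoInMeasure_iff_norm.2 fun ε hε => ?_⟩
  · have hC : ENNReal.ofReal (4 / (ε / 2)) * W ≠ ∞ := by finiteness
    simp only [eLpNorm_one_eq_lintegral_enorm] at hu
    have hlim := (ENNReal.Tendsto.const_mul (hu.add h4) (.inr hC)).add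
      (tendstoInMeasure_iff_norm.1 hg (ε / 2) (by positivity))
    rw [add_zero, add_zero, mul_zero] at hlim
    refine tendsto_of_tendsto_of_tendsto_of_le_of_le tendsto_const_nhds hlim
      (fun _ => zero_le) fun n => ?_
    have h1 := measure_norm_add_le volume (fun x => T (u n) x - T (w n) x)
      (fun x => T (w n) x - g x) ε
    simp only [sub_add_sub_cancel] at h1
    refine h1.trans (add_le_add_left ((hsub (u n) (w n) (by positivity)).trans ?_) _)
    exact mul_le_mul_right (add_le_add_right (hw n) _) _
  · have hC : ENNReal.ofReal (2 / (ε / 2)) * W ≠ ∞ := by finiteness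
    refine ENNReal.tendsto_nhds_zero.2 fun δ hδ => ?_
    have hδ' : 0 < δ / 2 := by simpa using hδ.ne'
    have hlim := (ENNReal.Tendsto.const_mul h4 (.inr hC)).add
      (tendstoInMeasure_iff_norm.1 hg (ε / 2 / 2) (by positivity))
    rw [mul_zero, add_zero] at hlim
    -- The weak type bound is uniform in `s`, so `n` is fixed first; then only the convergence of
    -- the partial sums of one `L²` function remains.
    obtain ⟨n, hn⟩ := (ENNReal.tendsto_nhds_zero.1 hlim (δ / 2) hδ').exists
    have hs := ENNReal.tendsto_nhds_zero.1 (tendstoInMeasure_iff_norm.1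
      (hK.tendstoInMeasure_partialSum hT (w n)) (ε / 2 / 2) (by positivity)) (δ / 2) hδ'
    filter_upwards [hs] with s hs
    have h1 := measure_norm_add_le volume (fun x => partialSum K s f x - partialSum K s (w n) x)
      (fun x => partialSum K s (w n) x - g x) ε
    have h2 := measure_norm_add_le volume (fun x => partialSum K s (w n) x - T (w n) x)
      (fun x => T (w n) x - g x) (ε / 2)
    simp only [sub_add_sub_cancel] at h1 h2
    have h3 := hW s (fun x => f x - w n x) (hf.sub (hwi n)) (ε / 2) (by positivity)
    have hps : ∀ x, partialSum K s (fun x => f x - w n x) x =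
        partialSum K s f x - partialSum K s (w n) x := fun x =>
      hK.partialSum_sub s x (fun Q => hf.integrableOn) fun Q => (hwi n).integrableOn
    simp only [hps] at h3
    calc _ ≤ _ := h1
      _ ≤ ENNReal.ofReal (2 / (ε / 2)) * W * (4⁻¹) ^ n + (δ / 2 +
          volume {x | ε / 2 / 2 ≤ ‖T (w n) x - g x‖}) :=
        add_le_add (h3.trans (mul_le_mul_right (hw n) _)) (h2.trans (add_le_add_left hs _))
      _ = δ / 2 + (ENNReal.ofReal (2 / (ε / 2)) * W * (4⁻¹) ^ n +
          volume {x | ε / 2 / 2 ≤ ‖T (w n) x - g x‖}) := by ring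
      _ ≤ δ / 2 + δ / 2 := add_le_add_right hn _
      _ = δ := ENNReal.add_halves δ

end L1Value

end ConvexBody

/-! ### Symmetric convex sets and approximate Auerbach bases. -/

namespace ConvexBody

open scoped NNReal

section Body

variable {E : Type*} [NormedAddCommGroup E] [NormedSpace ℝ E] {B : Set E}

/-- Symmetric convex sets containing the origin. -/
structure IsBody (B : Set E) : Prop where
  convex : Convex ℝ B
  zero_mem : (0 : E) ∈ B
  neg_mem : ∀ v ∈ B, -v ∈ B

namespace IsBody

theorem zero_mem_smul (hB : IsBody B) (a : ℝ) : (0 : E) ∈ a • B :=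
  ⟨0, hB.zero_mem, smul_zero a⟩

theorem add_mem (hB : IsBody B) {a b : ℝ} (ha : 0 ≤ a) (hb : 0 ≤ b) {v w : E} (hv : v ∈ a • B)
    (hw : w ∈ b • B) : v + w ∈ (a + b) • B := by
  rw [hB.convex.add_smul ha hb]
  exact Set.add_mem_add hv hw

theorem mono (hB : IsBody B) {a b : ℝ} (ha : 0 ≤ a) (hab : a ≤ b) {v : E} (hv : v ∈ a • B) :
    v ∈ b • B := by
  have := hB.add_mem ha (sub_nonneg.2 hab) hv (hB.zero_mem_smul (b - a))
  rwa [add_zero, add_sub_cancel] at this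

theorem sum_mem (hB : IsBody B) {ι : Type*} (s : Finset ι) {a : ι → ℝ} (ha : ∀ i ∈ s, 0 ≤ a i)
    {v : ι → E} (hv : ∀ i ∈ s, v i ∈ a i • B) : ∑ i ∈ s, v i ∈ (∑ i ∈ s, a i) • B := by
  classical
  induction s using Finset.induction_on with
  | empty => simpa using hB.zero_mem_smul 0
  | insert i s hi ih =>
    rw [Finset.sum_insert hi, Finset.sum_insert hi]
    have h1 := fun j hj => ha j (Finset.mem_insert_of_mem hj)
    exact hB.add_mem (ha i (Finset.mem_insert_self i s)) (Finset.sum_nonneg h1)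
      (hv i (Finset.mem_insert_self i s))
      (ih h1 fun j hj => hv j (Finset.mem_insert_of_mem hj))

theorem smul_mem (hB : IsBody B) {v : E} (hv : v ∈ B) (c : ℝ) : c • v ∈ |c| • B := by
  rcases abs_choice c with h | h <;> rw [h]
  · exact ⟨v, hv, rfl⟩
  · exact ⟨-v, hB.neg_mem v hv, by simp⟩

theorem smul_mem_span (c : ℝ) {v : E} (hv : v ∈ c • B) : v ∈ Submodule.span ℝ B := by
  obtain ⟨w, hw, rfl⟩ := hv
  exact Submodule.smul_mem _ _ (Submodule.subset_span hw)

end IsBody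

/-- Coordinates adapted to the set `B`: an approximate Auerbach basis of its span consisting of
elements of `B`. -/
structure AuerbachCoords (B : Set E) (n : ℕ) where
  vec : Fin n → E
  coord : Fin n → E →L[ℝ] ℝ
  vec_mem : ∀ i, vec i ∈ B
  abs_coord_le : ∀ i, ∀ w ∈ B, |coord i w| ≤ 2
  sum_eq : ∀ w ∈ Submodule.span ℝ B, ∑ i, coord i w • vec i = w

/-- Choose vectors of `B` whose determinant is more than half the supremum. By Cramer's rule the
coordinate of `w` is a quotient of determinants of vectors of `B`, hence at most 2 in absolute
value. Settling for half the supremum means that `B` need not be closed. -/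
theorem exists_auerbachCoords [FiniteDimensional ℝ E] (hB : Bornology.IsBounded B) :
    ∃ n ≤ Module.finrank ℝ E, Nonempty (AuerbachCoords B n) := by
  obtain ⟨n, hn, f, hfB, hfspan, hfli⟩ : ∃ n ≤ Module.finrank ℝ E, ∃ f : Fin n → E,
      (∀ i, f i ∈ B) ∧ Submodule.span ℝ (Set.range f) = Submodule.span ℝ B ∧
      LinearIndependent ℝ f :=
    ⟨_, Submodule.finrank_le _, Submodule.exists_fun_fin_finrank_span_eq ℝ B⟩
  refine ⟨n, hn, ?_⟩
  set V := Submodule.span ℝ (Set.range f) with hV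
  set b : Module.Basis (Fin n) ℝ V := Module.Basis.span hfli with hb
  have hbf : ∀ i, (b i : E) = f i := fun i => by
    rw [hb, Module.Basis.span_apply]
  set S : Set ℝ := {m | ∃ v : Fin n → V, (∀ i, (v i : E) ∈ B) ∧ m = |b.det v|} with hS
  obtain ⟨R, hR⟩ := hB.exists_norm_le
  have hbound : ∃ M, ∀ i, ∀ w : V, (w : E) ∈ B → |b.repr w i| ≤ M := by
    refine ⟨∑ i, ‖LinearMap.toContinuousLinearMap (b.coord i)‖ * R, fun i w hw => ?_⟩
    have h1 := (LinearMap.toContinuousLinearMap (b.coord i)).le_opNorm w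
    have hR0 : 0 ≤ R := (norm_nonneg _).trans (hR _ hw)
    have h2 : ‖w‖ ≤ R := hR _ hw
    calc |b.repr w i| ≤ ‖LinearMap.toContinuousLinearMap (b.coord i)‖ * ‖w‖ := h1
      _ ≤ ‖LinearMap.toContinuousLinearMap (b.coord i)‖ * R := by gcongr
      _ ≤ _ := Finset.single_le_sum
        (f := fun i => ‖LinearMap.toContinuousLinearMap (b.coord i)‖ * R)
        (fun j _ => by positivity) (Finset.mem_univ i)
  obtain ⟨M, hM⟩ := hbound
  have hbdd : BddAbove S := by
    refine ⟨(Fintype.card (Fin n)).factorial • M ^ Fintype.card (Fin n), ?_⟩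
    rintro _ ⟨v, hv, rfl⟩
    rw [Module.Basis.det_apply]
    exact Matrix.det_le (abv := AbsoluteValue.abs) fun i j => hM i (v j) (hv j)
  have h1S : (1 : ℝ) ∈ S := ⟨b, fun i => by rw [hbf]; exact hfB i, by rw [b.det_self, abs_one]⟩
  have hsup : 1 ≤ sSup S := le_csSup hbdd h1S
  obtain ⟨_, ⟨v, hv, rfl⟩, hlt⟩ := exists_lt_of_lt_csSup ⟨1, h1S⟩
    (show sSup S / 2 < sSup S by linarith)
  have hdet : b.det v ≠ 0 := fun h0 => by
    rw [h0, abs_zero] at hlt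
    linarith
  obtain ⟨hli, hsp⟩ := (b.is_basis_iff_det).2 (isUnit_iff_ne_zero.2 hdet)
  set b' := Module.Basis.mk hli hsp.ge with hb'
  -- The coordinates live on the span only and are extended to the whole space, so that they can be
  -- applied to `f` pointwise.
  have hext : ∀ i, ∃ l : E →ₗ[ℝ] ℝ, l ∘ₗ V.subtype = b'.coord i := fun i =>
    LinearMap.exists_extend _
  choose l hl using hext
  have hl' : ∀ i (w : V), l i w = b'.coord i w := fun i w => LinearMap.congr_fun (hl i) w
  refine ⟨⟨fun i => v i, fun i => LinearMap.toContinuousLinearMap (l i), hv, fun i w hw => ?_,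
    fun w hw => ?_⟩⟩
  · have hwV : w ∈ V := by rw [hfspan]; exact Submodule.subset_span hw
    change |l i w| ≤ 2
    rw [show w = ((⟨w, hwV⟩ : V) : E) from rfl, hl']
    -- Cramer's rule: `det v` times the coordinate is the determinant with the `i`-th vector
    -- replaced by `w`.
    have h1 := congrArg (fun φ : V →ₗ[ℝ] ℝ => φ ⟨w, hwV⟩)
      (b.det_smul_mk_coord_eq_det_update hli hsp.ge i)
    simp only [LinearMap.smul_apply, smul_eq_mul, MultilinearMap.toLinearMap_apply] at h1
    have h2 : |b.det v| * |b'.coord i ⟨w, hwV⟩| ≤ sSup S := by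
      rw [← abs_mul, hb', h1]
      refine le_csSup hbdd ⟨Function.update v i ⟨w, hwV⟩, fun j => ?_, rfl⟩
      by_cases hj : j = i
      · subst hj; simpa using hw
      · simpa [hj] using hv j
    by_contra! h3
    have h4 : sSup S / 2 * 2 < |b.det v| * |b'.coord i ⟨w, hwV⟩| := by gcongr
    linarith
  · have hwV : w ∈ V := by rwa [hfspan]
    have h1 : ∑ i, b'.repr ⟨w, hwV⟩ i • (b' i : E) = w := by
      have h2 := congrArg V.subtype (b'.sum_repr ⟨w, hwV⟩)
      simpa only [map_sum, map_smul, Submodule.subtype_apply] using h2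
    refine Eq.trans (Finset.sum_congr rfl fun i _ => ?_) h1
    rw [hb', Module.Basis.mk_apply]
    exact congrArg (· • (v i : E)) (hl' i ⟨w, hwV⟩)

/-- Scalar bounds are turned back into convex body membership: the basis vectors lie in the
symmetric convex set `B`, so each term lies in `M • B`. -/
theorem AuerbachCoords.mem_smul {n : ℕ} (a : AuerbachCoords B n) (hB : IsBody B) {w : E}
    (hw : w ∈ Submodule.span ℝ B) {M : ℝ} (hM : 0 ≤ M) (h : ∀ i, |a.coord i w| ≤ M) :
    w ∈ (n * M) • B := by
  have h1 := hB.sum_mem Finset.univ (a := fun _ : Fin n => M) (v := fun i => a.coord i w • a.vec i)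
    (fun _ _ => hM)
    fun i _ => hB.mono (abs_nonneg _) (h i) (hB.smul_mem (a.vec_mem i) (a.coord i w))
  rw [a.sum_eq w hw] at h1
  simpa using h1

/-- The bounds on the coordinates pass to the closure. This makes limits harmless without any
compactness of the averages `⟪f⟫_Q`. -/
theorem IsBody.closure_subset [FiniteDimensional ℝ E] (hB : IsBody B)
    (hb : Bornology.IsBounded B) {w : E} (hw : w ∈ closure B) :
    w ∈ (2 * Module.finrank ℝ E : ℝ) • B := by
  obtain ⟨n, hn, ⟨a⟩⟩ := exists_auerbachCoords hb
  have h1 : w ∈ Submodule.span ℝ B :=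
    (closure_minimal Submodule.subset_span (Submodule.closed_of_finiteDimensional _)) hw
  have h2 : ∀ i, |a.coord i w| ≤ 2 := fun i =>
    (closure_minimal (a.abs_coord_le i) (isClosed_le (a.coord i).continuous.abs continuous_const)) hw
  have h3 := a.mem_smul hB h1 zero_le_two h2
  refine hB.mono (by positivity) ?_ h3
  have : (n : ℝ) ≤ Module.finrank ℝ E := by exact_mod_cast hn
  linarith

end Body

end ConvexBody

/-! ### Convex body averages and vector valued pieces. -/

namespace ConvexBody

open scoped NNReal

variable {N d : ℕ} {D : DyadicLattice N} {A : Cube N → ℝ≥0} {r : ℕ} {c : ℤ}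
  {K : Cube N → (Fin N → ℝ) → (Fin N → ℝ) → ℝ} {f : (Fin N → ℝ) → EuclideanSpace ℝ (Fin d)}
  {Q P : Cube N}

theorem integrableOn_bdd_smul {U : Set (Fin N → ℝ)} (hf : IntegrableOn f U)
    {φ : (Fin N → ℝ) → ℝ} (hφ : AEStronglyMeasurable φ (volume.restrict U))
    {M : ℝ} (hM : ∀ᵐ x ∂volume.restrict U, |φ x| ≤ M) : IntegrableOn (fun x => φ x • f x) U :=
  Integrable.bdd_smul hf M hφ hM

theorem isBody_bodyAverage (hf : IntegrableOn f (D.toSet Q)) :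
    IsBody (bodyAverage f (D.toSet Q)) where
  convex := by
    rintro _ ⟨φ, hφm, hφ, rfl⟩ _ ⟨ψ, hψm, hψ, rfl⟩ a b ha hb hab
    refine ⟨fun x => a * φ x + b * ψ x, (hφm.const_mul a).add (hψm.const_mul b), ?_, ?_⟩
    · filter_upwards [hφ, hψ] with x h1 h2
      calc |a * φ x + b * ψ x| ≤ a * |φ x| + b * |ψ x| := by
            refine (abs_add_le _ _).trans ?_
            rw [abs_mul, abs_mul, abs_of_nonneg ha, abs_of_nonneg hb]
        _ ≤ a * 1 + b * 1 := by gcongr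
        _ = 1 := by linarith
    · have i1 := integrableOn_bdd_smul hf hφm hφ
      have i2 := integrableOn_bdd_smul hf hψm hψ
      simp only [setAverage_eq, add_smul, mul_smul]
      rw [integral_add (by exact i1.smul a) (by exact i2.smul b), integral_smul, integral_smul,
        smul_add, smul_comm a, smul_comm b]
  zero_mem := ⟨fun _ => 0, aestronglyMeasurable_const, by simp, by simp⟩
  neg_mem := by
    rintro _ ⟨φ, hφm, hφ, rfl⟩
    refine ⟨fun x => -φ x, hφm.neg, by simpa using hφ, ?_⟩
    simp only [setAverage_eq, neg_smul, integral_neg, smul_neg]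

theorem norm_le_of_mem_bodyAverage (hf : Integrable f) {v : EuclideanSpace ℝ (Fin d)}
    (hv : v ∈ bodyAverage f (D.toSet Q)) :
    ‖v‖ ≤ (volume.real (D.toSet Q))⁻¹ * ∫ x, ‖f x‖ := by
  obtain ⟨φ, hφm, hφ, rfl⟩ := hv
  rw [setAverage_eq, norm_smul, Real.norm_of_nonneg (by positivity)]
  refine mul_le_mul_of_nonneg_left ?_ (by positivity)
  refine (norm_integral_le_integral_norm _).trans (le_trans (b := ∫ x in D.toSet Q, ‖f x‖) ?_
    (setIntegral_le_integral hf.norm (.of_forall fun _ => norm_nonneg _)))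
  refine integral_mono_ae (integrableOn_bdd_smul hf.integrableOn hφm hφ).norm
    hf.norm.integrableOn ?_
  filter_upwards [hφ] with x hx
  rw [norm_smul]
  exact mul_le_of_le_one_left (norm_nonneg _) hx

theorem isBounded_bodyAverage (hf : Integrable f) :
    Bornology.IsBounded (bodyAverage f (D.toSet Q)) :=
  isBounded_iff_forall_norm_le.2 ⟨_, fun _ hv => norm_le_of_mem_bodyAverage hf hv⟩

/-- The admissible multiplier is `ψ` rescaled by `|Q| / a`. -/
theorem setIntegral_smul_mem (D : DyadicLattice N) (Q : Cube N) {ψ : (Fin N → ℝ) → ℝ}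
    (hψ : Measurable ψ) {a : ℝ} (ha : 0 ≤ a)
    (h : ∀ x, |ψ x| ≤ a * (volume.real (D.toSet Q))⁻¹) :
    ∫ x in D.toSet Q, ψ x • f x ∈ a • bodyAverage f (D.toSet Q) := by
  have hV := D.volume_real_toSet_pos Q
  rcases ha.eq_or_lt with rfl | ha
  · have : ∀ x, ψ x = 0 := fun x => by simpa using h x
    refine ⟨0, ⟨fun _ => 0, aestronglyMeasurable_const, by simp, by simp⟩, by simp [this]⟩
  refine ⟨_, ⟨fun x => a⁻¹ * volume.real (D.toSet Q) * ψ x,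
    (hψ.const_mul _).aestronglyMeasurable, .of_forall fun x => ?_, rfl⟩, ?_⟩
  · rw [abs_mul, abs_of_pos (by positivity)]
    calc _ ≤ a⁻¹ * volume.real (D.toSet Q) * (a * (volume.real (D.toSet Q))⁻¹) := by
          gcongr; exact h x
      _ = 1 := by field_simp
  · simp only [setAverage_eq, mul_smul, integral_smul]
    rw [smul_smul, smul_smul, smul_smul]
    have : a * (volume.real (D.toSet Q))⁻¹ * a⁻¹ * volume.real (D.toSet Q) = 1 := by field_simp
    rw [this, one_smul]

/-- The vector valued version of `kernelPiece`. -/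
noncomputable def vecPiece (K : Cube N → (Fin N → ℝ) → (Fin N → ℝ) → ℝ)
    (f : (Fin N → ℝ) → EuclideanSpace ℝ (Fin d)) (Q : Cube N) (x : Fin N → ℝ) :
    EuclideanSpace ℝ (Fin d) :=
  ∫ y, K Q x y • f y

theorem IsShift.vecPiece_mem_smul (hK : IsShift D A r c K) {a : ℝ}
    (ha : A Q * (volume.real (D.toSet Q))⁻¹ ≤ a * (volume.real (D.toSet P))⁻¹)
    (hQP : D.toSet Q ⊆ D.toSet P) (x : Fin N → ℝ) :
    vecPiece K f Q x ∈ a • bodyAverage f (D.toSet P) := by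
  have hV := D.volume_real_toSet_pos P
  have hV' := D.volume_real_toSet_pos Q
  have ha0 : 0 ≤ a := by
    have h1 : 0 ≤ a * (volume.real (D.toSet P))⁻¹ := le_trans (by positivity) ha
    exact nonneg_of_mul_nonneg_left h1 (by positivity)
  rw [vecPiece, ← setIntegral_eq_of_support (D := D) (Q := P) fun y hy => by
    rw [hK.eq_zero_right x fun hy' => hy (hQP hy'), zero_smul]]
  exact setIntegral_smul_mem D P (hK.measurable_right Q x) ha0 fun y =>
    (hK.bound Q x y).trans ha

theorem IsShift.map_vecPiece (hK : IsShift D A r c K) (hf : Integrable f)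
    (l : EuclideanSpace ℝ (Fin d) →L[ℝ] ℝ) (Q : Cube N) (x : Fin N → ℝ) :
    l (vecPiece K f Q x) = kernelPiece K Q (fun y => l (f y)) x := by
  rw [vecPiece, kernelPiece, ← l.integral_comp_comm (hK.integrable_smul Q x hf.integrableOn)]
  simp only [map_smul, smul_eq_mul]

theorem IsShift.vecPiece_eq_zero (hK : IsShift D A r c K) {x : Fin N → ℝ}
    (hx : x ∉ D.toSet Q) : vecPiece K f Q x = 0 := by
  simp [vecPiece, hK.eq_zero_left hx]

theorem IsShift.vecPiece_eq_zero' (hK : IsShift D A r c K)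
    (hf : ∀ y ∈ D.toSet Q, f y = 0) (x : Fin N → ℝ) : vecPiece K f Q x = 0 := by
  rw [vecPiece]
  refine integral_eq_zero_of_ae (.of_forall fun y => ?_)
  by_cases hy : y ∈ D.toSet Q
  · simp [hf y hy]
  · simp [hK.eq_zero_right x hy]

theorem vecPiece_eq_zero_of_kernel (hQ : K Q = 0) (x : Fin N → ℝ) : vecPiece K f Q x = 0 := by
  simp [vecPiece, hQ]

/-- Take `φ` to be the sign of `l ∘ f`: applying `l` to the corresponding element of the body gives
the average of `|l ∘ f|`. Where `l ∘ f` vanishes the quotient is 0. -/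
theorem setLIntegral_le_of_bodyAverage (hf : Integrable f)
    (l : EuclideanSpace ℝ (Fin d) →L[ℝ] ℝ) {M : ℝ}
    (h : ∀ v ∈ bodyAverage f (D.toSet Q), |l v| ≤ M) :
    ∫⁻ y in D.toSet Q, ‖l (f y)‖ₑ ≤ ENNReal.ofReal M * volume (D.toSet Q) := by
  have hlf : Integrable fun y => l (f y) := l.integrable_comp hf
  set φ : (Fin N → ℝ) → ℝ := fun y => l (f y) / |l (f y)| with hφ
  have hφm : AEStronglyMeasurable φ (volume.restrict (D.toSet Q)) :=
    (hlf.1.aemeasurable.div hlf.1.norm.aemeasurable).aestronglyMeasurable.restrict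
  have hφ1 : ∀ y, |φ y| ≤ 1 := fun y => by
    rw [hφ]
    simp only [abs_div, abs_abs]
    exact div_self_le_one _
  have hmem : (⨍ y in D.toSet Q, φ y • f y) ∈ bodyAverage f (D.toSet Q) :=
    ⟨φ, hφm, .of_forall hφ1, rfl⟩
  have h1 := h _ hmem
  have hi := integrableOn_bdd_smul hf.integrableOn hφm (.of_forall hφ1)
  rw [setAverage_eq, map_smul, ← l.integral_comp_comm hi] at h1
  have h2 : ∀ y, l (φ y • f y) = |l (f y)| := fun y => by
    rw [map_smul, smul_eq_mul, hφ]
    rcases eq_or_ne (l (f y)) 0 with h0 | h0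
    · simp [h0]
    · simp only
      rw [div_mul_eq_mul_div, div_eq_iff (abs_ne_zero.2 h0), abs_mul_abs_self]
  have hV := D.volume_real_toSet_pos Q
  simp_rw [h2] at h1
  rw [smul_eq_mul, abs_of_nonneg (by positivity), inv_mul_le_iff₀ hV] at h1
  calc ∫⁻ y in D.toSet Q, ‖l (f y)‖ₑ = ENNReal.ofReal (∫ y in D.toSet Q, |l (f y)|) := by
        rw [ofReal_integral_eq_lintegral_ofReal hlf.abs.integrableOn
          (.of_forall fun y => abs_nonneg _)]
        simp only [Real.enorm_eq_ofReal_abs]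
    _ ≤ ENNReal.ofReal (M * volume.real (D.toSet Q)) :=
        ENNReal.ofReal_le_ofReal (by linarith)
    _ = _ := by
        rw [ENNReal.ofReal_mul' hV.le, Measure.real, ENNReal.ofReal_toReal (D.volume_toSet_ne_top Q)]

end ConvexBody

/-! ### The stopping time argument below a fixed cube. -/

namespace ConvexBody

open scoped NNReal

variable {N d : ℕ} {D : DyadicLattice N} {A : ℝ≥0} {r : ℕ} {c : ℤ}
  {K : Cube N → (Fin N → ℝ) → (Fin N → ℝ) → ℝ} {f : (Fin N → ℝ) → EuclideanSpace ℝ (Fin d)}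
  {P : Cube N} {W : ℝ≥0} {h : (Fin N → ℝ) → ℝ}

/-- The sum of `T_Q h (x)` over the cubes `Q ∋ x` of scale in `(q, p]`. -/
noncomputable def chainSum (D : DyadicLattice N) (K : Cube N → (Fin N → ℝ) → (Fin N → ℝ) → ℝ)
    (h : (Fin N → ℝ) → ℝ) (q p : ℤ) (x : Fin N → ℝ) : ℝ :=
  ∑ k ∈ Finset.Ioc q p, kernelPiece K (D.cubeAt k x) h x

/-- The vector valued version of `chainSum`. -/
noncomputable def vecChainSum (D : DyadicLattice N)
    (K : Cube N → (Fin N → ℝ) → (Fin N → ℝ) → ℝ)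
    (f : (Fin N → ℝ) → EuclideanSpace ℝ (Fin d)) (q p : ℤ) (x : Fin N → ℝ) :
    EuclideanSpace ℝ (Fin d) :=
  ∑ k ∈ Finset.Ioc q p, vecPiece K f (D.cubeAt k x) x

theorem IsShift.map_vecChainSum (hK : IsShift D (fun _ => A) r c K) (hf : Integrable f)
    (l : EuclideanSpace ℝ (Fin d) →L[ℝ] ℝ) (q p : ℤ) (x : Fin N → ℝ) :
    l (vecChainSum D K f q p x) = chainSum D K (fun y => l (f y)) q p x := by
  simp only [vecChainSum, chainSum, map_sum, hK.map_vecPiece hf]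

theorem tsum_volume_le_of_finset {F : Set (Cube N)} {M : ℝ≥0∞}
    (hM : ∀ s : Finset (Cube N), (∀ R ∈ s, R ∈ F) → ∑ R ∈ s, volume (D.toSet R) ≤ M) :
    ∑' R : F, volume (D.toSet (R : Cube N)) ≤ M := by
  rw [ENNReal.tsum_eq_iSup_sum]
  refine iSup_le fun s => ?_
  have := hM (s.map (Function.Embedding.subtype _)) (by simp +contextual)
  simpa using this

/-- Families of disjoint cubes on which all truncations of the shift are large: by linearization,
their total measure is controlled by the weak type bound for a single partial sum. -/
theorem IsShift.tsum_volume_chainSum_le (hK : IsShift D (fun _ => A) r c K)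
    (hW : HasWeakType K W) (hh : Integrable h) {t : ℝ} (ht : 0 < t) {F : Set (Cube N)}
    (hFP : ∀ R ∈ F, D.toSet R ⊆ D.toSet P)
    (hF : ∀ R ∈ F, ∀ R' ∈ F, D.toSet R ⊆ D.toSet R' → R = R')
    (hFt : ∀ R ∈ F, ∀ y ∈ D.toSet R, t ≤ |chainSum D K h R.scale P.scale y|) :
    ∑' R : F, volume (D.toSet (R : Cube N)) ≤
      ENNReal.ofReal (2 / t) * W * ∫⁻ y in D.toSet P, ‖h y‖ₑ := by
  classical
  refine tsum_volume_le_of_finset fun G hG => ?_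
  choose pt hpt hpt' using fun R : Cube N => D.exists_cubeAt_eq R
  -- All chains from cubes of `G` up to `P`. A cube of `s` containing a point of `R` is strictly
  -- larger than `R`; otherwise some `R' ∈ G` would lie strictly inside `R`. So on each `R` this one
  -- partial sum is the sum truncated at `R`.
  set s : Finset (Cube N) := G.biUnion fun R =>
    (Finset.Ioc R.scale P.scale).image fun k => D.cubeAt k (pt R) with hs
  have hsum : ∀ R ∈ G, ∀ y ∈ D.toSet R,
      partialSum K s ((D.toSet P).indicator h) y = chainSum D K h R.scale P.scale y := by
    intro R hR y hy
    have hyP : y ∈ D.toSet P := hFP R (hG R hR) hy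
    have hyR : D.cubeAt R.scale y = R := D.mem_toSet_iff.1 hy
    have h1 : ∑ Q ∈ (Finset.Ioc R.scale P.scale).image (fun k => D.cubeAt k y),
        kernelPiece K Q ((D.toSet P).indicator h) y = chainSum D K h R.scale P.scale y := by
      rw [Finset.sum_image fun k _ l _ hkl => congrArg Cube.scale hkl]
      refine Finset.sum_congr rfl fun k hk => ?_
      rw [hK.kernelPiece_eq, hK.kernelPiece_eq]
      refine setIntegral_congr_fun (D.measurableSet_toSet _) fun z hz => ?_
      have : z ∈ D.toSet P := D.toSet_subset_of_mem (Finset.mem_Ioc.1 hk).2 (D.mem_cubeAt k y) hyP hz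
      simp only [Set.indicator_of_mem this]
    rw [← h1, partialSum]
    symm
    refine Finset.sum_subset (fun Q hQ => ?_) fun Q hQ hQ' => ?_
    · obtain ⟨k, hk, rfl⟩ := Finset.mem_image.1 hQ
      refine Finset.mem_biUnion.2 ⟨R, hR, Finset.mem_image.2 ⟨k, hk, ?_⟩⟩
      exact D.cubeAt_mono (Finset.mem_Ioc.1 hk).1.le ((hpt' R).trans hyR.symm)
    · refine hK.kernelPiece_eq_zero _ fun hyQ => hQ' ?_
      obtain ⟨R', hR', hQR'⟩ := Finset.mem_biUnion.1 hQ
      obtain ⟨k, hk, rfl⟩ := Finset.mem_image.1 hQR'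
      rw [Finset.mem_Ioc] at hk
      have hyQ' := D.mem_cubeAt_iff.1 hyQ
      refine Finset.mem_image.2 ⟨k, Finset.mem_Ioc.2 ⟨?_, hk.2⟩, hyQ'⟩
      by_contra! hkR
      have e1 : D.toSet R' ⊆ D.toSet (D.cubeAt k (pt R')) :=
        D.toSet_subset_of_mem hk.1.le (hpt R') (D.mem_cubeAt k _)
      have e2 : D.toSet (D.cubeAt k (pt R')) ⊆ D.toSet R := D.toSet_subset_of_mem hkR hyQ hy
      have := hF R' (hG R' hR') R (hG R hR) (e1.trans e2)
      subst this
      omega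
  have hdisj : Set.PairwiseDisjoint (G : Set (Cube N)) D.toSet := by
    intro R hR R' hR' hne
    rcases le_total R.scale R'.scale with hle | hle
    · exact (D.subset_or_disjoint hle).resolve_left fun hsub =>
        hne (hF R (hG R hR) R' (hG R' hR') hsub)
    · exact ((D.subset_or_disjoint hle).resolve_left fun hsub =>
        hne (hF R' (hG R' hR') R (hG R hR) hsub).symm).symm
  rw [← measure_biUnion_finset hdisj fun R _ => D.measurableSet_toSet R]
  have hind : ∫⁻ y, ‖(D.toSet P).indicator h y‖ₑ = ∫⁻ y in D.toSet P, ‖h y‖ₑ := by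
    rw [← lintegral_indicator (D.measurableSet_toSet P)]
    simp only [enorm_indicator_eq_indicator_enorm]
  rw [← hind]
  refine (measure_mono fun y hy => ?_).trans
    (hW s _ (hh.indicator (D.measurableSet_toSet P)) t ht)
  obtain ⟨R, hR, hyR⟩ := Set.mem_iUnion₂.1 hy
  rw [Set.mem_ofPred_eq, hsum R hR y hyR]
  exact hFt R (hG R hR) y hyR

theorem tsum_volume_isHigh_le (hF0 : Set (Cube N)) {l : ℝ≥0} (hl : l ≠ 0)
    (hFP : ∀ R ∈ hF0, D.toSet R ⊆ D.toSet P)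
    (hF : ∀ R ∈ hF0, ∀ R' ∈ hF0, D.toSet R ⊆ D.toSet R' → R = R')
    (hFt : ∀ R ∈ hF0, D.IsHigh h l R) :
    ∑' R : hF0, volume (D.toSet (R : Cube N)) ≤
      (l : ℝ≥0∞)⁻¹ * ∫⁻ y in D.toSet P, ‖h y‖ₑ := by
  refine (ENNReal.mul_le_iff_le_inv (by simpa using hl) ENNReal.coe_ne_top).1 ?_
  rw [← ENNReal.tsum_mul_left]
  have hdisj : Pairwise (Function.onFun Disjoint fun R : hF0 => D.toSet (R : Cube N)) := by
    intro R R' hne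
    have hne' : (R : Cube N) ≠ R' := fun h => hne (Subtype.ext h)
    rcases le_total (R : Cube N).scale (R' : Cube N).scale with hle | hle
    · exact (D.subset_or_disjoint hle).resolve_left fun hsub => hne' (hF R R.2 R' R'.2 hsub)
    · exact ((D.subset_or_disjoint hle).resolve_left fun hsub =>
        hne' (hF R' R'.2 R R.2 hsub).symm).symm
  calc _ ≤ ∑' R : hF0, ∫⁻ y in D.toSet (R : Cube N), ‖h y‖ₑ :=
        ENNReal.tsum_le_tsum fun R => (hFt R R.2).le
    _ = ∫⁻ y in ⋃ R : hF0, D.toSet (R : Cube N), ‖h y‖ₑ :=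
        (lintegral_iUnion (fun R => D.measurableSet_toSet _) hdisj _).symm
    _ ≤ _ := lintegral_mono_set (Set.iUnion_subset fun R => hFP R R.2)

/-- The threshold of the stopping time construction. -/
noncomputable def stopLevel (d : ℕ) (W : ℝ≥0) (ε : ℝ) : ℝ := 2 * d * (1 + 2 * W) / ε + 3

theorem stopLevel_ge {ε : ℝ} (hε : 0 < ε) : 3 ≤ stopLevel d W ε := by
  have : 0 ≤ 2 * d * (1 + 2 * (W : ℝ)) / ε := by positivity
  unfold stopLevel
  linarith

/-- Each coordinate costs `2 / t` for high averages and `4 W / t` for large truncated sums, the last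
2 in each summand being the average bound on `P`; at most `d` coordinates occur. -/
theorem stopLevel_bound {ε : ℝ} (hε : 0 < ε) {n : ℕ} (hn : n ≤ d) :
    ∑ _i : Fin n, (((stopLevel d W ε).toNNReal : ℝ≥0∞)⁻¹ * (ENNReal.ofReal 2) +
      ENNReal.ofReal (2 / stopLevel d W ε) * W * ENNReal.ofReal 2) ≤ ENNReal.ofReal ε := by
  have h3 := stopLevel_ge (d := d) (W := W) hε
  set t := stopLevel d W ε with ht
  have ht0 : 0 < t := by linarith
  have h1 : ((t.toNNReal : ℝ≥0∞)⁻¹) = ENNReal.ofReal t⁻¹ := by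
    rw [ENNReal.ofReal_inv_of_pos ht0]; rfl
  rw [h1, ← ENNReal.ofReal_coe_nnreal, ← ENNReal.ofReal_mul (by positivity),
    ← ENNReal.ofReal_mul (by positivity), ← ENNReal.ofReal_mul (by positivity),
    ← ENNReal.ofReal_add (by positivity) (by positivity), Finset.sum_const, Finset.card_univ,
    Fintype.card_fin, ← ENNReal.ofReal_nsmul]
  refine ENNReal.ofReal_le_ofReal ?_
  rw [nsmul_eq_mul]
  have h2 : 2 * d * (1 + 2 * (W : ℝ)) ≤ ε * t := by
    rw [ht, stopLevel, mul_add ε, mul_div_cancel₀ _ hε.ne']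
    linarith [mul_pos hε (show (0 : ℝ) < 3 by norm_num)]
  have h4 : (n : ℝ) ≤ d := by exact_mod_cast hn
  calc (n : ℝ) * (t⁻¹ * 2 + 2 / t * W * 2) = (2 * n * (1 + 2 * W)) / t := by field_simp
    _ ≤ (2 * d * (1 + 2 * W)) / t := by gcongr
    _ ≤ ε := by rw [div_le_iff₀ ht0]; exact h2

section Stopping

variable {n : ℕ}

/-- The cubes `R ⊆ P` at which the stopping time argument stops unless it has stopped before. -/
def IsBad (D : DyadicLattice N) (r : ℕ) (c : ℤ) (K : Cube N → (Fin N → ℝ) → (Fin N → ℝ) → ℝ)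
    (f : (Fin N → ℝ) → EuclideanSpace ℝ (Fin d)) (P : Cube N) (t : ℝ)
    (a : AuerbachCoords (bodyAverage f (D.toSet P)) n) (i : Fin n) (R : Cube N) : Prop :=
  D.toSet R ⊆ D.toSet P ∧ (D.IsHigh (fun y => a.coord i (f y)) t.toNNReal R ∨
    -- At scales of the progression the truncated sum is constant on `R` (`IsShift.chainSum_congr`),
    -- so failure at one point is failure on all of `R`.
    ((∃ j : ℤ, R.scale = c + (r + 1) * j) ∧
      ∀ y ∈ D.toSet R, t < |chainSum D K (fun y => a.coord i (f y)) R.scale P.scale y|))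

/-- The maximal bad cubes. -/
def stopCubes (D : DyadicLattice N) (r : ℕ) (c : ℤ)
    (K : Cube N → (Fin N → ℝ) → (Fin N → ℝ) → ℝ)
    (f : (Fin N → ℝ) → EuclideanSpace ℝ (Fin d)) (P : Cube N) (t : ℝ)
    (a : AuerbachCoords (bodyAverage f (D.toSet P)) n) : Set (Cube N) :=
  {R | (∃ i, IsBad D r c K f P t a i R) ∧
    ∀ R', (∃ i, IsBad D r c K f P t a i R') → D.toSet R ⊆ D.toSet R' → R = R'}

variable {a : AuerbachCoords (bodyAverage f (D.toSet P)) n} {t : ℝ}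

theorem setLIntegral_coord_le (hf : Integrable f) (i : Fin n) :
    ∫⁻ y in D.toSet P, ‖a.coord i (f y)‖ₑ ≤ ENNReal.ofReal 2 * volume (D.toSet P) :=
  setLIntegral_le_of_bodyAverage hf _ (a.abs_coord_le i)

/-- The coordinates have average at most `2 < t` on `P`, and the truncated sum from `P` to itself is
empty. -/
theorem not_isBad_self (hf : Integrable f) (ht : 3 ≤ t) (i : Fin n) :
    ¬ IsBad D r c K f P t a i P := by
  rintro ⟨-, h | ⟨-, h⟩⟩
  · have h1 := h.trans_le (setLIntegral_coord_le hf i)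
    refine absurd h1 (not_lt.2 ?_)
    gcongr
    exact ENNReal.ofReal_le_ofReal (by linarith)
  · obtain ⟨y, hy⟩ := D.toSet_nonempty P
    have := h y hy
    simp only [chainSum, Finset.Ioc_self, Finset.sum_empty, abs_zero] at this
    linarith

theorem ssubset_of_mem_stopCubes (hN : 1 ≤ N) (hf : Integrable f) (ht : 3 ≤ t) {R : Cube N}
    (hR : R ∈ stopCubes D r c K f P t a) : D.toSet R ⊂ D.toSet P := by
  obtain ⟨⟨i, hi⟩, -⟩ := hR
  refine hi.1.ssubset_of_ne fun he => ?_
  rw [D.toSet_injective hN he] at hi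
  exact not_isBad_self hf ht i hi

theorem stopCubes_eq_of_subset {R R' : Cube N} (hR : R ∈ stopCubes D r c K f P t a)
    (hR' : R' ∈ stopCubes D r c K f P t a) (h : D.toSet R ⊆ D.toSet R') : R = R' :=
  hR.2 R' hR'.1 h

theorem IsShift.tsum_volume_stopCubes_le (hK : IsShift D (fun _ => A) r c K)
    (hW : HasWeakType K W) (hf : Integrable f) {ε : ℝ} (hε : 0 < ε) (hn : n ≤ d) :
    ∑' R : stopCubes D r c K f P (stopLevel d W ε) a, volume (D.toSet (R : Cube N)) ≤
      ENNReal.ofReal ε * volume (D.toSet P) := by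
  have h3 := stopLevel_ge (d := d) (W := W) hε
  have hbound := stopLevel_bound (d := d) (W := W) hε hn
  set t := stopLevel d W ε with ht
  have ht0 : 0 < t := by linarith
  set st := stopCubes D r c K f P t a with hst
  set F : Fin n → Set (Cube N) := fun i => {R | R ∈ st ∧
    D.IsHigh (fun y => a.coord i (f y)) t.toNNReal R} with hF
  set G : Fin n → Set (Cube N) := fun i => {R | R ∈ st ∧
    ∀ y ∈ D.toSet R, t < |chainSum D K (fun y => a.coord i (f y)) R.scale P.scale y|} with hG
  have hsub : st ⊆ ⋃ i, (F i ∪ G i) := by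
    intro R hR
    obtain ⟨⟨i, hi⟩, -⟩ := id hR
    refine Set.mem_iUnion.2 ⟨i, ?_⟩
    rcases hi.2 with h | ⟨-, h⟩
    · exact .inl ⟨hR, h⟩
    · exact .inr ⟨hR, h⟩
  have hstP : ∀ R ∈ st, D.toSet R ⊆ D.toSet P := fun R hR => by
    obtain ⟨⟨i, hi⟩, -⟩ := hR
    exact hi.1
  calc _ ≤ ∑' R : (⋃ i, (F i ∪ G i) : Set (Cube N)), volume (D.toSet (R : Cube N)) :=
        ENNReal.tsum_mono_subtype (fun R => volume (D.toSet R)) hsub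
    _ ≤ ∑ i, ∑' R : (F i ∪ G i : Set (Cube N)), volume (D.toSet (R : Cube N)) :=
        ENNReal.tsum_iUnion_le (fun R => volume (D.toSet R)) _
    _ ≤ ∑ _i : Fin n, ((t.toNNReal : ℝ≥0∞)⁻¹ * (ENNReal.ofReal 2) +
      ENNReal.ofReal (2 / t) * W * ENNReal.ofReal 2) * volume (D.toSet P) := by
        refine Finset.sum_le_sum fun i _ => ?_
        have hli : Integrable fun y => a.coord i (f y) := (a.coord i).integrable_comp hf
        have hi := setLIntegral_coord_le (a := a) hf i
        refine (ENNReal.tsum_union_le (fun R => volume (D.toSet R)) _ _).trans ?_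
        rw [add_mul]
        refine add_le_add ?_ ?_
        · refine (tsum_volume_isHigh_le (P := P) (h := fun y => a.coord i (f y)) (F i)
            (l := t.toNNReal) (by simpa using ht0) (fun R hR => hstP R hR.1)
            (fun R hR R' hR' => stopCubes_eq_of_subset hR.1 hR'.1) fun R hR => hR.2).trans ?_
          rw [mul_assoc]
          exact mul_le_mul_right hi _
        · refine (hK.tsum_volume_chainSum_le (P := P) hW hli ht0 (fun R hR => hstP R hR.1)
            (fun R hR R' hR' => stopCubes_eq_of_subset hR.1 hR'.1)
            fun R hR y hy => (hR.2 y hy).le).trans ?_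
          rw [mul_assoc _ (ENNReal.ofReal 2)]
          exact mul_le_mul_right hi _
    _ ≤ _ := by
        rw [← Finset.sum_mul]
        exact mul_le_mul_left hbound _

/-- A cube that contains `x` and is not contained in a stopping cube is not bad. -/
theorem not_isBad_cubeAt (hN : 1 ≤ N) {x : Fin N → ℝ} {q : ℤ}
    (hq : ∀ R ∈ stopCubes D r c K f P t a, x ∈ D.toSet R → R.scale ≤ q) {k : ℤ}
    (hqk : q < k) (i : Fin n) : ¬ IsBad D r c K f P t a i (D.cubeAt k x) := by
  intro hbad
  -- The largest bad cube containing `x` is a maximal bad cube, hence a stopping cube of scale above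
  -- `q`.
  obtain ⟨m, ⟨hkm, hm⟩, hmax⟩ := Int.exists_greatest_of_bdd
    (P := fun m => k ≤ m ∧ ∃ i, IsBad D r c K f P t a i (D.cubeAt m x))
    ⟨P.scale, fun z hz => by
      obtain ⟨-, j, hj⟩ := hz
      exact D.scale_le_of_subset hN hj.1⟩ ⟨k, le_rfl, i, hbad⟩
  have hmem : D.cubeAt m x ∈ stopCubes D r c K f P t a := by
    refine ⟨hm, fun R' hR' hsub => ?_⟩
    have h1 : m ≤ R'.scale := D.scale_le_of_subset hN hsub
    have h2 : D.cubeAt R'.scale x = R' := D.mem_toSet_iff.1 (hsub (D.mem_cubeAt m x))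
    have h3 := hmax R'.scale ⟨hkm.trans h1, by rwa [h2]⟩
    rw [← h2, le_antisymm h3 h1]
  have := hq _ hmem (D.mem_cubeAt m x)
  rw [DyadicLattice.cubeAt_scale] at this
  omega

theorem IsShift.chainSum_congr (hK : IsShift D (fun _ => A) r c K) {k p : ℤ}
    (hk : ∃ j : ℤ, k = c + (r + 1) * j) {x y : Fin N → ℝ} (hxy : D.cubeAt k x = D.cubeAt k y) :
    chainSum D K h k p x = chainSum D K h k p y := by
  refine Finset.sum_congr rfl fun l hl => ?_
  rw [Finset.mem_Ioc] at hl
  have h1 := D.cubeAt_mono hl.1.le hxy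
  rw [← h1]
  by_cases h0 : K (D.cubeAt l x) = 0
  · simp [kernelPiece, h0]
  · have h2 := separated_scale_le hk (hK.separated _ h0) hl.1
    exact hK.kernelPiece_congr _ h (D.cubeAt_mono h2 hxy)

theorem IsShift.abs_kernelPiece_le (hK : IsShift D (fun _ => A) r c K) {Q : Cube N}
    (ht : 0 ≤ t) (hQ : ¬ D.IsHigh h t.toNNReal Q) (x : Fin N → ℝ) :
    |kernelPiece K Q h x| ≤ A * t := by
  have h1 := hK.enorm_kernelPiece_le Q h x
  rw [DyadicLattice.IsHigh, not_lt] at hQ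
  have h2 : ‖kernelPiece K Q h x‖ₑ ≤ ENNReal.ofReal (A * t) := by
    refine h1.trans ?_
    calc _ ≤ (A : ℝ≥0∞) * (volume (D.toSet Q))⁻¹ * (t.toNNReal * volume (D.toSet Q)) :=
          mul_le_mul_right hQ _
      _ = A * t.toNNReal * ((volume (D.toSet Q))⁻¹ * volume (D.toSet Q)) := by ring
      _ = A * t.toNNReal := by
          rw [ENNReal.inv_mul_cancel (D.volume_toSet_ne_zero Q) (D.volume_toSet_ne_top Q), mul_one]
      _ = _ := by
          rw [ENNReal.ofReal_mul (by positivity), ENNReal.ofReal_coe_nnreal]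
          rfl
  rw [Real.enorm_eq_ofReal_abs, ENNReal.ofReal_le_ofReal_iff (by positivity)] at h2
  exact h2

/-- Let `k` be the lowest scale in the range with a nonzero kernel. The cube there is not bad, so
the sum strictly above it is at most `t` in each coordinate, and its own term is at most `A * t`
because its average is not high. The Auerbach coordinates turn this into membership. -/
theorem IsShift.vecChainSum_mem (hK : IsShift D (fun _ => A) r c K) (hN : 1 ≤ N)
    (hf : Integrable f) (ht : 0 ≤ t) {x : Fin N → ℝ} (hx : x ∈ D.toSet P) {q : ℤ}
    (hq : ∀ R ∈ stopCubes D r c K f P t a, x ∈ D.toSet R → R.scale ≤ q) :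
    vecChainSum D K f q P.scale x ∈ (n * ((1 + A) * t)) • bodyAverage f (D.toSet P) := by
  have hB := isBody_bodyAverage (D := D) (Q := P) hf.integrableOn
  have hsubP : ∀ k ≤ P.scale, D.toSet (D.cubeAt k x) ⊆ D.toSet P := fun k hk =>
    D.toSet_subset_of_mem hk (D.mem_cubeAt k x) hx
  by_cases hex : ∃ k ∈ Finset.Ioc q P.scale, K (D.cubeAt k x) ≠ 0
  swap
  · push Not at hex
    have : vecChainSum D K f q P.scale x = 0 :=
      Finset.sum_eq_zero fun k hk => vecPiece_eq_zero_of_kernel (hex k hk) x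
    rw [this]
    exact hB.zero_mem_smul _
  obtain ⟨k, ⟨hk, hk0⟩, hmin⟩ := Int.exists_least_of_bdd
    (P := fun k => k ∈ Finset.Ioc q P.scale ∧ K (D.cubeAt k x) ≠ 0)
    ⟨q, fun z hz => (Finset.mem_Ioc.1 hz.1).1.le⟩ hex
  rw [Finset.mem_Ioc] at hk
  refine a.mem_smul hB ?_ (by positivity) fun i => ?_
  -- Only membership in the span is needed here, so the size of the multiple is irrelevant.
  · refine Submodule.sum_mem _ fun l hl => ?_
    rw [Finset.mem_Ioc] at hl
    have hV := D.volume_real_toSet_pos P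
    refine IsBody.smul_mem_span _ (hK.vecPiece_mem_smul
      (a := A * (volume.real (D.toSet (D.cubeAt l x)))⁻¹ * volume.real (D.toSet P)) ?_
      (hsubP l hl.2) x)
    rw [mul_assoc _ (volume.real (D.toSet P)), mul_inv_cancel₀ hV.ne', mul_one]
  · rw [hK.map_vecChainSum hf]
    have hnb := not_isBad_cubeAt hN hq hk.1 i
    have hsep : ∃ j : ℤ, k = c + (r + 1) * j := hK.separated _ hk0
    simp only [IsBad, DyadicLattice.cubeAt_scale, not_and_or, not_or] at hnb
    have hnb' := hnb.resolve_left (not_not.2 (hsubP k hk.2))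
    have h1 := hK.abs_kernelPiece_le (h := fun y => a.coord i (f y)) ht hnb'.1 x
    have h2 : |chainSum D K (fun y => a.coord i (f y)) k P.scale x| ≤ t := by
      have h3 := hnb'.2.resolve_left (not_not.2 hsep)
      push Not at h3
      obtain ⟨y, hy, hyt⟩ := h3
      rwa [hK.chainSum_congr (k := k) hsep (D.mem_cubeAt_iff.1 hy).symm]
    have h4 : chainSum D K (fun y => a.coord i (f y)) q P.scale x =
        kernelPiece K (D.cubeAt k x) (fun y => a.coord i (f y)) x +
          chainSum D K (fun y => a.coord i (f y)) k P.scale x := by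
      rw [chainSum, chainSum, ← Finset.sum_insert (s := Finset.Ioc k P.scale) (by simp)
        (f := fun l => kernelPiece K (D.cubeAt l x) (fun y => a.coord i (f y)) x)]
      symm
      refine Finset.sum_subset (fun l hl => ?_) fun l hl hl' => ?_
      · rw [Finset.mem_insert, Finset.mem_Ioc] at hl
        rw [Finset.mem_Ioc]
        omega
      · have : K (D.cubeAt l x) = 0 := by
          by_contra h0
          have := hmin l ⟨hl, h0⟩
          rw [Finset.mem_insert, Finset.mem_Ioc] at hl'
          rw [Finset.mem_Ioc] at hl
          omega
        simp [kernelPiece, this]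
    rw [h4]
    calc _ ≤ _ := abs_add_le _ _
      _ ≤ A * t + t := add_le_add h1 h2
      _ = _ := by ring

end Stopping

/-- The stopping cubes below a given cube. -/
theorem IsShift.exists_stopCubes (hK : IsShift D (fun _ => A) r c K) (hN : 1 ≤ N)
    (hW : HasWeakType K W) (hf : Integrable f) {ε : ℝ} (hε : 0 < ε) (P : Cube N) :
    ∃ st : Set (Cube N), (∀ R ∈ st, D.toSet R ⊂ D.toSet P) ∧
      (∀ R ∈ st, ∀ R' ∈ st, D.toSet R ⊆ D.toSet R' → R = R') ∧
      ∑' R : st, volume (D.toSet (R : Cube N)) ≤ ENNReal.ofReal ε * volume (D.toSet P) ∧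
      ∀ x ∈ D.toSet P, ∀ q, (∀ R ∈ st, x ∈ D.toSet R → R.scale ≤ q) →
        vecChainSum D K f q P.scale x ∈
          (d * ((1 + A) * stopLevel d W ε)) • bodyAverage f (D.toSet P) := by
  obtain ⟨n, hn, ⟨a⟩⟩ := exists_auerbachCoords (isBounded_bodyAverage (D := D) (Q := P) hf)
  rw [finrank_euclideanSpace, Fintype.card_fin] at hn
  have h3 := stopLevel_ge (d := d) (W := W) hε
  refine ⟨stopCubes D r c K f P (stopLevel d W ε) a,
    fun R hR => ssubset_of_mem_stopCubes hN hf h3 hR,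
    fun R hR R' hR' => stopCubes_eq_of_subset hR hR',
    hK.tsum_volume_stopCubes_le hW hf hε hn, fun x hx q hq => ?_⟩
  have hB := isBody_bodyAverage (D := D) (Q := P) hf.integrableOn
  have hn' : (n : ℝ) ≤ d := by exact_mod_cast hn
  have h0 : 0 ≤ stopLevel d W ε := by linarith
  exact hB.mono (by positivity) (by gcongr) (hK.vecChainSum_mem hN hf h0 hx hq)

end ConvexBody

/-! ### Sparse families from generations of cubes. -/

namespace ConvexBody

open scoped NNReal

variable {N : ℕ} {D : DyadicLattice N} {ε : ℝ}

section Generations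

variable {gen : ℤ → Set (Cube N)}

theorem exists_ancestor (h1 : ∀ n, ∀ R ∈ gen (n + 1), ∃ Q ∈ gen n, D.toSet R ⊂ D.toSet Q)
    {n m : ℤ} (hnm : n ≤ m) {R : Cube N} (hR : R ∈ gen m) :
    ∃ Q ∈ gen n, D.toSet R ⊆ D.toSet Q := by
  induction n, hnm using Int.leInductionDown with
  | base => exact ⟨R, hR, subset_rfl⟩
  | pred n _ ih =>
    obtain ⟨Q, hQ, hRQ⟩ := ih
    obtain ⟨Q', hQ', hQQ'⟩ := h1 (n - 1) Q (by simpa using hQ)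
    exact ⟨Q', hQ', hRQ.trans hQQ'.subset⟩

/-- A family of cubes organized in generations, in which the cubes of the next generation inside
a given cube have small total measure, is sparse. -/
theorem isSparse_iUnion (h1 : ∀ n, ∀ R ∈ gen (n + 1), ∃ Q ∈ gen n, D.toSet R ⊂ D.toSet Q)
    (h2 : ∀ n, ∀ R ∈ gen n, ∀ R' ∈ gen n, ∀ x ∈ D.toSet R, x ∈ D.toSet R' → R = R')
    (h3 : ∀ n, ∀ Q ∈ gen n, ∑' R : {R | R ∈ gen (n + 1) ∧ D.toSet R ⊂ D.toSet Q},
      volume (D.toSet (R : Cube N)) ≤ ENNReal.ofReal ε * volume (D.toSet Q)) :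
    D.IsSparse ε (⋃ n, gen n) := by
  intro Q hQ
  obtain ⟨n, hn⟩ := Set.mem_iUnion.1 hQ
  refine le_trans (ENNReal.tsum_mono_subtype (fun R : Cube N => volume (D.toSet R))
      fun R hR => ?_) (h3 n Q hn)
  obtain ⟨hRS, hRQ, hmax⟩ := hR
  obtain ⟨m, hm⟩ := Set.mem_iUnion.1 hRS
  obtain ⟨x, hx⟩ := D.toSet_nonempty R
  -- If `m ≤ n`, the ancestor of `Q` in generation `m` would meet `R` and therefore equal it,
  -- although `R` is strictly inside `Q`.
  have hnm : n + 1 ≤ m := by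
    by_contra! hlt
    obtain ⟨Q', hQ', hQQ'⟩ := exists_ancestor h1 (show m ≤ n by omega) hn
    have := h2 m R hm Q' hQ' x hx (hQQ' (hRQ.subset hx))
    exact hRQ.not_subset (this ▸ hQQ')
  -- The ancestor of `R` in generation `n + 1` also lies strictly inside `Q`, so maximality forces
  -- `R` to be this ancestor.
  obtain ⟨R', hR', hRR'⟩ := exists_ancestor h1 hnm hm
  obtain ⟨Q', hQ', hRQ'⟩ := h1 n R' hR'
  have hQQ' := h2 n Q hn Q' hQ' x (hRQ.subset hx) (hRQ'.subset (hRR' hx))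
  subst hQQ'
  have := hmax R' (Set.mem_iUnion.2 ⟨_, hR'⟩) hRQ' hRR'
  subst this
  exact ⟨hR', hRQ⟩

end Generations

section StopGen

/-- The generations of stopping cubes below the cubes of the family `G`. -/
def stopGen (children : Cube N → Set (Cube N)) (G : Set (Cube N)) : ℕ → Set (Cube N)
  | 0 => G
  | n + 1 => ⋃ Q ∈ stopGen children G n, children Q

variable {children : Cube N → Set (Cube N)} {G : Set (Cube N)}

theorem mem_stopGen_succ {n : ℕ} {R : Cube N} :
    R ∈ stopGen children G (n + 1) ↔ ∃ Q ∈ stopGen children G n, R ∈ children Q := by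
  simp [stopGen]

theorem stopGen_disjoint (hs : ∀ P, ∀ R ∈ children P, D.toSet R ⊂ D.toSet P)
    (hd : ∀ P, ∀ R ∈ children P, ∀ R' ∈ children P, D.toSet R ⊆ D.toSet R' → R = R')
    (hG : ∀ R ∈ G, ∀ R' ∈ G, ∀ x ∈ D.toSet R, x ∈ D.toSet R' → R = R') (n : ℕ) :
    ∀ R ∈ stopGen children G n, ∀ R' ∈ stopGen children G n, ∀ x ∈ D.toSet R,
      x ∈ D.toSet R' → R = R' := by
  induction n with
  | zero => exact hG
  | succ n ih =>
    intro R hR R' hR' x hx hx'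
    obtain ⟨Q, hQ, hRQ⟩ := mem_stopGen_succ.1 hR
    obtain ⟨Q', hQ', hRQ'⟩ := mem_stopGen_succ.1 hR'
    have := ih Q hQ Q' hQ' x ((hs Q R hRQ).subset hx) ((hs Q' R' hRQ').subset hx')
    subst this
    rcases le_total R.scale R'.scale with h | h
    · exact hd Q R hRQ R' hRQ' (D.toSet_subset_of_mem h hx hx')
    · exact (hd Q R' hRQ' R hRQ (D.toSet_subset_of_mem h hx' hx)).symm

theorem tsum_stopGen_le
    (ht : ∀ P, ∑' R : children P, volume (D.toSet (R : Cube N)) ≤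
      ENNReal.ofReal ε * volume (D.toSet P)) (n : ℕ) :
    ∑' R : stopGen children G n, volume (D.toSet (R : Cube N)) ≤
      ENNReal.ofReal ε ^ n * ∑' R : G, volume (D.toSet (R : Cube N)) := by
  induction n with
  | zero => simp [stopGen]
  | succ n ih =>
    calc _ ≤ ∑' Q : stopGen children G n, ∑' R : children Q, volume (D.toSet (R : Cube N)) :=
          ENNReal.tsum_biUnion_le_tsum (fun R => volume (D.toSet R)) _ _
      _ ≤ ∑' Q : stopGen children G n, ENNReal.ofReal ε * volume (D.toSet (Q : Cube N)) :=
          ENNReal.tsum_le_tsum fun Q => ht Q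
      _ ≤ _ := by
          rw [ENNReal.tsum_mul_left, pow_succ', mul_assoc]
          exact mul_le_mul_right ih _

/-- Almost every point belongs to the cubes of finitely many generations only. -/
theorem ae_exists_notMem_stopGen (hε : ε < 1) (hG : G.Finite)
    (ht : ∀ P, ∑' R : children P, volume (D.toSet (R : Cube N)) ≤
      ENNReal.ofReal ε * volume (D.toSet P)) :
    ∀ᵐ x : Fin N → ℝ, ∃ n, ∀ R ∈ stopGen children G n, x ∉ D.toSet R := by
  set M := ∑' R : G, volume (D.toSet (R : Cube N)) with hM
  have hMtop : M ≠ ∞ := by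
    have := hG.fintype
    rw [hM, tsum_fintype]
    exact ENNReal.sum_ne_top.2 fun R _ => D.volume_toSet_ne_top _
  rw [ae_iff]
  refine le_antisymm (ge_of_tendsto' (f := fun n : ℕ => ENNReal.ofReal ε ^ n * M) (x := atTop) ?_
    fun n => ?_) bot_le
  · have h := ENNReal.tendsto_pow_atTop_nhds_zero_of_lt_one (r := ENNReal.ofReal ε)
      (by rwa [ENNReal.ofReal_lt_one])
    simpa using ENNReal.Tendsto.mul_const h (Or.inr hMtop)
  · refine le_trans (measure_mono (t := ⋃ R ∈ stopGen children G n, D.toSet R) fun x hx => ?_) ?_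
    · have hx' : ¬ ∃ n, ∀ R ∈ stopGen children G n, x ∉ D.toSet R := hx
      push Not at hx'
      obtain ⟨R, hR, hxR⟩ := hx' n
      exact Set.mem_biUnion hR hxR
    · exact (measure_biUnion_le _ (Set.to_countable _) _).trans (tsum_stopGen_le ht n)

end StopGen

section Support

variable {U : Set (Fin N → ℝ)}

theorem finite_cubeAt_image (D : DyadicLattice N) (k : ℤ) (hU : Bornology.IsBounded U) :
    (D.cubeAt k '' U).Finite := by
  obtain ⟨R, hR⟩ := hU.exists_norm_le
  refine ((Set.finite_Icc (fun i => ⌊(-R - D.origin k i) / (2 : ℝ) ^ k⌋)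
    (fun i => ⌊(R - D.origin k i) / (2 : ℝ) ^ k⌋)).image fun p => (⟨k, p⟩ : Cube N)).subset ?_
  rintro _ ⟨x, hx, rfl⟩
  have h := fun i => abs_le.1 ((norm_le_pi_norm x i).trans (hR x hx))
  refine ⟨_, ⟨fun i => ?_, fun i => ?_⟩, rfl⟩
  · have := (h i).1
    dsimp only
    gcongr
  · have := (h i).2
    dsimp only
    gcongr

/-- From some scale on, passing to larger cubes does not merge any of the cubes that meet a given
bounded set. -/
theorem exists_stable_scale (D : DyadicLattice N) (hU : Bornology.IsBounded U) :
    ∃ k₀ : ℤ, ∀ k, k₀ ≤ k → ∀ l, k ≤ l → ∀ x ∈ U, ∀ y ∈ U,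
      D.cubeAt l x = D.cubeAt l y → D.cubeAt k x = D.cubeAt k y := by
  -- The number of cubes of a given scale that meet `U` is a natural number, so some scale attains
  -- the minimum.
  obtain ⟨k₀, hk₀⟩ : ∃ k₀ : ℤ, ∀ l, (D.cubeAt k₀ '' U).ncard ≤ (D.cubeAt l '' U).ncard :=
    ⟨Function.argmin fun l => (D.cubeAt l '' U).ncard, fun l =>
      Function.argmin_le (fun l => (D.cubeAt l '' U).ncard) l⟩
  refine ⟨k₀, fun k hk l hl x hx y hy hxy => D.cubeAt_mono hk ?_⟩
  choose pt hpt hpt' using fun Q : Cube N => D.exists_cubeAt_eq Q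
  have hφ : ∀ z, D.cubeAt l (pt (D.cubeAt k₀ z)) = D.cubeAt l z := fun z =>
    D.cubeAt_mono (hk.trans hl) (hpt' (D.cubeAt k₀ z))
  have himg : (fun Q => D.cubeAt l (pt Q)) '' (D.cubeAt k₀ '' U) = D.cubeAt l '' U := by
    rw [Set.image_image]
    simp only [hφ]
  have hfin := finite_cubeAt_image D k₀ hU
  -- Passing to larger cubes is a surjection between finite sets, and by minimality of the count it
  -- is injective.
  have hinj : Set.InjOn (fun Q => D.cubeAt l (pt Q)) (D.cubeAt k₀ '' U) :=
    Set.injOn_of_ncard_image_eq (le_antisymm (Set.ncard_image_le hfin) (himg ▸ hk₀ l)) hfin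
  exact hinj (Set.mem_image_of_mem _ hx) (Set.mem_image_of_mem _ hy) (by simp only [hφ, hxy])

theorem cubeAt_image_disjoint (k : ℤ) : ∀ R ∈ D.cubeAt k '' U, ∀ R' ∈ D.cubeAt k '' U,
    ∀ x ∈ D.toSet R,
      x ∈ D.toSet R' → R = R' := by
  rintro _ ⟨y, -, rfl⟩ _ ⟨z, -, rfl⟩ x hx hx'
  exact D.eq_of_mem rfl hx hx'

end Support

section Family

/-- The generations of the sparse family: for `n ≥ 0` the stopping cubes of generation `n` below
the cubes of side length `2 ^ k₀` that meet `U`, and for `n ≤ 0` the cubes of side length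
`2 ^ (k₀ + m |n|)` that meet `U`. -/
def sparseGen (D : DyadicLattice N) (children : Cube N → Set (Cube N)) (U : Set (Fin N → ℝ))
    (k₀ : ℤ) (m : ℕ) (n : ℤ) : Set (Cube N) :=
  stopGen children (D.cubeAt (k₀ + m * (-n).toNat) '' U) n.toNat

variable {children : Cube N → Set (Cube N)} {U : Set (Fin N → ℝ)} {k₀ : ℤ} {m : ℕ}

theorem sparseGen_natCast (n : ℕ) :
    sparseGen D children U k₀ m n = stopGen children (D.cubeAt k₀ '' U) n := by
  simp [sparseGen]

theorem sparseGen_neg (n : ℕ) :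
    sparseGen D children U k₀ m (-n) = D.cubeAt (k₀ + m * n) '' U := by
  simp [sparseGen, stopGen]

theorem sparseGen_cases (n : ℤ) :
    (∃ j : ℕ, n = j) ∨ ∃ j : ℕ, n = -((j + 1 : ℕ) : ℤ) ∧ n + 1 = -(j : ℤ) := by
  rcases le_or_gt 0 n with h | h
  · exact .inl ⟨n.toNat, by omega⟩
  · exact .inr ⟨(-n - 1).toNat, by omega, by omega⟩

/-- In the lower generations sparseness is the stopping cube bound. In the upper ones the choice of
`k₀` leaves a single cube of the next generation inside each cube, of relative volume `2 ^ (-m * N)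
≤ ε`. -/
theorem isSparse_sparseGen (hN : 1 ≤ N) (hm : 0 < m) (hmε : (2⁻¹ : ℝ) ^ m ≤ ε)
    (hs : ∀ P, ∀ R ∈ children P, D.toSet R ⊂ D.toSet P)
    (hd : ∀ P, ∀ R ∈ children P, ∀ R' ∈ children P, D.toSet R ⊆ D.toSet R' → R = R')
    (ht : ∀ P, ∑' R : children P, volume (D.toSet (R : Cube N)) ≤
      ENNReal.ofReal ε * volume (D.toSet P))
    (hk₀ : ∀ k, k₀ ≤ k → ∀ l, k ≤ l → ∀ x ∈ U, ∀ y ∈ U,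
      D.cubeAt l x = D.cubeAt l y → D.cubeAt k x = D.cubeAt k y) :
    D.IsSparse ε (⋃ n, sparseGen D children U k₀ m n) := by
  have hdisj : ∀ n, ∀ R ∈ sparseGen D children U k₀ m n, ∀ R' ∈ sparseGen D children U k₀ m n,
      ∀ x ∈ D.toSet R, x ∈ D.toSet R' → R = R' := fun n =>
    stopGen_disjoint hs hd (cubeAt_image_disjoint _) _
  refine isSparse_iUnion (fun n R hR => ?_) hdisj fun n Q hQ => ?_
  · rcases sparseGen_cases n with ⟨j, rfl⟩ | ⟨j, hj, hj'⟩
    · rw [← Nat.cast_succ, sparseGen_natCast, mem_stopGen_succ] at hR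
      obtain ⟨Q, hQ, hRQ⟩ := hR
      exact ⟨Q, by rwa [sparseGen_natCast], hs Q R hRQ⟩
    · rw [hj', sparseGen_neg] at hR
      rw [hj, sparseGen_neg]
      obtain ⟨x, hx, rfl⟩ := hR
      refine ⟨_, Set.mem_image_of_mem _ hx, D.ssubset_of_scale_lt hN (D.cubeAt_subset ?_ x) ?_⟩
      · push_cast; nlinarith
      · simp only [DyadicLattice.cubeAt_scale]; push_cast; nlinarith
  · rcases sparseGen_cases n with ⟨j, rfl⟩ | ⟨j, hj, hj'⟩
    · refine le_trans (ENNReal.tsum_mono_subtype (fun R : Cube N => volume (D.toSet R))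
      fun R hR => ?_) (ht Q)
      obtain ⟨hR, hRQ⟩ := hR
      rw [← Nat.cast_succ, sparseGen_natCast, mem_stopGen_succ] at hR
      obtain ⟨Q', hQ', hRQ'⟩ := hR
      obtain ⟨x, hx⟩ := D.toSet_nonempty R
      have := hdisj j Q hQ Q' (by rwa [sparseGen_natCast]) x (hRQ.subset hx)
        ((hs Q' R hRQ').subset hx)
      rwa [this]
    · rw [hj, sparseGen_neg] at hQ
      rw [hj', sparseGen_neg]
      obtain ⟨z, hz, rfl⟩ := hQ
      set k := k₀ + m * (j : ℤ) with hk
      have hkm : k₀ + m * ((j + 1 : ℕ) : ℤ) = k + m := by push_cast; ring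
      have hkk : k₀ ≤ k := by rw [hk]; nlinarith
      rw [hkm]
      have hsub : {R | R ∈ D.cubeAt k '' U ∧ D.toSet R ⊂ D.toSet (D.cubeAt (k + m) z)} ⊆
          {D.cubeAt k z} := by
        rintro _ ⟨⟨x, hx, rfl⟩, hxz⟩
        have := D.mem_cubeAt_iff.1 (hxz.subset (D.mem_cubeAt k x))
        exact hk₀ k hkk (k + m) (by omega) x hx z hz this
      refine (ENNReal.tsum_mono_subtype (fun R : Cube N => volume (D.toSet R)) hsub).trans ?_
      rw [tsum_singleton (D.cubeAt k z) fun R : Cube N => volume (D.toSet R), D.volume_toSet,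
        D.volume_toSet, ← ENNReal.ofReal_mul (le_trans (by positivity) hmε)]
      refine ENNReal.ofReal_le_ofReal ?_
      simp only [DyadicLattice.cubeAt_scale]
      clear_value k
      rw [zpow_add₀ two_ne_zero, mul_pow, zpow_natCast]
      have h2 : (0 : ℝ) < (2 ^ k) ^ N := by positivity
      have h3 : (2 : ℝ) ^ m ≤ (2 ^ m) ^ N := le_self_pow₀ (one_le_pow₀ one_le_two) (by omega)
      have hε : 0 ≤ ε := le_trans (by positivity) hmε
      have h4 : 1 ≤ ε * (2 ^ m) ^ N := by
        calc (1 : ℝ) = 2⁻¹ ^ m * 2 ^ m := by rw [← mul_pow]; norm_num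
          _ ≤ _ := by gcongr
      nlinarith

end Family

end ConvexBody

/-! ### `T f` as an almost everywhere limit of sums over intervals of scales. -/

namespace ConvexBody

open scoped NNReal

/-- The sets `s n` need not exhaust all cubes: those missing the support of `f` are absent but
contribute nothing, which suffices to follow the net of finite sums along a sequence. -/
theorem tendsto_comp_of_union_eq {ι β : Type*} [DecidableEq ι] {l : Filter β} {φ : Finset ι → β}
    (h : Tendsto φ atTop l) {s : ℕ → Finset ι}
    (hs : ∀ s₀, ∀ᶠ n in atTop, φ (s n ∪ s₀) = φ (s n)) :
    Tendsto (fun n => φ (s n)) atTop l := by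
  intro V hV
  obtain ⟨s₀, hs₀⟩ := mem_atTop_sets.1 (h hV)
  show ∀ᶠ n in atTop, φ (s n) ∈ V
  filter_upwards [hs s₀] with n hn
  have : φ (s n ∪ s₀) ∈ V := hs₀ _ Finset.subset_union_right
  rwa [← hn]

theorem tendstoInMeasure_pi {α ι κ : Type*} [MeasurableSpace α] {μ : Measure α} [Fintype κ]
    {l : Filter ι} {F : ι → α → κ → ℝ} {G : α → κ → ℝ}
    (h : ∀ i, TendstoInMeasure μ (fun n x => F n x i) l fun x => G x i) :
    TendstoInMeasure μ F l G := by
  intro δ hδ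
  have h1 : Tendsto (fun n => ∑ i, μ {x | δ ≤ edist (F n x i) (G x i)}) l (𝓝 0) := by
    simpa using tendsto_finsetSum Finset.univ fun i _ => h i δ hδ
  refine tendsto_of_tendsto_of_tendsto_of_le_of_le tendsto_const_nhds h1 (fun _ => zero_le)
    fun n => ?_
  refine (measure_mono fun x hx => ?_).trans (measure_iUnion_fintype_le μ _)
  have hx' : δ ≤ edist (F n x) (G x) := hx
  by_contra hne
  refine hx'.not_gt ?_
  rw [edist_pi_def, Finset.sup_lt_iff hδ]
  intro i _
  by_contra! hi
  exact hne (Set.mem_iUnion.2 ⟨i, hi⟩)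

variable {N d : ℕ} {D : DyadicLattice N} {A : ℝ≥0} {r : ℕ} {c : ℤ}
  {K : Cube N → (Fin N → ℝ) → (Fin N → ℝ) → ℝ} {f : (Fin N → ℝ) → EuclideanSpace ℝ (Fin d)}
  {W : ℝ≥0}

theorem eq_zero_of_notMem_image {Q : Cube N}
    (hQ : Q ∉ D.cubeAt Q.scale '' Function.support f) {y : Fin N → ℝ} (hy : y ∈ D.toSet Q) :
    f y = 0 := by
  by_contra h
  exact hQ ⟨y, h, D.mem_toSet_iff.1 hy⟩

theorem IsShift.vecPiece_eq_zero_of_notMem_image (hK : IsShift D (fun _ => A) r c K) {Q : Cube N}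
    (hQ : Q ∉ D.cubeAt Q.scale '' Function.support f) (x : Fin N → ℝ) : vecPiece K f Q x = 0 :=
  hK.vecPiece_eq_zero' (fun _ hy => eq_zero_of_notMem_image hQ hy) x

theorem IsShift.kernelPiece_eq_zero_of_notMem_image (hK : IsShift D (fun _ => A) r c K)
    (hf : Integrable f) (l : EuclideanSpace ℝ (Fin d) →L[ℝ] ℝ) {Q : Cube N}
    (hQ : Q ∉ D.cubeAt Q.scale '' Function.support f) (x : Fin N → ℝ) :
    kernelPiece K Q (fun y => l (f y)) x = 0 := by
  rw [← hK.map_vecPiece hf, hK.vecPiece_eq_zero_of_notMem_image hQ, map_zero]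

theorem exists_scaleCubes (D : DyadicLattice N) {U : Set (Fin N → ℝ)} (hU : Bornology.IsBounded U)
    (q p : ℤ) : ∃ s : Finset (Cube N), ∀ Q, Q ∈ s ↔
      Q.scale ∈ Finset.Ioc q p ∧ Q ∈ D.cubeAt Q.scale '' U := by
  classical
  refine ⟨(Finset.Ioc q p).biUnion fun k => (finite_cubeAt_image D k hU).toFinset, fun Q => ?_⟩
  simp only [Finset.mem_biUnion, Set.Finite.mem_toFinset]
  constructor
  · rintro ⟨k, hk, y, hy, rfl⟩
    exact ⟨hk, y, hy, rfl⟩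
  · rintro ⟨h1, h2⟩
    exact ⟨_, h1, h2⟩

theorem IsShift.partialSum_scaleCubes (hK : IsShift D (fun _ => A) r c K) (hf : Integrable f)
    (l : EuclideanSpace ℝ (Fin d) →L[ℝ] ℝ) {q p : ℤ} {s : Finset (Cube N)}
    (hs : ∀ Q, Q ∈ s ↔ Q.scale ∈ Finset.Ioc q p ∧ Q ∈ D.cubeAt Q.scale '' Function.support f)
    (x : Fin N → ℝ) :
    partialSum K s (fun y => l (f y)) x = l (vecChainSum D K f q p x) := by
  classical
  have hinj : Function.Injective fun k : ℤ => D.cubeAt k x := fun k j h => congrArg Cube.scale h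
  have h1 : partialSum K s (fun y => l (f y)) x =
      ∑ Q ∈ s ∪ (Finset.Ioc q p).image (fun k => D.cubeAt k x),
        kernelPiece K Q (fun y => l (f y)) x := by
    refine Finset.sum_subset Finset.subset_union_left fun Q hQ hQs => ?_
    refine hK.kernelPiece_eq_zero_of_notMem_image hf l (fun h => hQs ((hs Q).2 ⟨?_, h⟩)) x
    rcases Finset.mem_union.1 hQ with h' | h'
    · exact absurd h' hQs
    · obtain ⟨k, hk, rfl⟩ := Finset.mem_image.1 h'
      exact hk
  rw [h1, hK.map_vecChainSum hf, chainSum, ← Finset.sum_image (s := Finset.Ioc q p)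
    (f := fun Q => kernelPiece K Q (fun y => l (f y)) x) hinj.injOn]
  symm
  refine Finset.sum_subset Finset.subset_union_right fun Q hQ hQi => ?_
  rw [← hK.map_vecPiece hf, hK.vecPiece_eq_zero, map_zero]
  intro hxQ
  rcases Finset.mem_union.1 hQ with h' | h'
  · exact hQi (Finset.mem_image.2 ⟨Q.scale, ((hs Q).1 h').1, D.mem_toSet_iff.1 hxQ⟩)
  · exact hQi h'

/-- The extension to `L¹` is the pointwise limit of sums over all cubes with scales in suitable
intervals. -/
theorem IsShift.exists_isVectorL1Value (hK : IsShift D (fun _ => A) r c K) (hW : HasWeakType K W)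
    (hW0 : W ≠ 0)
    {T : Lp ℝ 2 (volume : Measure (Fin N → ℝ)) →L[ℝ] Lp ℝ 2 (volume : Measure (Fin N → ℝ))}
    (hT : IsL2Sum T (kernelPiece K)) (hf : Integrable f)
    (hfs : Bornology.IsBounded (Function.support f)) (k₀ : ℤ) {m : ℕ} (hm : 0 < m) :
    ∃ g, IsVectorL1Value T f g ∧ ∃ ns : ℕ → ℕ, StrictMono ns ∧
      ∀ᵐ x, Tendsto (fun j => vecChainSum D K f (k₀ - ns j) (k₀ + m * ns j) x) atTop
        (𝓝 (g x)) := by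
  classical
  choose g hg hgs using fun i : Fin d => hK.exists_isL1Value hW hW0 hT
    (f := fun x => f x i) ((EuclideanSpace.proj (𝕜 := ℝ) i).integrable_comp hf)
  choose s hs using fun n : ℕ => exists_scaleCubes D hfs (k₀ - n) (k₀ + m * n)
  have hsum : ∀ i n x, partialSum K (s n) (fun x => f x i) x =
      vecChainSum D K f (k₀ - n) (k₀ + m * n) x i := fun i n x =>
    hK.partialSum_scaleCubes hf (EuclideanSpace.proj (𝕜 := ℝ) i) (hs n) x
  have hunion : ∀ i s₀, ∀ᶠ n in atTop, partialSum K (s n ∪ s₀) (fun x => f x i) =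
      partialSum K (s n) (fun x => f x i) := by
    intro i s₀
    have hev : ∀ᶠ n : ℕ in atTop, ∀ Q ∈ s₀, Q.scale ∈ Finset.Ioc (k₀ - n) (k₀ + m * n) := by
      rw [Finset.eventually_all]
      intro Q _
      filter_upwards [eventually_gt_atTop (Q.scale - k₀).natAbs] with n hn
      have : (n : ℤ) ≤ m * n := by
        have : (1 : ℤ) ≤ m := by exact_mod_cast hm
        nlinarith
      rw [Finset.mem_Ioc]
      omega
    filter_upwards [hev] with n hn
    funext x
    symm
    refine Finset.sum_subset Finset.subset_union_left fun Q hQ hQs => ?_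
    refine hK.kernelPiece_eq_zero_of_notMem_image hf (EuclideanSpace.proj (𝕜 := ℝ) i)
      (fun h => hQs ((hs n Q).2 ⟨?_, h⟩)) x
    exact hn Q ((Finset.mem_union.1 hQ).resolve_left hQs)
  have hconv : TendstoInMeasure volume
      (fun n x i => vecChainSum D K f (k₀ - (n : ℕ)) (k₀ + m * (n : ℕ)) x i) atTop
      fun x i => g i x := by
    refine tendstoInMeasure_pi fun i δ hδ => ?_
    have := tendsto_comp_of_union_eq (hgs i δ hδ) (s := s) fun s₀ => by
      filter_upwards [hunion i s₀] with n hn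
      rw [hn]
    simpa only [hsum] using this
  -- All coordinates are treated at once as a product valued function, so that one subsequence
  -- serves them all.
  obtain ⟨ns, hns, hae⟩ := hconv.exists_seq_tendsto_ae
  refine ⟨fun x => WithLp.toLp 2 fun i => g i x, hg, ns, hns, ?_⟩
  filter_upwards [hae] with x hx
  exact (PiLp.continuous_toLp 2 (fun _ : Fin d => ℝ)).continuousAt.tendsto.comp hx

end ConvexBody

/-! ### Assembling the sparse domination. -/

namespace ConvexBody

open scoped NNReal

variable {N d : ℕ} {D : DyadicLattice N} {A : ℝ≥0} {r : ℕ} {c : ℤ}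
  {K : Cube N → (Fin N → ℝ) → (Fin N → ℝ) → ℝ} {f : (Fin N → ℝ) → EuclideanSpace ℝ (Fin d)}
  {W : ℝ≥0} {x : Fin N → ℝ}

theorem vecChainSum_add {q k p : ℤ} (hqk : q ≤ k) (hkp : k ≤ p) (x : Fin N → ℝ) :
    vecChainSum D K f q k x + vecChainSum D K f k p x = vecChainSum D K f q p x := by
  rw [vecChainSum, vecChainSum, vecChainSum, ← Finset.Ioc_union_Ioc_eq_Ioc hqk hkp,
    Finset.sum_union (Finset.disjoint_left.2 fun l hl hl' => by
      rw [Finset.mem_Ioc] at hl hl'; omega)]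

theorem IsShift.vecChainSum_eq_zero (hK : IsShift D (fun _ => A) r c K) {q p : ℤ}
    (hp : D.cubeAt p x ∉ D.cubeAt p '' Function.support f) : vecChainSum D K f q p x = 0 := by
  refine Finset.sum_eq_zero fun k hk => hK.vecPiece_eq_zero_of_notMem_image (fun h => hp ?_) x
  obtain ⟨y, hy, hyk⟩ := h
  exact ⟨y, hy, D.cubeAt_mono (Finset.mem_Ioc.1 hk).2 hyk⟩

/-- The limit lies in the closure, at a cost of `2 * d`. Using `2 * d + 1` keeps the factor at least
1 even for `d = 0`, so the same constant also covers finite gaps. -/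
theorem mem_smul_of_forall_mem (hf : Integrable f) {P : Cube N} {C : ℝ}
    {u : ℕ → EuclideanSpace ℝ (Fin d)} {w : EuclideanSpace ℝ (Fin d)}
    (hu : ∀ᶠ j in atTop, u j ∈ C • bodyAverage f (D.toSet P)) (hw : Tendsto u atTop (𝓝 w)) :
    w ∈ ((2 * d + 1) * C) • bodyAverage f (D.toSet P) := by
  have hB := isBody_bodyAverage (D := D) (Q := P) hf.integrableOn
  have h1 : w ∈ closure (C • bodyAverage f (D.toSet P)) := mem_closure_of_tendsto hw hu
  rw [closure_smul₀] at h1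
  obtain ⟨w', hw', rfl⟩ := h1
  have h2 := hB.closure_subset (isBounded_bodyAverage hf) hw'
  rw [finrank_euclideanSpace, Fintype.card_fin] at h2
  have h3 := hB.mono (by positivity) (show (2 * d : ℝ) ≤ 2 * d + 1 by linarith) h2
  obtain ⟨w'', hw'', rfl⟩ := h3
  refine ⟨w'', hw'', ?_⟩
  simp only [smul_smul, mul_comm]

section Stopping

variable {children : Cube N → Set (Cube N)} {G : Set (Cube N)} {C : ℝ}

/-- Decomposition of the sum over the small cubes that contain `x` along the stopping cubes that
contain `x`. -/
theorem exists_hasSum_stopGen (hN : 1 ≤ N) (hf : Integrable f) (hC : 0 ≤ C)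
    (hs : ∀ P, ∀ R ∈ children P, D.toSet R ⊂ D.toSet P)
    (hd : ∀ P, ∀ R ∈ children P, ∀ R' ∈ children P, D.toSet R ⊆ D.toSet R' → R = R')
    (hgap : ∀ P, ∀ x ∈ D.toSet P, ∀ q, (∀ R ∈ children P, x ∈ D.toSet R → R.scale ≤ q) →
      vecChainSum D K f q P.scale x ∈ C • bodyAverage f (D.toSet P))
    {q : ℕ → ℤ} (hq : Tendsto q atTop atBot) {M : ℕ}
    (hM : ∀ R ∈ stopGen children G M, x ∉ D.toSet R)
    (k n : ℕ) (hkn : n + k = M) (Q : Cube N) (hQ : Q ∈ stopGen children G n) (hx : x ∈ D.toSet Q)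
    (w : EuclideanSpace ℝ (Fin d))
    (hw : Tendsto (fun j => vecChainSum D K f (q j) Q.scale x) atTop (𝓝 w)) :
    ∃ v : Cube N → EuclideanSpace ℝ (Fin d),
      (∀ R, v R ∈ ((2 * d + 1) * C) • bodyAverage f (D.toSet R)) ∧
      (∀ R, v R ≠ 0 → x ∈ D.toSet R ∧ D.toSet R ⊆ D.toSet Q ∧ ∃ i, R ∈ stopGen children G i) ∧
      HasSum v w := by
  classical
  have hB : ∀ R, IsBody (bodyAverage f (D.toSet R)) := fun R => isBody_bodyAverage hf.integrableOn
  -- Induction on the number `k` of generations left before `M`, where no cube contains `x` any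
  -- more.
  induction k generalizing n Q w with
  | zero =>
    obtain rfl : n = M := hkn
    exact absurd hx (hM Q hQ)
  | succ k ih =>
    by_cases hex : ∃ R ∈ children Q, x ∈ D.toSet R
    -- The scales between the child `R` and `Q` are charged to `Q`; what lies below `R` is handled
    -- by the induction hypothesis.
    · obtain ⟨R, hR, hxR⟩ := hex
      have hRQ := D.scale_lt_of_ssubset hN (hs Q R hR)
      have hgapR : vecChainSum D K f R.scale Q.scale x ∈ C • bodyAverage f (D.toSet Q) := by
        refine hgap Q x hx _ fun R' hR' hxR' => ?_
        by_contra! hlt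
        have := hd Q R hR R' hR' (D.toSet_subset_of_mem hlt.le hxR hxR')
        rw [this] at hlt
        exact lt_irrefl _ hlt
      obtain ⟨v, hv, hv', hsum⟩ := ih (n + 1) (by omega) R (mem_stopGen_succ.2 ⟨Q, hQ, hR⟩) hxR
        (w - vecChainSum D K f R.scale Q.scale x) (by
          refine (hw.sub_const _).congr' ?_
          filter_upwards [hq.eventually_le_atBot R.scale] with j hj
          rw [← vecChainSum_add hj hRQ.le, add_sub_cancel_right])
      have hvQ : v Q = 0 := by
        by_contra h
        exact (hs Q R hR).not_subset (hv' Q h).2.1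
      refine ⟨fun R' => v R' + Pi.single (M := fun _ => EuclideanSpace ℝ (Fin d)) Q
        (vecChainSum D K f R.scale Q.scale x) R', fun R' => ?_, fun R' hR' => ?_, ?_⟩
      · by_cases h : R' = Q
        · subst h
          dsimp only
          rw [Pi.single_eq_same, hvQ, zero_add]
          exact (hB _).mono hC (by nlinarith [Nat.cast_nonneg (α := ℝ) d]) hgapR
        · dsimp only
          rw [Pi.single_eq_of_ne h, add_zero]
          exact hv R'
      · by_cases h : R' = Q
        · subst h
          exact ⟨hx, subset_rfl, n, hQ⟩
        · dsimp only at hR'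
          rw [Pi.single_eq_of_ne h, add_zero] at hR'
          obtain ⟨h1, h2, h3⟩ := hv' R' hR'
          exact ⟨h1, h2.trans (hs Q R hR).subset, h3⟩
      · have := hsum.add (hasSum_pi_single Q (vecChainSum D K f R.scale Q.scale x))
        rwa [sub_add_cancel] at this
    -- No stopping cube below `Q` contains `x`, so the whole tail down to scale `-∞` is charged to
    -- `Q`, through the limit.
    · push Not at hex
      refine ⟨Pi.single Q w, fun R' => ?_, fun R' hR' => ?_, hasSum_pi_single Q w⟩
      · by_cases h : R' = Q
        · subst h
          rw [Pi.single_eq_same]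
          exact mem_smul_of_forall_mem hf (.of_forall fun j =>
            hgap R' x hx _ fun R hR hxR => absurd hxR (hex R hR)) hw
        · rw [Pi.single_eq_of_ne h]
          exact (hB R').zero_mem_smul _
      · have h : R' = Q := by
          by_contra h
          exact hR' (Pi.single_eq_of_ne h _)
        subst h
        exact ⟨hx, subset_rfl, n, hQ⟩

end Stopping

section Large

variable {k₀ : ℤ} {m : ℕ}

/-- There are `m` cubes, each of volume at least `2 ^ (-m * N)` times that of the top one. The loss
depends on `ε`, through `m`, but not on `r`. -/
theorem IsShift.vecChainSum_mem_smul (hK : IsShift D (fun _ => A) r c K) (hf : Integrable f)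
    (p : ℤ) (x : Fin N → ℝ) : vecChainSum D K f p (p + m) x ∈
      (m * (A * (2 ^ m) ^ N) : ℝ) • bodyAverage f (D.toSet (D.cubeAt (p + m) x)) := by
  have hB := isBody_bodyAverage (D := D) (Q := D.cubeAt (p + m) x) hf.integrableOn
  have h := hB.sum_mem (Finset.Ioc p (p + m)) (a := fun _ => (A * (2 ^ m) ^ N : ℝ))
    (v := fun k => vecPiece K f (D.cubeAt k x) x) (fun _ _ => by positivity) fun k hk => by
      rw [Finset.mem_Ioc] at hk
      refine hK.vecPiece_mem_smul ?_ (D.cubeAt_subset hk.2 x) x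
      rw [D.volume_real_toSet, D.volume_real_toSet]
      simp only [DyadicLattice.cubeAt_scale]
      rw [mul_assoc, ← inv_pow, ← inv_pow, ← mul_pow]
      gcongr
      rw [← zpow_neg, ← zpow_neg, ← zpow_natCast, ← zpow_add₀ two_ne_zero]
      exact zpow_le_zpow_right₀ one_le_two (by omega)
  simpa [vecChainSum] using h

/-- The sum over the large cubes that contain `x`. -/
theorem IsShift.exists_hasSum_large (hK : IsShift D (fun _ => A) r c K) (hN : 1 ≤ N)
    (hf : Integrable f) (hm : 0 < m) (x : Fin N → ℝ) :
    ∃ v : Cube N → EuclideanSpace ℝ (Fin d),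
      (∀ R, v R ∈ (m * (A * (2 ^ m) ^ N) : ℝ) • bodyAverage f (D.toSet R)) ∧
      (∀ R, v R ≠ 0 → x ∈ D.toSet R ∧
        ∃ j : ℕ, R ∈ D.cubeAt (k₀ + m * (j + 1 : ℕ)) '' Function.support f) ∧
      ∃ w, HasSum v w ∧
        Tendsto (fun n : ℕ => vecChainSum D K f k₀ (k₀ + m * n) x) atTop (𝓝 w) := by
  have hB : ∀ R, IsBody (bodyAverage f (D.toSet R)) := fun R => isBody_bodyAverage hf.integrableOn
  set e : ℕ → Cube N := fun j => D.cubeAt (k₀ + m * (j + 1 : ℕ)) x with he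
  have hinj : Function.Injective e := fun i j h => by
    have h1 : k₀ + m * (i + 1 : ℕ) = k₀ + m * (j + 1 : ℕ) := congrArg Cube.scale h
    have h2 : (m : ℤ) * (i + 1 : ℕ) = m * (j + 1 : ℕ) := by linarith
    have h3 := mul_left_cancel₀ (by exact_mod_cast hm.ne') h2
    push_cast at h3
    omega
  set block : ℕ → EuclideanSpace ℝ (Fin d) := fun j =>
    vecChainSum D K f (k₀ + m * j) (k₀ + m * (j + 1 : ℕ)) x with hblock
  have hstep : ∀ j : ℕ, k₀ + m * (j + 1 : ℕ) = k₀ + m * j + m := fun j => by push_cast; ring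
  have hmem : ∀ j, block j ∈ (m * (A * (2 ^ m) ^ N) : ℝ) • bodyAverage f (D.toSet (e j)) :=
    fun j => by
      simp only [hblock, he, hstep]
      exact hK.vecChainSum_mem_smul hf _ x
  set ρ : ℝ := ((2 ^ m) ^ N)⁻¹ with hρ
  have hρ0 : 0 ≤ ρ := by positivity
  have hρ1 : ρ < 1 := by
    refine inv_lt_one_of_one_lt₀ (one_lt_pow₀ (one_lt_pow₀ one_lt_two hm.ne') (by omega))
  have hsummable : Summable block := by
    -- The averages of an integrable function decay like `|Q|⁻¹`, hence geometrically with ratio `ρ`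
    -- along the blocks.
    refine Summable.of_norm_bounded (g := fun j : ℕ =>
      (m * (A * (2 ^ m) ^ N)) * ((((2 : ℝ) ^ k₀) ^ N)⁻¹ * ρ * ∫ x, ‖f x‖) * ρ ^ j)
      ((summable_geometric_of_lt_one hρ0 hρ1).mul_left _) fun j => ?_
    obtain ⟨u, hu, hu'⟩ := hmem j
    have h1 := norm_le_of_mem_bodyAverage hf hu
    have h2 : (volume.real (D.toSet (e j)))⁻¹ = (((2 : ℝ) ^ k₀) ^ N)⁻¹ * ρ * ρ ^ j := by
      rw [D.volume_real_toSet]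
      simp only [he, DyadicLattice.cubeAt_scale]
      rw [mul_assoc, ← pow_succ', hρ, zpow_add₀ two_ne_zero, mul_pow, mul_inv, zpow_mul,
        zpow_natCast, zpow_natCast, inv_pow, ← pow_mul, ← pow_mul, ← pow_mul, ← pow_mul,
        mul_comm N]
    rw [← hu']
    dsimp only
    rw [norm_smul, Real.norm_of_nonneg (by positivity)]
    calc _ ≤ _ := mul_le_mul_of_nonneg_left h1 (by positivity)
      _ = _ := by rw [h2]; ring
  have hpartial : ∀ n : ℕ, ∑ j ∈ Finset.range n, block j =
      vecChainSum D K f k₀ (k₀ + m * n) x := fun n => by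
    induction n with
    | zero => simp [vecChainSum]
    | succ n ih =>
      rw [Finset.sum_range_succ, ih]
      exact vecChainSum_add (by nlinarith) (by push_cast; nlinarith) x
  refine ⟨Function.extend e block 0, fun R => ?_, fun R hR => ?_, _,
    (hasSum_extend_zero hinj).2 hsummable.hasSum, ?_⟩
  · by_cases h : ∃ j, e j = R
    · obtain ⟨j, rfl⟩ := h
      rw [hinj.extend_apply]
      exact hmem j
    · rw [Function.extend_apply' _ _ _ h]
      exact (hB R).zero_mem_smul _
  · by_cases h : ∃ j, e j = R
    · obtain ⟨j, rfl⟩ := h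
      rw [hinj.extend_apply] at hR
      refine ⟨D.mem_cubeAt _ x, j, ?_⟩
      by_contra h
      exact hR (hK.vecChainSum_eq_zero h)
    · exact absurd (Function.extend_apply' _ _ _ h) hR
  · simpa only [hpartial] using hsummable.hasSum.tendsto_sum_nat

end Large

theorem mem_smul_sparseOp (hf : Integrable f) {S : Set (Cube N)} {C : ℝ} (hC : 0 < C)
    {v : Cube N → EuclideanSpace ℝ (Fin d)} {w : EuclideanSpace ℝ (Fin d)}
    (hv : ∀ R, v R ∈ C • bodyAverage f (D.toSet R))
    (hvS : ∀ R, v R ≠ 0 → x ∈ D.toSet R ∧ R ∈ S) (hw : HasSum v w) :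
    w ∈ C • sparseOp D S f x := by
  rw [Set.mem_smul_set_iff_inv_smul_mem₀ hC.ne']
  refine ⟨fun Q => C⁻¹ • v Q, fun Q => ?_, ?_⟩
  · dsimp only
    by_cases h : v Q = 0
    · rw [h, smul_zero]
      exact (isBody_bodyAverage hf.integrableOn).zero_mem_smul _
    · rw [Set.indicator_of_mem (hvS Q h).1, one_smul, ← Set.mem_smul_set_iff_inv_smul_mem₀ hC.ne']
      exact hv Q
  · refine HasSum.const_smul C⁻¹ ?_
    exact (hasSum_subtype_iff_of_support_subset fun R hR => (hvS R hR).2).2 hw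

/-- The constant in the sparse domination theorem. -/
noncomputable def sparseConst (N d : ℕ) (ε : ℝ) (m : ℕ) : ℝ :=
  (2 * d + 1) * (d * ((1 + (2 ^ N : ℝ≥0)) * stopLevel d (weakConst N (2 ^ N)) ε)) +
    m * ((2 ^ N : ℝ≥0) * (2 ^ m) ^ N)

/-- Split the sum at `k₀`: the scales above are summed over blocks of length `m`, those below along
the stopping cubes containing `x`. A cube occurring in both halves receives the sum of its two
vectors, so the constants add. -/
theorem IsShift.exists_sparse (hK : IsShift D (fun _ => 2 ^ N) r c K) (hN : 1 ≤ N)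
    (hL : IsL2Contractive K)
    {T : Lp ℝ 2 (volume : Measure (Fin N → ℝ)) →L[ℝ] Lp ℝ 2 (volume : Measure (Fin N → ℝ))}
    (hT : IsL2Sum T (kernelPiece K)) {ε : ℝ} (hε0 : 0 < ε) (hε1 : ε < 1) {m : ℕ} (hm : 0 < m)
    (hmε : (2⁻¹ : ℝ) ^ m ≤ ε) (hf : Integrable f) (hfc : HasCompactSupport f) :
    ∃ (g : (Fin N → ℝ) → EuclideanSpace ℝ (Fin d)) (S : Set (Cube N)),
      IsVectorL1Value T f g ∧ D.IsSparse ε S ∧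
        ∀ᵐ x ∂(volume : Measure (Fin N → ℝ)), g x ∈ sparseConst N d ε m • sparseOp D S f x := by
  have hW := hasWeakType hN hK hL
  have hfs : Bornology.IsBounded (Function.support f) :=
    hfc.isCompact.isBounded.subset (subset_tsupport f)
  obtain ⟨k₀, hk₀⟩ := exists_stable_scale D hfs
  obtain ⟨g, hg, ns, hns, hae⟩ := hK.exists_isVectorL1Value hW (by simp [weakConst]) hT hf hfs k₀ hm
  choose children hs hd ht hgap using hK.exists_stopCubes hN hW hf hε0
  refine ⟨g, ⋃ n, sparseGen D children (Function.support f) k₀ m n, hg,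
    isSparse_sparseGen hN hm hmε hs hd ht hk₀, ?_⟩
  have hS : ∀ i, ∀ R ∈ stopGen children (D.cubeAt k₀ '' Function.support f) i,
      R ∈ ⋃ n, sparseGen D children (Function.support f) k₀ m n := fun i R hR =>
    Set.mem_iUnion.2 ⟨i, by rwa [sparseGen_natCast]⟩
  filter_upwards [hae, ae_exists_notMem_stopGen hε1 (finite_cubeAt_image D k₀ hfs) ht]
    with x hx ⟨M, hM⟩
  obtain ⟨v₂, hv₂, hv₂', w₂, hw₂, hlim⟩ :=
    hK.exists_hasSum_large (k₀ := k₀) hN hf hm x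
  have h3 := stopLevel_ge (d := d) (W := weakConst N (2 ^ N)) hε0
  have hC0 : 0 ≤ d * ((1 + (2 ^ N : ℝ≥0)) * stopLevel d (weakConst N (2 ^ N)) ε) := by positivity
  have hq : Tendsto (fun j => k₀ - (ns j : ℤ)) atTop atBot := by
    refine tendsto_atBot.2 fun b => ?_
    filter_upwards [hns.tendsto_atTop.eventually_ge_atTop (k₀ - b).natAbs] with j hj
    omega
  have hsmall : Tendsto (fun j => vecChainSum D K f (k₀ - (ns j : ℤ)) k₀ x) atTop
      (𝓝 (g x - w₂)) := by
    refine (hx.sub (hlim.comp hns.tendsto_atTop)).congr fun j => ?_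
    simp only [Function.comp_apply]
    rw [← vecChainSum_add (k := k₀) (by omega) (by nlinarith), add_sub_cancel_right]
  obtain ⟨v₁, hv₁, hv₁', hw₁⟩ : ∃ v : Cube N → EuclideanSpace ℝ (Fin d),
      (∀ R, v R ∈ ((2 * d + 1) * (d * ((1 + (2 ^ N : ℝ≥0)) *
        stopLevel d (weakConst N (2 ^ N)) ε))) • bodyAverage f (D.toSet R)) ∧
      (∀ R, v R ≠ 0 → x ∈ D.toSet R ∧ R ∈ ⋃ n, sparseGen D children (Function.support f) k₀ m n) ∧
      HasSum v (g x - w₂) := by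
    -- If the cube of scale `k₀` at `x` misses the support, it is not in the family, but then all
    -- small scales contribute zero.
    by_cases h0 : D.cubeAt k₀ x ∈ D.cubeAt k₀ '' Function.support f
    · obtain ⟨v, hv, hv', hvw⟩ := exists_hasSum_stopGen hN hf hC0 hs hd hgap hq hM M 0 (zero_add M)
        (D.cubeAt k₀ x) h0 (D.mem_cubeAt k₀ x) _ hsmall
      refine ⟨v, hv, fun R hR => ?_, hvw⟩
      obtain ⟨h1, -, i, hi⟩ := hv' R hR
      exact ⟨h1, hS i R hi⟩
    · have : g x - w₂ = 0 := by
        refine tendsto_nhds_unique hsmall ?_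
        simp only [hK.vecChainSum_eq_zero h0]
        exact tendsto_const_nhds
      rw [this]
      exact ⟨0, fun R => (isBody_bodyAverage hf.integrableOn).zero_mem_smul _,
        fun R hR => absurd rfl hR, hasSum_zero⟩
  refine mem_smul_sparseOp (v := fun R => v₁ R + v₂ R) hf ?_ (fun R => ?_) (fun R hR => ?_) ?_
  · unfold sparseConst
    positivity
  · exact (isBody_bodyAverage hf.integrableOn).add_mem (by positivity) (by positivity)
      (hv₁ R) (hv₂ R)
  · by_cases h : v₁ R = 0
    · have h2 : v₂ R ≠ 0 := fun h2 => hR (by simp [h, h2])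
      obtain ⟨h4, j, hj⟩ := hv₂' R h2
      exact ⟨h4, Set.mem_iUnion.2 ⟨-((j + 1 : ℕ) : ℤ), by rwa [sparseGen_neg]⟩⟩
    · exact hv₁' R h
  · simpa using hw₁.add hw₂

end ConvexBody

theorem theorem3p4 (N d : ℕ) (hN : 1 ≤ N) (ε : ℝ) (hε0 : 0 < ε) (hε1 : ε < 1) :
    ∃ C : ℝ, 0 < C ∧
      ∀ (D : ConvexBody.DyadicLattice N) (r : ℕ)
        (T : Lp ℝ 2 (volume : Measure (Fin N → ℝ)) →L[ℝ] Lp ℝ 2 (volume : Measure (Fin N → ℝ)))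
        (t : ConvexBody.Cube N → ((Fin N → ℝ) → ℝ) → (Fin N → ℝ) → ℝ),
        ConvexBody.IsL2Sum T t →
        ConvexBody.IsSeparated r t →
        ((∃ K : ConvexBody.Cube N → (Fin N → ℝ) → (Fin N → ℝ) → ℝ,
            D.IsBigHaarKernel r K ∧ t = ConvexBody.kernelPiece K) ∨
          (∃ b : (Fin N → ℝ) → ℝ, LocallyIntegrable b volume ∧ t = D.paraPiece r b ∧
            ‖T‖ ≤ (2 : ℝ) ^ (-((N : ℝ) * r / 2)))) →
        ∀ f : (Fin N → ℝ) → EuclideanSpace ℝ (Fin d),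
          Integrable f volume → HasCompactSupport f →
          ∃ (g : (Fin N → ℝ) → EuclideanSpace ℝ (Fin d)) (S : Set (ConvexBody.Cube N)),
            ConvexBody.IsVectorL1Value T f g ∧ D.IsSparse ε S ∧
              ∀ᵐ x ∂(volume : Measure (Fin N → ℝ)), g x ∈ C • ConvexBody.sparseOp D S f x := by
  -- The block length is determined by `ε` alone, so the constant is fixed before the lattice and
  -- the complexity.
  obtain ⟨m, hm⟩ := exists_pow_lt_of_lt_one hε0 (show (2⁻¹ : ℝ) < 1 by norm_num)
  have hm0 : 0 < m := by
    rcases Nat.eq_zero_or_pos m with rfl | h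
    · rw [pow_zero] at hm
      exact absurd hm hε1.not_gt
    · exact h
  refine ⟨ConvexBody.sparseConst N d ε m, ?_, fun D r T t hT ht h f hf hfc => ?_⟩
  · have h3 := ConvexBody.stopLevel_ge (d := d) (W := ConvexBody.weakConst N (2 ^ N)) hε0
    unfold ConvexBody.sparseConst
    positivity
  · obtain ⟨c, K, hK, hL, hTK⟩ := ConvexBody.exists_isShift hT ht h
    exact hK.exists_sparse hN hL hTK hε0 hε1 hm0 hm.le hf hfc
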